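/- **Setting.** Let $(\mathcal X,\rho_{\mathcal X})$ and $(\mathcal Y,\rho_{\mathcal Y})$ be separable metric spaces with their Borel $\sigma$-algebras, let $\alpha\ge 1$ and $\ell=\rho_{\mathcal Y}^{\alpha}$, and write $B_\ell(y,r)=\{z\in\mathcal Y:\ell(y,z)<r\}$. *Learning rules.* An online learning rule $f_\cdot$ consists of a measurable space $\mathcal R$, probability distributions $R_t$ on $\mathcal R$ and measurable maps $f_t:\mathcal R\times\mathcal X^{t-1}\times\mathcal Y^{t-1}\times\mathcal X\to\mathcal Y$, $t\ge1$; its prediction at time $t$ is $\hat Y_t=f_t(r_t;X_{<t},Y_{<t},X_t)$ with $r_t\sim R_t$. *Adversarial responses.* An adversarial process on a process $\mathbb X$ is a sequence $(X_t,Y_t)_{t\ge1}$, on a common probability space with the seeds $(r_t)$, such that $(X_t)_t$ has the law of $\mathbb X$ and, for all $t$, $r_t\sim R_t$ is independent of $((X_s)_{s\ge1},Y_{\le t},r_{<t})$ jointly; thus $Y_t$ may depend on the whole instance sequence, on the past, including the past seeds, and on extra randomness. It is *empirically integrable* if there is $y_0\in\mathcal Y$ such that for every $\epsilon>0$, almost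 surely there is $M\ge0$ with $\limsup_{T}\frac1T\sum_{t\le T}\ell(y_0,Y_t)\mathbb 1_{\ell(y_0,Y_t)\ge M}\le\epsilon$. *Consistency.* $f_\cdot$ is universally consistent under $\mathbb X$ if for every adversarial process on $\mathbb X$ with empirically integrable responses and every measurable $f^*:\mathcal X\to\mathcal Y$, almost surely $\limsup_T\frac1T\sum_{t\le T}\big(\ell(\hat Y_t,Y_t)-\ell(f^*(X_t),Y_t)\big)\le0$. $\mathrm{SOLAR}$ is the set of processes $\mathbb X$ (identified with their laws) under which some rule is universally consistent; a rule is *optimistically universal* if it is universally consistent under every $\mathbb X\in\mathrm{SOLAR}$. *Condition CS.* For measurable $A\subseteq\mathcal X$ put $\hat\mu_{\mathbb X}(A)=\limsup_T\frac1T\sum_{t\le T}\mathbb 1_A(X_t)$. $\mathbb X\in\mathrm{CS}$ if $\mathbb E[\hat\mu_{\mathbb X}(A_k)]\to0$ for all measurable $A_k\downarrow\emptyset$. *F-TiME.* A set $S\subseteq\mathcal Y$ satisfies F-TiME if for every $\eta>0$ there are $T\ge1$ and a (randomized) online learning rule $g_{\le T}$ without instances, with predictions in $\mathcal Y$, such that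 for all $y_1,\dots,y_T\in S$ and all $y\in S$, $\frac1T\,\mathbb E\big[\sum_{t=1}^T\ell(g_t(y_{<t}),y_t)-\ell(y,y_t)\big]\le\eta$. *The truncated Hedge rule.* Let $\mathcal T$ be a countable set of measurable subsets of $\mathcal X$ with $\inf_{G\in\mathcal T}\mathbb E[\hat\mu_{\mathbb X}(G\triangle A)]=0$ for all $\mathbb X\in\mathrm{CS}$ and all measurable $A$, let $(y^i)_{i\ge0}$ be dense in $\mathcal Y$, and enumerate, with indices $i\ge0$, all finite lists $((l_1,A_1),\dots,(l_k,A_k))$ with $k\ge0$, $l_p\in\mathbb N$, $A_p\in\mathcal T$, beginning with the empty list for $i=0$. The $i$-th list defines $f^i(x)=y^{l_j}$, where $j=\max\{0\le p\le k:x\in A_p\}$, $A_0=\mathcal X$, $l_0=0$; so $f^0=y^0$. For $t\ge1$ let $m_t=2^{1-\alpha}\ln t$; let $I_t$ be the set of $i\le\ln t$ such that all labels of the $i$-th list satisfy $\ell(y^{l_p},y^0)\le m_t$; let $t_i=\min\{t:i\in I_t\}$; let $\eta_t=\frac1{\sqrt t\,\ln t}$ for $t\ge2$ (the value of $\eta_1$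 is immaterial); let $\tilde y_t=y_t$ if $\ell(y_t,y^0)<m_t$, and $\tilde y_t=y^0$ otherwise. Recursively, with $$w_{t-1,i}=\exp\Big(\eta_t\sum_{s=t_i}^{t-1}\big(\hat\ell_s-\ell(f^i(x_s),\tilde y_s)\big)\Big),\quad p_t(i)=\frac{w_{t-1,i}}{\sum_{j\in I_t}w_{t-1,j}}\ (i\in I_t),\quad \hat\ell_t=\sum_{j\in I_t}p_t(j)\,\ell(f^j(x_t),\tilde y_t),$$ the rule draws at time $t$, with the fresh seed $r_t$, an index $i\in I_t$ with probability $p_t(i)$ and predicts $f^{i}(x_t)$. **Theorem.** Suppose that some ball $B_\ell(y,r)$ of $(\mathcal Y,\ell)$ does not satisfy F-TiME. Then $\mathrm{SOLAR}=\mathrm{CS}$. Moreover, data $(\mathcal T,(y^i),\text{enumeration})$ as above and a learning rule that is a truncated Hedge rule for them exist, and, for any such data, every truncated Hedge rule is optimistically universal, i.e. universally consistent under every $\mathbb X\in\mathrm{CS}$ for adversarial empirically integrable responses. -/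

import Mathlib

open MeasureTheory ProbabilityTheory Filter Topology
open scoped ENNReal

universe u

noncomputable section

/-! Time is indexed from `0`: index `t` stands for the round number `t + 1`. -/

/-- The loss `ℓ = ρ ^ α`. -/
def powLoss {Y : Type u} [MetricSpace Y] (α : ℝ) (a b : Y) : ℝ := dist a b ^ α

/-- An online learning rule: the prediction of round `t` is a jointly measurable function of a fresh
private seed of law `law t`, of the past instances and responses, and of the new instance. -/
structure LearningRule (X Y : Type u) [MeasurableSpace X] [MeasurableSpace Y] where
  /-- the space in which the private randomness of each round is drawn -/
  Seed : Type u
  [measurableSpaceSeed : MeasurableSpace Seed]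
  law : ℕ → ProbabilityMeasure Seed
  predict : (t : ℕ) → Seed → (Fin t → X) → (Fin t → Y) → X → Y
  measurable_predict : ∀ t, Measurable
    fun p : Seed × (Fin t → X) × (Fin t → Y) × X => predict t p.1 p.2.1 p.2.2.1 p.2.2.2

attribute [instance] LearningRule.measurableSpaceSeed

section Consistency

variable {X Y : Type u} [MeasurableSpace X] [MeasurableSpace Y] [MetricSpace Y]

/-- Sample space of the interaction with the rule `f`: the instances, the responses, the seeds. -/
abbrev LearningRule.Path (f : LearningRule X Y) : Type u :=
  (ℕ → X) × (ℕ → Y) × (ℕ → f.Seed)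

/-- `P` is the joint law of instances, responses and seeds when `f` faces an adversarial response
mechanism on a process of law `μ`. The response of round `t` may depend on the whole instance
sequence, on the earlier responses, on the earlier seeds and on additional randomness, but the seed
of round `t` is drawn from its law independently of all of these. -/
structure IsAdversarialProcess (f : LearningRule X Y) (μ : ProbabilityMeasure (ℕ → X))
    (P : ProbabilityMeasure f.Path) : Prop where
  instance_law : (P : Measure f.Path).map (fun ω => ω.1) = (μ : Measure (ℕ → X))
  seed_law : ∀ t, (P : Measure f.Path).map (fun ω => ω.2.2 t) = (f.law t : Measure f.Seed)
  seed_indep : ∀ t, IndepFun (fun ω : f.Path => ω.2.2 t)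
    (fun ω : f.Path => (ω.1, (fun s : Fin (t + 1) => ω.2.1 s), (fun s : Fin t => ω.2.2 s)))
    (P : Measure f.Path)

/-- Empirical integrability of a response process `Z` defined on a probability space. -/
def EmpiricallyIntegrable {Ω : Type u} [MeasurableSpace Ω] (α : ℝ) (P : ProbabilityMeasure Ω)
    (Z : Ω → ℕ → Y) : Prop :=
  ∃ y₀ : Y, ∀ ε : ℝ, 0 < ε → ∀ᵐ ω ∂(P : Measure Ω), ∃ M : ℝ, 0 ≤ M ∧
    limsup (fun T : ℕ => (((∑ t ∈ Finset.range T,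
      Set.indicator {z : Y | M ≤ powLoss α y₀ z} (fun z => powLoss α y₀ z) (Z ω t)) / T : ℝ) :
        EReal)) atTop ≤ (ε : EReal)

/-- The prediction of `f` in round `t` along the sample path `ω`. -/
def LearningRule.prediction (f : LearningRule X Y) (ω : f.Path) (t : ℕ) : Y :=
  f.predict t (ω.2.2 t) (fun s : Fin t => ω.1 s) (fun s : Fin t => ω.2.1 s) (ω.1 t)

/-- The long-run average excess loss of `f` over `g` along the sample path `ω`. -/
def LearningRule.excessLoss (α : ℝ) (f : LearningRule X Y) (g : X → Y) (ω : f.Path) : EReal :=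
  limsup (fun T : ℕ => (((∑ t ∈ Finset.range T,
    (powLoss α (f.prediction ω t) (ω.2.1 t) - powLoss α (g (ω.1 t)) (ω.2.1 t))) / T : ℝ) :
      EReal)) atTop

/-- Consistency of `f` when the joint law of the interaction is `P`. -/
def LearningRule.Consistent (α : ℝ) (f : LearningRule X Y) (P : ProbabilityMeasure f.Path) : Prop :=
  ∀ g : X → Y, Measurable g → ∀ᵐ ω ∂(P : Measure f.Path), f.excessLoss α g ω ≤ 0

/-- Universal consistency under the process of law `μ`, for empirically integrable adversarial
responses. -/
def LearningRule.UniversallyConsistent (α : ℝ) (f : LearningRule X Y)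
    (μ : ProbabilityMeasure (ℕ → X)) : Prop :=
  ∀ P : ProbabilityMeasure f.Path, IsAdversarialProcess f μ P →
    EmpiricallyIntegrable α P (fun ω => ω.2.1) → f.Consistent α P

variable (X Y) in
/-- `SOLAR`: the (laws of) processes under which some rule is universally consistent. -/
def SOLAR (α : ℝ) : Set (ProbabilityMeasure (ℕ → X)) :=
  {μ | ∃ f : LearningRule X Y, f.UniversallyConsistent α μ}

/-- `f` is universally consistent under every process under which some rule is. -/
def LearningRule.OptimisticallyUniversal (α : ℝ) (f : LearningRule X Y) : Prop :=
  ∀ μ ∈ SOLAR X Y α, f.UniversallyConsistent α μ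

end Consistency

section ContinuousSubmeasure

variable {X : Type u} [MeasurableSpace X]

/-- The upper frequency of visits of the sequence `x` to `A`. -/
def upperFreq (x : ℕ → X) (A : Set X) : ℝ≥0∞ :=
  limsup (fun T : ℕ => (∑ t ∈ Finset.range T, A.indicator (fun _ => (1 : ℝ≥0∞)) (x t)) / T) atTop

/-- The expected upper frequency of visits to `A` under a process of law `μ`. -/
def expUpperFreq (μ : ProbabilityMeasure (ℕ → X)) (A : Set X) : ℝ≥0∞ :=
  ∫⁻ x, upperFreq x A ∂(μ : Measure (ℕ → X))

variable (X) in
/-- The condition `CS` (continuous sub-measure). -/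
def CSProcesses : Set (ProbabilityMeasure (ℕ → X)) :=
  {μ | ∀ A : ℕ → Set X, (∀ k, MeasurableSet (A k)) → Antitone A → ⋂ k, A k = ∅ →
    Tendsto (fun k => expUpperFreq μ (A k)) atTop (𝓝 0)}

end ContinuousSubmeasure

section MeanEstimation

variable {Y : Type u} [MeasurableSpace Y] [MetricSpace Y]

/-- The ball `B_ℓ(y, r)`. -/
def lossBall (α : ℝ) (y : Y) (r : ℝ) : Set Y := {z | powLoss α y z < r}

/-- Finite-time mean estimation for values in `S`: for each `η > 0` there are a horizon `T` and a
(randomized) online learning rule without covariates whose expected average regret at time `T` is at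
most `η`, for all sequences of values in `S` and all reference values in `S`. As for every online
learning rule of the value space `Y`, the predictions are points of `Y`. The nonnegative losses are
integrated in `[0, ∞]`, and the reference loss is moved to the right-hand side. -/
def FTiMEOn (α : ℝ) (S : Set Y) : Prop :=
  ∀ η : ℝ, 0 < η → ∃ T : ℕ, 1 ≤ T ∧ ∃ g : LearningRule PUnit.{u + 1} Y,
    ∀ y : ℕ → Y, (∀ t < T, y t ∈ S) → ∀ c ∈ S,
      ∑ t ∈ Finset.range T, ∫⁻ r, ENNReal.ofReal
          (powLoss α (g.predict t r (fun _ => PUnit.unit) (fun s : Fin t => y s) PUnit.unit) (y t))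
          ∂(g.law t : Measure g.Seed)
        ≤ ∑ t ∈ Finset.range T, ENNReal.ofReal (powLoss α c (y t)) + ENNReal.ofReal (η * T)

end MeanEstimation

section Hedge

variable {X Y : Type u} [MetricSpace Y]

open scoped Classical in
/-- The simple function `x ↦ y^{l_j}`, with `j` the last index such that `x ∈ A_j`, coded by the list
`[(l_1, A_1), …, (l_k, A_k)]`; its value is `y^0` where there is no such index. -/
def simpleOfCode (y : ℕ → Y) (c : List (ℕ × Set X)) (x : X) : Y :=
  c.foldl (fun v p => if x ∈ p.2 then y p.1 else v) (y 0)

open scoped Classical in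
/-- The truncation at level `M` around `y₀`. -/
def truncate (α : ℝ) (y₀ : Y) (M : ℝ) (z : Y) : Y := if powLoss α z y₀ < M then z else y₀

/-- The truncation level of round number `t + 1`. -/
def hedgeLevel (α : ℝ) (t : ℕ) : ℝ := (2 : ℝ) ^ (1 - α) * Real.log (t + 1)

/-- The learning rate of round number `t + 1`. -/
def hedgeRate (t : ℕ) : ℝ := 1 / (Real.log (t + 1) * Real.sqrt (t + 1))

open scoped Classical in
/-- The indices of the experts in use in round number `t + 1`: those `i ≤ log (t + 1)` all of whose
labels `l` satisfy `ℓ(y^l, y^0) ≤ 2 ^ (1 - α) * log (t + 1)`. (As `log (t + 1) ≤ t`, the `range` is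
no restriction.) -/
def hedgeActive (α : ℝ) (y : ℕ → Y) (e : ℕ → List (ℕ × Set X)) (t : ℕ) : Finset ℕ :=
  (Finset.range (t + 1)).filter fun i =>
    (i : ℝ) ≤ Real.log (t + 1) ∧ ∀ p ∈ e i, powLoss α (y p.1) (y 0) ≤ hedgeLevel α t

/-- The loss of expert `i` in round `t` with respect to the truncated response. -/
def hedgeExpertLoss (α : ℝ) (y : ℕ → Y) (e : ℕ → List (ℕ × Set X)) (xs : ℕ → X) (ys : ℕ → Y)
    (t i : ℕ) : ℝ :=
  powLoss α (simpleOfCode y (e i) (xs t)) (truncate α (y 0) (hedgeLevel α t) (ys t))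

/-- Exponential weights on the finite set `I`, at rate `η`, for the regrets `R`. -/
def expWeight (η : ℝ) (R : ℕ → ℝ) (I : Finset ℕ) (i : ℕ) : ℝ :=
  Real.exp (η * R i) / ∑ j ∈ I, Real.exp (η * R j)

open scoped Classical in
/-- `hedgeRegret … t i` is the sum, over the rounds `s < t` at which expert `i` was in use, of the
mean loss of the forecaster minus the loss of the expert. (The sets `hedgeActive` are increasing, so
these are the rounds from the first one at which `i` is in use.) It only depends on the instances
and responses of the rounds `s < t`. -/
def hedgeRegret (α : ℝ) (y : ℕ → Y) (e : ℕ → List (ℕ × Set X)) (xs : ℕ → X) (ys : ℕ → Y) :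
    ℕ → ℕ → ℝ
  | 0 => fun _ => 0
  | t + 1 => fun i =>
      hedgeRegret α y e xs ys t i +
        if i ∈ hedgeActive α y e t then
          (∑ j ∈ hedgeActive α y e t,
              expWeight (hedgeRate t) (hedgeRegret α y e xs ys t) (hedgeActive α y e t) j *
                hedgeExpertLoss α y e xs ys t j)
            - hedgeExpertLoss α y e xs ys t i
        else 0

/-- The probability with which expert `i` is selected in round `t`. -/
def hedgeProb (α : ℝ) (y : ℕ → Y) (e : ℕ → List (ℕ × Set X)) (xs : ℕ → X) (ys : ℕ → Y)
    (t i : ℕ) : ℝ :=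
  expWeight (hedgeRate t) (hedgeRegret α y e xs ys t) (hedgeActive α y e t) i

/-- Admissible data of the Hedge variant: a countable family `𝒯` of measurable sets that is dense for
the expected upper frequency of visits under every `CS` process, a dense sequence `y` of values, and
an enumeration `e` of all codes of simple functions with labels in `y` and sets in `𝒯`, starting
with the code of the constant function `y 0`. -/
structure IsHedgeData [MeasurableSpace X] (𝒯 : Set (Set X)) (y : ℕ → Y)
    (e : ℕ → List (ℕ × Set X)) : Prop where
  countable : 𝒯.Countable
  measurable : ∀ A ∈ 𝒯, MeasurableSet A
  dense_sets : ∀ μ ∈ CSProcesses X, ∀ A : Set X, MeasurableSet A →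
    ⨅ G ∈ 𝒯, expUpperFreq μ (symmDiff G A) = 0
  dense_values : DenseRange y
  range_codes : Set.range e = {c | ∀ p ∈ c, p.2 ∈ 𝒯}
  code_zero : e 0 = []

/-- `f` is the truncated Hedge variant with data `(y, e)`: in each round, given the past and the new
instance, it draws an index `i` in use with probability `hedgeProb … i` and predicts the value at
the new instance of the simple function number `i`. -/
def LearningRule.IsTruncatedHedge [MeasurableSpace X] [MeasurableSpace Y] (α : ℝ)
    (f : LearningRule X Y) (y : ℕ → Y) (e : ℕ → List (ℕ × Set X)) : Prop :=
  ∀ (xs : ℕ → X) (ys : ℕ → Y) (t : ℕ),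
    (f.law t : Measure f.Seed).map
        (fun r => f.predict t r (fun s : Fin t => xs s) (fun s : Fin t => ys s) (xs t)) =
      ∑ i ∈ hedgeActive α y e t,
        ENNReal.ofReal (hedgeProb α y e xs ys t i) •
          Measure.dirac (simpleOfCode y (e i) (xs t))

end Hedge

end

/-! Sufficiency of `CS`. Fix a measurable comparison function `g` and an expert `i`. In each round,
once `i` is in use, the excess loss of the truncated Hedge rule is at most a sum of four terms
(`excess_le_of_mem_hedgeActive`): the deviation of the realised loss from its mean given the past,
the regret of the mean loss against expert `i`, the positive part of the excess of expert `i` over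
`g`, and a multiple of the part of `ℓ(y^0, Y_t)` above the truncation level. Each has a small
average. The deviations are orthogonal and of logarithmic size, so they obey a strong law
(`ae_eventually_abs_sum_le`). The regret bound is deterministic: exponential weights with about `log
t` experts, losses at most `2 log t` and rate `1 / (√t log t)` give regret `o(T)` on every sequence
(`eventually_sum_hedgeMeanLoss_sub_le`). Truncation costs nothing asymptotically, because
empirically integrable responses are uniformly integrable in the empirical averages and the levels
tend to infinity. The approximation uses `CS`: off a set of small expected upper frequency, `g` is
close to a simple function built on `𝒯` (`IsHedgeData.exists_expert_approx`). Taking errors `2^(-k)`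
makes the exceptional frequencies almost surely summable, so one null set serves all responses
(`IsHedgeData.ae_exists_expert`).

Necessity of `CS`. If `CS` fails, some sets decreasing to `∅` keep being visited with frequency
above a fixed `δ`, with probability at least `δ`. Differences of these sets give disjoint targets
and successive stages of time; during each stage its own target is visited a fixed fraction of the
time, with probability bounded below (`nonempty_visitStages`). Each stage hosts a hard mean
estimation problem, and the comparison function takes one constant value on each target. The number
of visits in a stage is random, while the failure of F-TiME concerns deterministic horizons. The
adversary, however, knows all the instances and may let the responses depend on that number.
`exists_hard_sequences` exploits this: F-TiME is refuted at a horizon divisible by every possible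
number `n` of visits, against the learner restarted every `n` rounds, and for each `n` the worst
block is kept. The comparison value is common to all `n`, so the comparison function does not depend
on the path. Predictions are clipped to a neighbourhood of the ball, which makes losses bounded
without increasing them. The stages are filled one after the other, and the data of a later stage do
not influence a successful earlier one. A stage is long compared with all that precedes it, so
consistency forces the positive part of its average excess to vanish almost surely on success;
dominated convergence then contradicts the lower bound on the expected excess. -/

noncomputable section

/-! ### Quasi-triangle inequalities for the power loss -/

section PowLoss

variable {Y : Type u} [MetricSpace Y] {α : ℝ}

theorem powLoss_nonneg (a b : Y) : 0 ≤ powLoss α a b := Real.rpow_nonneg dist_nonneg _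

theorem powLoss_comm (a b : Y) : powLoss α a b = powLoss α b a := by
  rw [powLoss, powLoss, dist_comm]

theorem powLoss_self (hα : 1 ≤ α) (a : Y) : powLoss α a a = 0 := by
  rw [powLoss, dist_self, Real.zero_rpow (by linarith)]

/-- Convexity of `x ↦ x ^ α` at the points `b / l` and `d / (1 - l)` with weights `l` and `1 - l`.
-/
theorem add_rpow_le_weighted (hα : 1 ≤ α) {l b d : ℝ} (hl : 0 < l) (hl1 : l < 1) (hb : 0 ≤ b)
    (hd : 0 ≤ d) : (b + d) ^ α ≤ l ^ (1 - α) * b ^ α + (1 - l) ^ (1 - α) * d ^ α := by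
  have hm : 0 < 1 - l := by linarith
  have h := (convexOn_rpow hα).2 (x := b / l) (y := d / (1 - l)) (by
    simp only [Set.mem_Ici]; positivity) (by simp only [Set.mem_Ici]; positivity) hl.le hm.le
    (by ring)
  simp only [smul_eq_mul] at h
  rw [mul_div_cancel₀ _ hl.ne', mul_div_cancel₀ _ hm.ne', Real.div_rpow hb hl.le,
    Real.div_rpow hd hm.le] at h
  rw [Real.rpow_sub hl, Real.rpow_sub hm, Real.rpow_one, Real.rpow_one]
  rw [div_mul_eq_mul_div, div_mul_eq_mul_div, mul_div_assoc, mul_div_assoc]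
  exact h

theorem powLoss_triangle (hα : 1 ≤ α) (a b c : Y) :
    powLoss α a c ≤ (2 : ℝ) ^ (α - 1) * (powLoss α a b + powLoss α b c) := by
  have h := add_rpow_le_weighted hα (l := 1 / 2) (by norm_num) (by norm_num)
    (dist_nonneg (x := a) (y := b)) (dist_nonneg (x := b) (y := c))
  have h2 : (1 / 2 : ℝ) ^ (1 - α) = 2 ^ (α - 1) := by
    rw [one_div, Real.inv_rpow (by norm_num), ← Real.rpow_neg (by norm_num)]; congr 1; ring
  rw [show (1 : ℝ) - 1 / 2 = 1 / 2 by norm_num, h2] at h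
  calc powLoss α a c ≤ (dist a b + dist b c) ^ α :=
        Real.rpow_le_rpow dist_nonneg (dist_triangle a b c) (by linarith)
    _ ≤ _ := by rw [powLoss, powLoss]; linarith

/-- Let `l` tend to `1` from below in the weighted inequality. A coefficient close to `1` in front
of the reference loss is essential: the factor `2 ^ (α - 1)` of `powLoss_triangle` would survive in
an average excess loss. -/
theorem exists_powLoss_le_add (hα : 1 ≤ α) {ε : ℝ} (hε : 0 < ε) :
    ∃ C : ℝ, 0 < C ∧ ∀ a b c : Y, powLoss α a c ≤ (1 + ε) * powLoss α b c + C * powLoss α a b := by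
  have hc : Tendsto (fun l : ℝ => l ^ (1 - α)) (𝓝[<] 1) (𝓝 ((1 : ℝ) ^ (1 - α))) :=
    ((Real.continuousAt_rpow_const 1 (1 - α) (Or.inl one_ne_zero)).tendsto).mono_left
      nhdsWithin_le_nhds
  rw [Real.one_rpow] at hc
  obtain ⟨l, h1, h2, h3⟩ := ((hc.eventually_lt_const (by linarith : (1 : ℝ) < 1 + ε)).and
    ((Ioo_mem_nhdsLT (zero_lt_one (α := ℝ))))).exists
  refine ⟨(1 - l) ^ (1 - α), Real.rpow_pos_of_pos (by linarith) _, fun a b c => ?_⟩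
  have h := add_rpow_le_weighted hα h2 h3
    (dist_nonneg (x := b) (y := c)) (dist_nonneg (x := a) (y := b))
  calc powLoss α a c ≤ (dist b c + dist a b) ^ α :=
        Real.rpow_le_rpow dist_nonneg ((dist_triangle a b c).trans (add_comm (dist a b) (dist b c)).le)
          (by linarith)
    _ ≤ _ := h
    _ ≤ _ := add_le_add (mul_le_mul_of_nonneg_right h1.le (powLoss_nonneg b c)) le_rfl

variable [SecondCountableTopology Y] [MeasurableSpace Y] [BorelSpace Y]

theorem Measurable.powLoss {Ω : Type*} [MeasurableSpace Ω] {f g : Ω → Y} (hf : Measurable f)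
    (hg : Measurable g) : Measurable fun ω => powLoss α (f ω) (g ω) :=
  (hf.dist hg).pow_const α

end PowLoss

/-! ### Uniform integrability with respect to empirical averages -/

section UniformIntegrability

/-- Uniform integrability of a real sequence with respect to the empirical averages. -/
def SeqUI (a : ℕ → ℝ) : Prop :=
  ∀ ε : ℝ, 0 < ε → ∃ M : ℝ, 0 ≤ M ∧ ∀ᶠ T : ℕ in atTop,
    ∑ t ∈ Finset.range T, (if M ≤ a t then a t else 0) ≤ ε * T

/-- Terms below `M` cost at most `M * v t`, the others at most `ε * T` together. The bound is
uniform in `v`, which will be the indicator of visits to a rare set. -/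
theorem SeqUI.sum_mul_le {a : ℕ → ℝ} (h : SeqUI a) {ε : ℝ} (hε : 0 < ε) :
    ∃ M : ℝ, 0 ≤ M ∧ ∀ᶠ T : ℕ in atTop, ∀ v : ℕ → ℝ, (∀ t, 0 ≤ v t) → (∀ t, v t ≤ 1) →
      ∑ t ∈ Finset.range T, a t * v t ≤ M * ∑ t ∈ Finset.range T, v t + ε * T := by
  obtain ⟨M, hM, hev⟩ := h ε hε
  refine ⟨M, hM, hev.mono fun T hT v hv0 hv1 => ?_⟩
  calc ∑ t ∈ Finset.range T, a t * v t
      ≤ ∑ t ∈ Finset.range T, (M * v t + if M ≤ a t then a t else 0) := by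
        refine Finset.sum_le_sum fun t _ => ?_
        split_ifs with h
        · nlinarith [hv0 t, hv1 t, mul_nonneg hM (hv0 t)]
        · nlinarith [hv0 t]
    _ = M * ∑ t ∈ Finset.range T, v t + ∑ t ∈ Finset.range T, (if M ≤ a t then a t else 0) := by
        rw [Finset.sum_add_distrib, Finset.mul_sum]
    _ ≤ _ := by linarith

theorem SeqUI.sum_le {a : ℕ → ℝ} (h : SeqUI a) :
    ∃ C : ℝ, 0 ≤ C ∧ ∀ᶠ T : ℕ in atTop, ∑ t ∈ Finset.range T, a t ≤ C * T := by
  obtain ⟨M, hM, hev⟩ := h.sum_mul_le one_pos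
  refine ⟨M + 1, by linarith, hev.mono fun T hT => ?_⟩
  have := hT (fun _ => 1) (fun _ => zero_le_one) (fun _ => le_rfl)
  simp only [mul_one, Finset.sum_const, Finset.card_range, nsmul_eq_mul] at this
  linarith

theorem sum_range_eventually_le {b : ℕ → ℝ} {t₀ : ℕ} (h : ∀ t, t₀ ≤ t → b t ≤ 0) {ε : ℝ}
    (hε : 0 < ε) : ∀ᶠ T : ℕ in atTop, ∑ t ∈ Finset.range T, b t ≤ ε * T := by
  have h1 : Tendsto (fun T : ℕ => ε * (T : ℝ)) atTop atTop :=
    tendsto_natCast_atTop_atTop.const_mul_atTop hε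
  filter_upwards [eventually_ge_atTop t₀,
    h1.eventually_ge_atTop (∑ t ∈ Finset.range t₀, b t)] with T hT hT'
  rw [← Finset.sum_range_add_sum_Ico _ hT]
  have : ∑ t ∈ Finset.Ico t₀ T, b t ≤ 0 :=
    Finset.sum_nonpos fun t ht => h t (Finset.mem_Ico.1 ht).1
  linarith

/-- A level tending to infinity eventually exceeds any fixed threshold, and finitely many early
rounds do not affect averages. Hence truncation at a slowly growing level is asymptotically free. -/
theorem SeqUI.sum_ge_level_le {a : ℕ → ℝ} (h : SeqUI a) (ha : ∀ t, 0 ≤ a t) {m : ℕ → ℝ}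
    (hm : Tendsto m atTop atTop) {ε : ℝ} (hε : 0 < ε) :
    ∀ᶠ T : ℕ in atTop, ∑ t ∈ Finset.range T, (if m t ≤ a t then a t else 0) ≤ ε * T := by
  obtain ⟨M, hM, hev⟩ := h (ε / 2) (by linarith)
  obtain ⟨t₀, ht₀⟩ := eventually_atTop.1 (hm.eventually_ge_atTop M)
  have h2 := sum_range_eventually_le (t₀ := t₀)
    (b := fun t => (if m t ≤ a t then a t else 0) - (if M ≤ a t then a t else 0))
    (fun t ht => by
      have := ht₀ t ht
      have := ha t
      split_ifs <;> linarith) (by linarith : 0 < ε / 2)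
  filter_upwards [hev, h2] with T h3 h4
  rw [Finset.sum_sub_distrib] at h4
  linarith

/-- A sequence dominated by an affine function of a uniformly integrable one is uniformly
integrable. -/
theorem SeqUI.of_le {a b : ℕ → ℝ} (h : SeqUI a) (ha : ∀ t, 0 ≤ a t) {C : ℝ} (hC : 0 < C)
    (hab : ∀ t, b t ≤ C * (a t + C)) : SeqUI b := by
  intro ε hε
  obtain ⟨M, hM, hev⟩ := h (ε / (2 * C)) (by positivity)
  -- If `b t` exceeds this threshold, then `max M C ≤ a t`, whence `b t ≤ 2 * C * a t`.
  refine ⟨C * (max M C + C), by positivity, hev.mono fun T hT => ?_⟩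
  calc ∑ t ∈ Finset.range T, (if C * (max M C + C) ≤ b t then b t else 0)
      ≤ ∑ t ∈ Finset.range T, (2 * C) * (if M ≤ a t then a t else 0) := by
        refine Finset.sum_le_sum fun t _ => ?_
        have h1 := hab t
        have h0 := ha t
        by_cases h2 : C * (max M C + C) ≤ b t
        · have h3 : max M C ≤ a t := by
            have := le_of_mul_le_mul_left (h2.trans h1) hC
            linarith
          rw [if_pos h2, if_pos ((le_max_left _ _).trans h3)]
          have := (le_max_right M C).trans h3
          nlinarith
        · rw [if_neg h2]
          split_ifs <;> positivity
    _ = (2 * C) * ∑ t ∈ Finset.range T, (if M ≤ a t then a t else 0) := by rw [Finset.mul_sum]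
    _ ≤ (2 * C) * (ε / (2 * C) * T) := by gcongr
    _ = ε * T := by field_simp

theorem sum_le_of_limsup_lt {a : ℕ → ℝ} {c : ℝ}
    (h : limsup (fun T : ℕ => (((∑ t ∈ Finset.range T, a t) / T : ℝ) : EReal)) atTop < c) :
    ∀ᶠ T : ℕ in atTop, ∑ t ∈ Finset.range T, a t ≤ c * T := by
  filter_upwards [eventually_lt_of_limsup_lt h, eventually_gt_atTop 0] with T hT h0
  have h0' : (0 : ℝ) < T := by exact_mod_cast h0
  exact ((div_lt_iff₀ h0').1 (EReal.coe_lt_coe_iff.1 hT)).le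

theorem limsup_le_of_sum_le {a : ℕ → ℝ}
    (h : ∀ c : ℝ, 0 < c → ∀ᶠ T : ℕ in atTop, ∑ t ∈ Finset.range T, a t ≤ c * T) :
    limsup (fun T : ℕ => (((∑ t ∈ Finset.range T, a t) / T : ℝ) : EReal)) atTop ≤ 0 := by
  refine le_of_forall_gt_imp_ge_of_dense fun e he => ?_
  obtain ⟨c, hc0, hce⟩ := EReal.lt_iff_exists_real_btwn.1 he
  refine le_trans ?_ hce.le
  refine limsup_le_of_le (by isBoundedDefault) ?_
  filter_upwards [h c (by exact_mod_cast hc0), eventually_gt_atTop 0] with T hT h0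
  have h0' : (0 : ℝ) < T := by exact_mod_cast h0
  exact EReal.coe_le_coe_iff.2 ((div_le_iff₀ h0').2 hT)

variable {Y : Type u} [MetricSpace Y]

/-- The tolerances `1 / (n + 1)` reduce the almost sure statements to a single null set, and the
quasi-triangle inequality moves the centre to any chosen point. -/
theorem EmpiricallyIntegrable.ae_seqUI {Ω : Type u} [MeasurableSpace Ω] {α : ℝ} (hα : 1 ≤ α)
    {P : ProbabilityMeasure Ω} {Z : Ω → ℕ → Y} (h : EmpiricallyIntegrable α P Z) (y₀ : Y) :
    ∀ᵐ ω ∂(P : Measure Ω), SeqUI fun t => powLoss α y₀ (Z ω t) := by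
  obtain ⟨y₁, h⟩ := h
  have h' : ∀ᵐ ω ∂(P : Measure Ω), ∀ n : ℕ, ∃ M : ℝ, 0 ≤ M ∧
      limsup (fun T : ℕ => (((∑ t ∈ Finset.range T,
        Set.indicator {z : Y | M ≤ powLoss α y₁ z} (fun z => powLoss α y₁ z) (Z ω t)) / T : ℝ) :
          EReal)) atTop ≤ ((1 / ((n : ℝ) + 1) : ℝ) : EReal) :=
    ae_all_iff.2 fun n => h _ (by positivity)
  filter_upwards [h'] with ω hω
  have hUI : SeqUI fun t => powLoss α y₁ (Z ω t) := by
    intro ε hε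
    obtain ⟨n, hn⟩ := exists_nat_one_div_lt hε
    obtain ⟨M, hM, hl⟩ := hω n
    refine ⟨M, hM, ?_⟩
    convert sum_le_of_limsup_lt (hl.trans_lt (EReal.coe_lt_coe_iff.2 hn)) using 5
    simp [Set.indicator_apply]
  have hC : (0 : ℝ) < 2 ^ (α - 1) := by positivity
  refine hUI.of_le (fun t => powLoss_nonneg _ _)
    (C := 2 ^ (α - 1) + powLoss α y₀ y₁) (by linarith [powLoss_nonneg (α := α) y₀ y₁]) fun t => ?_
  have h1 := powLoss_triangle hα y₀ y₁ (Z ω t)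
  have h2 := powLoss_nonneg (α := α) y₀ y₁
  have h3 := powLoss_nonneg (α := α) y₁ (Z ω t)
  nlinarith

end UniformIntegrability

/-! ### Upper frequencies, approximation under `CS`, and existence of Hedge data -/

section UpperFreq

variable {X : Type u}

theorem upperFreq_mono (x : ℕ → X) {A B : Set X} (h : A ⊆ B) : upperFreq x A ≤ upperFreq x B := by
  refine limsup_le_limsup (Eventually.of_forall fun T => ?_)
  exact ENNReal.div_le_div_right
    (Finset.sum_le_sum fun t _ => Set.indicator_le_indicator_of_subset h (fun _ => zero_le) _) _

theorem upperFreq_le_one (x : ℕ → X) (A : Set X) : upperFreq x A ≤ 1 := by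
  refine limsup_le_of_le (by isBoundedDefault) (Eventually.of_forall fun T => ?_)
  refine ENNReal.div_le_of_le_mul ?_
  calc (∑ t ∈ Finset.range T, A.indicator (fun _ => (1 : ℝ≥0∞)) (x t))
      ≤ ∑ t ∈ Finset.range T, 1 :=
        Finset.sum_le_sum fun t _ => Set.indicator_le_self' (by simp) _
    _ = 1 * T := by simp

theorem upperFreq_union_le (x : ℕ → X) (A B : Set X) :
    upperFreq x (A ∪ B) ≤ upperFreq x A + upperFreq x B := by
  have hne : ∀ C : Set X, upperFreq x C ≠ ⊤ := fun C =>
    ne_top_of_le_ne_top ENNReal.one_ne_top (upperFreq_le_one x C)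
  refine ENNReal.le_of_forall_pos_le_add fun ε hε _ => ?_
  have hε' : (0 : ℝ≥0∞) < (ε : ℝ≥0∞) / 2 := by simp [hε.ne']
  have h := fun C : Set X => eventually_lt_of_limsup_lt
    (ENNReal.lt_add_right (hne C) hε'.ne' : upperFreq x C < _)
  refine limsup_le_of_le (by isBoundedDefault) (((h A).and (h B)).mono fun T hT => ?_)
  refine le_trans ?_ ((add_le_add hT.1.le hT.2.le).trans_eq
    (by rw [add_add_add_comm, ENNReal.add_halves]))
  rw [← ENNReal.add_div, ← Finset.sum_add_distrib]
  refine ENNReal.div_le_div_right (Finset.sum_le_sum fun t _ => ?_) _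
  by_cases hA : x t ∈ A <;> by_cases hB : x t ∈ B <;> simp [hA, hB]

theorem upperFreq_empty (x : ℕ → X) : upperFreq x ∅ = 0 := by
  simp [upperFreq]

open scoped Classical in
theorem sum_indicator_le_of_upperFreq_lt {x : ℕ → X} {A : Set X} {c : ℝ}
    (h : upperFreq x A < ENNReal.ofReal c) :
    ∀ᶠ T : ℕ in atTop, ∑ t ∈ Finset.range T, (if x t ∈ A then (1 : ℝ) else 0) ≤ c * T := by
  have hc : 0 < c := ENNReal.ofReal_pos.1 (lt_of_le_of_lt zero_le h)
  filter_upwards [eventually_lt_of_limsup_lt h, eventually_gt_atTop 0] with T hT h0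
  have h0' : (T : ℝ≥0∞) ≠ 0 := by exact_mod_cast h0.ne'
  have h1 := ((ENNReal.div_lt_iff (Or.inl h0') (Or.inl (ENNReal.natCast_ne_top T))).1 hT).le
  have h2 : (∑ t ∈ Finset.range T, A.indicator (fun _ => (1 : ℝ≥0∞)) (x t))
      = ENNReal.ofReal (∑ t ∈ Finset.range T, (if x t ∈ A then (1 : ℝ) else 0)) := by
    rw [ENNReal.ofReal_sum_of_nonneg fun t _ => by split_ifs <;> norm_num]
    refine Finset.sum_congr rfl fun t _ => ?_
    by_cases h : x t ∈ A <;> simp [h]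
  rw [h2, ← ENNReal.ofReal_natCast, ← ENNReal.ofReal_mul hc.le,
    ENNReal.ofReal_le_ofReal_iff (by positivity)] at h1
  exact h1

open scoped Classical in
theorem frequently_lt_sum_indicator {x : ℕ → X} {A : Set X} {c : ℝ}
    (h : ENNReal.ofReal c < upperFreq x A) (hc : 0 ≤ c) :
    ∃ᶠ T : ℕ in atTop, c * T < ∑ t ∈ Finset.range T, (if x t ∈ A then (1 : ℝ) else 0) := by
  have := frequently_lt_of_lt_limsup (by isBoundedDefault) h
  refine (this.and_eventually (eventually_gt_atTop 0)).mono fun T ⟨hT, h0⟩ => ?_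
  have h0' : (T : ℝ≥0∞) ≠ 0 := by exact_mod_cast h0.ne'
  have h1 := (ENNReal.lt_div_iff_mul_lt (Or.inl h0') (Or.inl (ENNReal.natCast_ne_top T))).1 hT
  have h2 : (∑ t ∈ Finset.range T, A.indicator (fun _ => (1 : ℝ≥0∞)) (x t))
      = ENNReal.ofReal (∑ t ∈ Finset.range T, (if x t ∈ A then (1 : ℝ) else 0)) := by
    rw [ENNReal.ofReal_sum_of_nonneg fun t _ => by split_ifs <;> norm_num]
    refine Finset.sum_congr rfl fun t _ => ?_
    by_cases h : x t ∈ A <;> simp [h]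
  rw [h2, ← ENNReal.ofReal_natCast, ← ENNReal.ofReal_mul hc,
    ENNReal.ofReal_lt_ofReal_iff_of_nonneg (by positivity)] at h1
  exact h1

variable [MeasurableSpace X]

theorem measurable_upperFreq {A : Set X} (hA : MeasurableSet A) :
    Measurable fun x : ℕ → X => upperFreq x A := by
  refine Measurable.limsup fun T => Measurable.div_const ?_ _
  exact Finset.measurable_fun_sum _ fun t _ =>
    (measurable_const.indicator hA).comp (measurable_pi_apply t)

theorem expUpperFreq_mono (μ : ProbabilityMeasure (ℕ → X)) {A B : Set X} (h : A ⊆ B) :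
    expUpperFreq μ A ≤ expUpperFreq μ B := lintegral_mono fun x => upperFreq_mono x h

theorem expUpperFreq_union_le (μ : ProbabilityMeasure (ℕ → X)) {A : Set X} (hA : MeasurableSet A)
    (B : Set X) : expUpperFreq μ (A ∪ B) ≤ expUpperFreq μ A + expUpperFreq μ B := by
  unfold expUpperFreq
  rw [← lintegral_add_left (measurable_upperFreq hA)]
  exact lintegral_mono fun x => upperFreq_union_le x A B

theorem expUpperFreq_empty (μ : ProbabilityMeasure (ℕ → X)) : expUpperFreq μ ∅ = 0 := by
  simp [expUpperFreq, upperFreq_empty]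

/-- Under a `CS` process, every set of the generated `σ`-algebra is approximated by the sets of an
algebra of sets. -/
theorem exists_symmDiff_expUpperFreq_lt {μ : ProbabilityMeasure (ℕ → X)} (hμ : μ ∈ CSProcesses X)
    {𝒜 : Set (Set X)} (hm : ∀ A ∈ 𝒜, MeasurableSet A) (h𝒜 : IsSetAlgebra 𝒜)
    {A : Set X} (hA : MeasurableSet[MeasurableSpace.generateFrom 𝒜] A) :
    ∀ ε : ℝ≥0∞, 0 < ε → ∃ G ∈ 𝒜, expUpperFreq μ (symmDiff G A) < ε := by
  have hle : MeasurableSpace.generateFrom 𝒜 ≤ ‹MeasurableSpace X› :=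
    MeasurableSpace.generateFrom_le hm
  induction A, hA using MeasurableSpace.generateFrom_induction with
  | hC t ht _ => exact fun ε hε => ⟨t, ht, by simpa [expUpperFreq_empty] using hε⟩
  | empty => exact fun ε hε => ⟨∅, h𝒜.empty_mem, by simpa [expUpperFreq_empty] using hε⟩
  | compl t ht ih =>
    intro ε hε
    obtain ⟨G, hG, h⟩ := ih ε hε
    refine ⟨Gᶜ, h𝒜.compl_mem hG, ?_⟩
    rwa [compl_symmDiff_compl]
  | iUnion s hs ih =>
    intro ε hε
    have hfin : ∀ n : ℕ, ∀ ε : ℝ≥0∞, 0 < ε →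
        ∃ G ∈ 𝒜, expUpperFreq μ (symmDiff G (⋃ k ∈ Finset.range n, s k)) < ε := by
      intro n
      induction n with
      | zero => exact fun ε hε => ⟨∅, h𝒜.empty_mem, by simpa [expUpperFreq_empty] using hε⟩
      | succ n ihn =>
        intro ε hε
        obtain ⟨G, hG, h⟩ := ihn (ε / 2) (ENNReal.half_pos hε.ne')
        obtain ⟨H, hH, h'⟩ := ih n (ε / 2) (ENNReal.half_pos hε.ne')
        refine ⟨G ∪ H, h𝒜.union_mem hG hH, ?_⟩
        have hmeas : MeasurableSet (symmDiff G (⋃ k ∈ Finset.range n, s k)) :=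
          (hm _ hG).symmDiff (Finset.measurableSet_biUnion _ fun k _ => hle _ (hs k))
        calc _ ≤ expUpperFreq μ (symmDiff G (⋃ k ∈ Finset.range n, s k) ∪ symmDiff H (s n)) := by
              refine expUpperFreq_mono μ ?_
              rw [Finset.range_add_one, Finset.set_biUnion_insert]
              intro x hx
              simp only [Set.mem_symmDiff, Set.mem_union] at hx ⊢
              tauto
          _ ≤ _ := expUpperFreq_union_le μ hmeas _
          _ < ε / 2 + ε / 2 := ENNReal.add_lt_add h h'
          _ = ε := ENNReal.add_halves ε
    -- The condition `CS` enters here, for the remainders of the union, which decrease to `∅`;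
    -- subadditivity of the frequency only handles finite unions.
    have hlim := hμ (fun n => (⋃ k, s k) \ ⋃ k ∈ Finset.range n, s k)
      (fun n => (MeasurableSet.iUnion fun k => hle _ (hs k)).diff
        (Finset.measurableSet_biUnion _ fun k _ => hle _ (hs k)))
      (fun m n hmn => Set.sdiff_subset_sdiff_right
        (Set.biUnion_subset_biUnion_left fun k hk => by
          simp only [Finset.mem_coe, Finset.mem_range] at hk ⊢; simpa using hk.trans_le hmn))
      (by
        ext x
        simp only [Set.mem_iInter, Set.mem_sdiff, Set.mem_iUnion, Finset.mem_range,
          Set.mem_empty_iff_false, iff_false, not_forall]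
        by_cases h : ∃ k, x ∈ s k
        · obtain ⟨k, hk⟩ := h
          exact ⟨k + 1, fun h => h.2 ⟨k, by simp, hk⟩⟩
        · exact ⟨0, fun h' => h h'.1⟩)
    obtain ⟨n, hn⟩ := (hlim.eventually_lt_const (ENNReal.half_pos hε.ne')).exists
    obtain ⟨G, hG, h⟩ := hfin n (ε / 2) (ENNReal.half_pos hε.ne')
    refine ⟨G, hG, ?_⟩
    have hmeas : MeasurableSet (symmDiff G (⋃ k ∈ Finset.range n, s k)) :=
      (hm _ hG).symmDiff (Finset.measurableSet_biUnion _ fun k _ => hle _ (hs k))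
    calc _ ≤ expUpperFreq μ (symmDiff G (⋃ k ∈ Finset.range n, s k) ∪
            ((⋃ k, s k) \ ⋃ k ∈ Finset.range n, s k)) := by
          refine expUpperFreq_mono μ ?_
          have hsub : (⋃ k ∈ Finset.range n, s k) ⊆ ⋃ k, s k :=
            Set.iUnion₂_subset fun k _ => Set.subset_iUnion s k
          intro x hx
          have := @hsub x
          simp only [Set.mem_symmDiff, Set.mem_union, Set.mem_sdiff] at hx ⊢
          tauto
      _ ≤ _ := expUpperFreq_union_le μ hmeas _
      _ < ε / 2 + ε / 2 := ENNReal.add_lt_add h hn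
      _ = ε := ENNReal.add_halves ε

/-- The algebra generated by a countable basis is countable and generates the Borel sets, so it can
serve as `𝒯` for all `CS` processes at once. -/
theorem exists_isHedgeData [TopologicalSpace X] [SecondCountableTopology X] [BorelSpace X]
    {Y : Type u} [MetricSpace Y] [TopologicalSpace.SeparableSpace Y] [Nonempty Y] :
    ∃ (𝒯 : Set (Set X)) (y : ℕ → Y) (e : ℕ → List (ℕ × Set X)), IsHedgeData 𝒯 y e := by
  obtain ⟨b, hbc, -, hb⟩ := TopologicalSpace.exists_countable_basis X
  have hgen : MeasurableSpace.generateFrom (generateSetAlgebra b) = ‹MeasurableSpace X› := by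
    rw [generateFrom_generateSetAlgebra_eq, ‹BorelSpace X›.measurable_eq, hb.borel_eq_generateFrom]
  have hm : ∀ A ∈ generateSetAlgebra b, MeasurableSet A := fun A hA => by
    rw [← hgen]; exact MeasurableSpace.measurableSet_generateFrom hA
  have hc : (generateSetAlgebra b).Countable := countable_generateSetAlgebra hbc
  obtain ⟨y, hy⟩ := TopologicalSpace.exists_dense_seq Y
  have hS : {c : List (ℕ × Set X) | ∀ p ∈ c, p.2 ∈ generateSetAlgebra b}.Countable := by
    have h1 : {p : ℕ × Set X | p.2 ∈ generateSetAlgebra b}.Countable := by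
      refine ((Set.countable_univ (α := ℕ)).prod hc).mono fun p hp => ?_
      exact Set.mem_prod.2 ⟨trivial, hp⟩
    have : Countable {p : ℕ × Set X | p.2 ∈ generateSetAlgebra b} := h1.to_subtype
    have h2 := Set.countable_range 
      (List.map (Subtype.val : {p : ℕ × Set X | p.2 ∈ generateSetAlgebra b} → ℕ × Set X))
    rwa [Set.range_list_map_coe] at h2
  obtain ⟨e, he⟩ := hS.exists_eq_range ⟨[], by simp⟩
  -- Shifting the enumeration puts the empty list at index `0`; the range is unchanged, since the
  -- empty list was already a code.
  refine ⟨generateSetAlgebra b, y, fun n => n.casesOn [] e, hc, hm, fun μ hμ A hA => ?_, hy, ?_,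
    rfl⟩
  · refine le_antisymm (le_of_forall_gt_imp_ge_of_dense fun ε hε => ?_) zero_le
    obtain ⟨G, hG, h⟩ := exists_symmDiff_expUpperFreq_lt hμ hm isSetAlgebra_generateSetAlgebra
      (A := A) (by rwa [hgen]) ε hε
    exact (iInf₂_le G hG).trans h.le
  · rw [he]
    ext c
    constructor
    · rintro ⟨n, rfl⟩
      cases n with
      | zero => rw [← he]; simp
      | succ n => exact ⟨n, rfl⟩
    · rintro ⟨n, rfl⟩
      exact ⟨n + 1, rfl⟩

end UpperFreq

/-! ### Causality and measurability of the Hedge probabilities -/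

section HedgeMeasurability

variable {X Y : Type u}

theorem simpleOfCode_mem (y : ℕ → Y) (c : List (ℕ × Set X)) (x : X) :
    simpleOfCode y c x = y 0 ∨ ∃ p ∈ c, simpleOfCode y c x = y p.1 := by
  classical
  unfold simpleOfCode
  generalize y 0 = v
  induction c generalizing v with
  | nil => simp
  | cons p c ih =>
    simp only [List.foldl_cons]
    rcases ih (if x ∈ p.2 then y p.1 else v) with h | ⟨q, hq, h⟩
    · rw [h]
      split_ifs
      · exact Or.inr ⟨p, by simp, rfl⟩
      · exact Or.inl rfl
    · exact Or.inr ⟨q, by simp [hq], h⟩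

theorem measurable_simpleOfCode [MeasurableSpace X] [MeasurableSpace Y] {y : ℕ → Y}
    {c : List (ℕ × Set X)} (hc : ∀ p ∈ c, MeasurableSet p.2) :
    Measurable (simpleOfCode y c) := by
  classical
  have : ∀ g : X → Y, Measurable g →
      Measurable fun x => c.foldl (fun v p => if x ∈ p.2 then y p.1 else v) (g x) := by
    induction c with
    | nil => exact fun g hg => hg
    | cons p c ih =>
      intro g hg
      simp only [List.foldl_cons]
      exact ih (fun q hq => hc q (by simp [hq])) _
        (Measurable.ite (hc p (by simp)) measurable_const hg)
  exact this _ measurable_const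

variable [MetricSpace Y] {α : ℝ} {y : ℕ → Y} {e : ℕ → List (ℕ × Set X)}

theorem hedgeRegret_congr {xs xs' : ℕ → X} {ys ys' : ℕ → Y} {t : ℕ}
    (hx : ∀ s < t, xs s = xs' s) (hy : ∀ s < t, ys s = ys' s) :
    hedgeRegret α y e xs ys t = hedgeRegret α y e xs' ys' t := by
  induction t with
  | zero => rfl
  | succ t ih =>
    have h := ih (fun s hs => hx s (by omega)) (fun s hs => hy s (by omega))
    have hl : hedgeExpertLoss α y e xs ys t = hedgeExpertLoss α y e xs' ys' t := by
      funext i; simp [hedgeExpertLoss, hx t (by omega), hy t (by omega)]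
    funext i
    simp only [hedgeRegret, h, hl]

theorem hedgeProb_congr {xs xs' : ℕ → X} {ys ys' : ℕ → Y} {t : ℕ}
    (hx : ∀ s < t, xs s = xs' s) (hy : ∀ s < t, ys s = ys' s) :
    hedgeProb α y e xs ys t = hedgeProb α y e xs' ys' t := by
  funext i
  simp only [hedgeProb, hedgeRegret_congr hx hy]

theorem zero_mem_hedgeActive (h0 : e 0 = []) (t : ℕ) : 0 ∈ hedgeActive α y e t := by
  have : (0 : ℝ) ≤ Real.log (t + 1) := Real.log_nonneg (by linarith [t.cast_nonneg (α := ℝ)])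
  simp [hedgeActive, h0, this]

theorem expWeight_nonneg (η : ℝ) (R : ℕ → ℝ) (I : Finset ℕ) (i : ℕ) : 0 ≤ expWeight η R I i :=
  div_nonneg (Real.exp_nonneg _) (Finset.sum_nonneg fun _ _ => Real.exp_nonneg _)

theorem sum_expWeight (η : ℝ) (R : ℕ → ℝ) {I : Finset ℕ} (hI : I.Nonempty) :
    ∑ i ∈ I, expWeight η R I i = 1 := by
  unfold expWeight
  rw [← Finset.sum_div]
  exact div_self (Finset.sum_pos (fun _ _ => Real.exp_pos _) hI).ne'

theorem hedgeProb_nonneg (xs : ℕ → X) (ys : ℕ → Y) (t i : ℕ) : 0 ≤ hedgeProb α y e xs ys t i :=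
  expWeight_nonneg _ _ _ _

theorem sum_hedgeProb (h0 : e 0 = []) (xs : ℕ → X) (ys : ℕ → Y) (t : ℕ) :
    ∑ i ∈ hedgeActive α y e t, hedgeProb α y e xs ys t i = 1 :=
  sum_expWeight _ _ ⟨0, zero_mem_hedgeActive h0 t⟩

variable [MeasurableSpace X] [MeasurableSpace Y]
variable [SecondCountableTopology Y] [BorelSpace Y]

theorem measurable_truncate (y₀ : Y) (M : ℝ) : Measurable (truncate α y₀ M) :=
  Measurable.ite (measurableSet_lt (measurable_id.powLoss measurable_const) measurable_const)
    measurable_id measurable_const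

theorem measurable_hedgeExpertLoss (he : ∀ i, ∀ p ∈ e i, MeasurableSet p.2) (t i : ℕ) :
    Measurable fun p : (ℕ → X) × (ℕ → Y) => hedgeExpertLoss α y e p.1 p.2 t i :=
  ((measurable_simpleOfCode (he i)).comp ((measurable_pi_apply t).comp measurable_fst)).powLoss
    ((measurable_truncate _ _).comp ((measurable_pi_apply t).comp measurable_snd))

theorem measurable_expWeight {Ω : Type*} [MeasurableSpace Ω] (η : ℝ) {R : Ω → ℕ → ℝ}
    (hR : ∀ i, Measurable fun ω => R ω i) (I : Finset ℕ) (i : ℕ) :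
    Measurable fun ω => expWeight η (R ω) I i :=
  (((hR i).const_mul η).exp).div
    (Finset.measurable_fun_sum _ fun j _ => ((hR j).const_mul η).exp)

theorem measurable_hedgeRegret (he : ∀ i, ∀ p ∈ e i, MeasurableSet p.2) (t i : ℕ) :
    Measurable fun p : (ℕ → X) × (ℕ → Y) => hedgeRegret α y e p.1 p.2 t i := by
  induction t generalizing i with
  | zero => exact measurable_const
  | succ t ih =>
    simp only [hedgeRegret]
    refine (ih i).add ?_
    split_ifs
    · exact (Finset.measurable_fun_sum _ fun j _ => (measurable_expWeight _ ih _ j).mul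
        (measurable_hedgeExpertLoss he t j)).sub (measurable_hedgeExpertLoss he t i)
    · exact measurable_const

theorem measurable_hedgeProb (he : ∀ i, ∀ p ∈ e i, MeasurableSet p.2) (t i : ℕ) :
    Measurable fun p : (ℕ → X) × (ℕ → Y) => hedgeProb α y e p.1 p.2 t i :=
  measurable_expWeight _ (fun j => measurable_hedgeRegret he t j) _ i

end HedgeMeasurability

/-! ### Sampling an index from a uniform variable -/

section InverseCdf

open scoped Classical in
/-- The index selected by inverting the cumulative distribution function of the weights `p`. -/
def cdfIndex (p : ℕ → ℝ) (t : ℕ) (r : ℝ) : ℕ :=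
  Nat.findGreatest (fun k => ∑ j ∈ Finset.range k, p j ≤ r) t

theorem cdfIndex_eq_iff {p : ℕ → ℝ} (hp : ∀ i, 0 ≤ p i) {t : ℕ}
    (hsum : ∑ i ∈ Finset.range (t + 1), p i = 1) {r : ℝ} (hr : r ∈ Set.Ico (0 : ℝ) 1) {i : ℕ}
    (hi : i ≤ t) : cdfIndex p t r = i ↔
      r ∈ Set.Ico (∑ j ∈ Finset.range i, p j) (∑ j ∈ Finset.range (i + 1), p j) := by
  classical
  have hmono : Monotone fun k => ∑ j ∈ Finset.range k, p j := fun a b hab =>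
    Finset.sum_le_sum_of_subset_of_nonneg (Finset.range_mono hab) fun j _ _ => hp j
  unfold cdfIndex
  rw [Nat.findGreatest_eq_iff]
  constructor
  · rintro ⟨-, h1, h2⟩
    constructor
    -- At index `0` the greatest-element search guarantees nothing, but the partial sum is empty and
    -- `0 ≤ r`.
    · rcases Nat.eq_zero_or_pos i with h | h
      · subst h; simpa using hr.1
      · exact h1 h.ne'
    · rcases hi.lt_or_eq with h | h
      · exact not_le.1 (h2 (Nat.lt_succ_self i) h)
      · rw [h, hsum]; exact hr.2
  · rintro ⟨h1, h2⟩
    exact ⟨hi, fun _ => h1, fun k hk _ h => absurd (h2.trans_le (hmono hk)) (not_lt.2 h)⟩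

theorem measurable_cdfIndex {Ω : Type*} [MeasurableSpace Ω] {p : Ω → ℕ → ℝ} {r : Ω → ℝ} (t : ℕ)
    (hp : ∀ i, Measurable fun ω => p ω i) (hr : Measurable r) :
    Measurable fun ω => cdfIndex (p ω) t (r ω) := by
  classical
  refine measurable_findGreatest fun k _ => ?_
  exact measurableSet_le (Finset.measurable_fun_sum _ fun j _ => hp j) hr

/-- The fibre over `i` is an interval between consecutive partial sums, of length `p i`. -/
theorem map_cdfIndex {p : ℕ → ℝ} (hp : ∀ i, 0 ≤ p i) {t : ℕ}
    (hsum : ∑ i ∈ Finset.range (t + 1), p i = 1) :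
    (volume.restrict (Set.Ico (0 : ℝ) 1)).map (cdfIndex p t) =
      ∑ i ∈ Finset.range (t + 1), ENNReal.ofReal (p i) • Measure.dirac i := by
  have hmono : Monotone fun k => ∑ j ∈ Finset.range k, p j := fun a b hab =>
    Finset.sum_le_sum_of_subset_of_nonneg (Finset.range_mono hab) fun j _ _ => hp j
  have hm : Measurable (cdfIndex p t) :=
    measurable_cdfIndex (p := fun _ : ℝ => p) t (fun _ => measurable_const) measurable_id
  refine Measure.ext_of_singleton fun i => ?_
  rw [Measure.map_apply hm (measurableSet_singleton i),
    Measure.restrict_apply (hm (measurableSet_singleton i))]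
  simp only [Measure.coe_finsetSum, Finset.sum_apply, Measure.smul_apply, smul_eq_mul,
    Measure.dirac_apply' _ (measurableSet_singleton i)]
  by_cases hi : i ∈ Finset.range (t + 1)
  · rw [Finset.sum_eq_single_of_mem i hi (fun j _ hj => by simp [hj])]
    have hi' : i ≤ t := by simpa [Nat.lt_succ_iff] using hi
    have : cdfIndex p t ⁻¹' {i} ∩ Set.Ico (0 : ℝ) 1 =
        Set.Ico (∑ j ∈ Finset.range i, p j) (∑ j ∈ Finset.range (i + 1), p j) := by
      ext r
      constructor
      · rintro ⟨h1, h2⟩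
        exact (cdfIndex_eq_iff hp hsum h2 hi').1 h1
      · intro h
        have h2 : r ∈ Set.Ico (0 : ℝ) 1 :=
          ⟨(Finset.sum_nonneg fun j _ => hp j).trans h.1,
            h.2.trans_le ((hmono (Nat.succ_le_succ hi')).trans_eq hsum)⟩
        exact ⟨(cdfIndex_eq_iff hp hsum h2 hi').2 h, h2⟩
    rw [this, Real.volume_Ico, Finset.sum_range_succ, add_sub_cancel_left]
    simp
  · rw [Finset.sum_eq_zero fun j hj => by
      have : j ≠ i := fun h => hi (h ▸ hj)
      simp [this]]
    have : cdfIndex p t ⁻¹' {i} = ∅ := by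
      ext r
      simp only [Set.mem_preimage, Set.mem_singleton_iff, Set.mem_empty_iff_false, iff_false]
      intro h
      exact hi (Finset.mem_range.2 (Nat.lt_succ_of_le (h ▸ Nat.findGreatest_le t)))
    simp [this]

end InverseCdf

/-! ### Construction of a truncated Hedge rule -/

section HedgeRule

variable {X Y : Type u} [MetricSpace Y] [MeasurableSpace X] [MeasurableSpace Y]

/-- A finite sequence, prolonged by a constant. -/
def extendSeq {Z : Type*} {t : ℕ} (z₀ : Z) (z : Fin t → Z) (s : ℕ) : Z :=
  if h : s < t then z ⟨s, h⟩ else z₀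

theorem extendSeq_apply {Z : Type*} {t : ℕ} (z₀ : Z) (z : ℕ → Z) {s : ℕ} (h : s < t) :
    extendSeq z₀ (fun s : Fin t => z s) s = z s := by
  simp [extendSeq, h]

theorem measurable_extendSeq {Z Ω : Type*} [MeasurableSpace Z] [MeasurableSpace Ω] {t : ℕ}
    {z₀ : Ω → Z} {z : Ω → Fin t → Z} (h₀ : Measurable z₀) (hz : Measurable z) :
    Measurable fun ω => extendSeq (z₀ ω) (z ω) := by
  refine measurable_pi_lambda _ fun s => ?_
  unfold extendSeq
  split_ifs with h
  · exact (measurable_pi_apply _).comp hz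
  · exact h₀

/-- The weights of the Hedge variant, extended by `0` to the experts that are not in use. -/
def hedgeWeight (α : ℝ) (y : ℕ → Y) (e : ℕ → List (ℕ × Set X)) (xs : ℕ → X) (ys : ℕ → Y)
    (t i : ℕ) : ℝ :=
  if i ∈ hedgeActive α y e t then hedgeProb α y e xs ys t i else 0

variable [SecondCountableTopology Y] [BorelSpace Y] {α : ℝ} {y : ℕ → Y}
  {e : ℕ → List (ℕ × Set X)}

theorem measurable_hedgeWeight (he : ∀ i, ∀ p ∈ e i, MeasurableSet p.2) (t i : ℕ) :
    Measurable fun p : (ℕ → X) × (ℕ → Y) => hedgeWeight α y e p.1 p.2 t i := by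
  unfold hedgeWeight
  split_ifs
  · exact measurable_hedgeProb he t i
  · exact measurable_const

/-- The truncated Hedge variant, which draws the index by inverting the cumulative distribution
function at a seed that is uniform in `[0, 1)`. -/
def hedgeRule (α : ℝ) (y : ℕ → Y) (e : ℕ → List (ℕ × Set X))
    (he : ∀ i, ∀ p ∈ e i, MeasurableSet p.2) : LearningRule X Y where
  Seed := ULift.{u} ℝ
  law _ := ⟨(volume.restrict (Set.Ico (0 : ℝ) 1)).map ULift.up, by
    have : IsProbabilityMeasure (volume.restrict (Set.Ico (0 : ℝ) 1)) := ⟨by simp⟩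
    exact Measure.isProbabilityMeasure_map measurable_up.aemeasurable⟩
  -- The padding of the past is immaterial: the weights of round `t` only read the earlier rounds.
  predict t r xs ys x := simpleOfCode y
    (e (cdfIndex (hedgeWeight α y e (extendSeq x xs) (extendSeq (y 0) ys) t) t r.down)) x
  measurable_predict t := by
    have hidx : Measurable fun p : ULift.{u} ℝ × (Fin t → X) × (Fin t → Y) × X =>
        cdfIndex (hedgeWeight α y e (extendSeq p.2.2.2 p.2.1) (extendSeq (y 0) p.2.2.1) t) t
          p.1.down := by
      refine measurable_cdfIndex t (fun i => ?_) (measurable_down.comp measurable_fst)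
      exact (measurable_hedgeWeight he t i).comp
        ((measurable_extendSeq (by fun_prop) (by fun_prop)).prodMk
          (measurable_extendSeq measurable_const (by fun_prop)))
    have h2 : Measurable fun q : ℕ × X => simpleOfCode y (e q.1) q.2 :=
      measurable_from_prod_countable_right fun i => measurable_simpleOfCode (he i)
    exact h2.comp (hidx.prodMk (by fun_prop))

theorem isTruncatedHedge_hedgeRule (he : ∀ i, ∀ p ∈ e i, MeasurableSet p.2) (h0 : e 0 = []) :
    (hedgeRule α y e he).IsTruncatedHedge α y e := by
  intro xs ys t
  have hw : hedgeWeight α y e (extendSeq (xs t) fun s : Fin t => xs s)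
      (extendSeq (y 0) fun s : Fin t => ys s) t = hedgeWeight α y e xs ys t := by
    funext i
    unfold hedgeWeight
    rw [hedgeProb_congr (xs' := xs) (ys' := ys) (fun s hs => extendSeq_apply _ _ hs)
      (fun s hs => extendSeq_apply _ _ hs)]
  have hnn : ∀ i, 0 ≤ hedgeWeight α y e xs ys t i := fun i => by
    unfold hedgeWeight
    split_ifs
    · exact hedgeProb_nonneg _ _ _ _
    · exact le_rfl
  have hsub : hedgeActive α y e t ⊆ Finset.range (t + 1) := Finset.filter_subset _ _
  have hsum : ∑ i ∈ Finset.range (t + 1), hedgeWeight α y e xs ys t i = 1 := by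
    unfold hedgeWeight
    rw [Finset.sum_ite_mem, Finset.inter_eq_right.2 hsub, sum_hedgeProb h0]
  have hidx : Measurable (cdfIndex (hedgeWeight α y e xs ys t) t) :=
    measurable_cdfIndex (p := fun _ : ℝ => _) t (fun _ => measurable_const) measurable_id
  have hg : Measurable fun i : ℕ => simpleOfCode y (e i) (xs t) := measurable_from_top
  have hlaw : ((volume.restrict (Set.Ico (0 : ℝ) 1)).map ULift.up.{u}).map ULift.down =
      volume.restrict (Set.Ico (0 : ℝ) 1) := by
    rw [Measure.map_map measurable_down measurable_up]
    exact Measure.map_id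
  change ((volume.restrict (Set.Ico (0 : ℝ) 1)).map ULift.up.{u}).map (fun r => simpleOfCode y
    (e (cdfIndex (hedgeWeight α y e (extendSeq (xs t) fun s : Fin t => xs s)
      (extendSeq (y 0) fun s : Fin t => ys s) t) t r.down)) (xs t)) = _
  rw [hw]
  change ((volume.restrict (Set.Ico (0 : ℝ) 1)).map ULift.up.{u}).map
    ((fun i : ℕ => simpleOfCode y (e i) (xs t)) ∘
      cdfIndex (hedgeWeight α y e xs ys t) t ∘ ULift.down) = _
  rw [← Measure.map_map hg (hidx.comp measurable_down),
    ← Measure.map_map hidx measurable_down, hlaw, map_cdfIndex hnn hsum,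
    Measure.map_finset_sum hg.aemeasurable]
  simp only [Measure.map_smul, Measure.map_dirac' hg]
  rw [← Finset.sum_subset hsub]
  · refine Finset.sum_congr rfl fun i hi => ?_
    simp [hedgeWeight, hi]
  · intro i _ hi
    simp [hedgeWeight, hi]

end HedgeRule

/-! ### Two inequalities for the exponential weights potential -/

section ExponentialWeights

/-- Jensen's inequality for the change of rate in the exponential weights potential. -/
theorem log_sum_exp_div_le {I : Finset ℕ} (hI : I.Nonempty) (R : ℕ → ℝ) {η η' : ℝ} (h' : 0 < η')
    (hle : η' ≤ η) :
    Real.log (∑ i ∈ I, Real.exp (η' * R i)) / η' ≤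
      Real.log (∑ i ∈ I, Real.exp (η * R i)) / η + Real.log I.card * (1 / η' - 1 / η) := by
  have hη : 0 < η := h'.trans_le hle
  have hN : (0 : ℝ) < I.card := by exact_mod_cast hI.card_pos
  have hS : 0 < ∑ i ∈ I, Real.exp (η * R i) := Finset.sum_pos (fun _ _ => Real.exp_pos _) hI
  have hS' : 0 < ∑ i ∈ I, Real.exp (η' * R i) := Finset.sum_pos (fun _ _ => Real.exp_pos _) hI
  have h := (Real.concaveOn_rpow (p := η' / η) (by positivity) ((div_le_one hη).2 hle)).le_map_sum
    (t := I) (w := fun _ => 1 / (I.card : ℝ)) (p := fun i => Real.exp (η * R i))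
    (fun _ _ => by positivity) (by simp [hN.ne']) (fun i _ => (Real.exp_pos _).le)
  simp only [smul_eq_mul, ← Finset.mul_sum, ← Real.exp_mul] at h
  have he : ∀ i, η * R i * (η' / η) = η' * R i := fun i => by field_simp
  simp only [he] at h
  have h2 := Real.log_le_log (by positivity) h
  rw [Real.log_mul (by positivity) hS'.ne', Real.log_rpow (by positivity),
    Real.log_mul (by positivity) hS.ne', one_div, Real.log_inv] at h2
  rw [div_le_iff₀ h']
  have h3 : (Real.log (∑ i ∈ I, Real.exp (η * R i)) / η + Real.log I.card * (1 / η' - 1 / η)) * η'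
      = η' / η * (-Real.log I.card + Real.log (∑ i ∈ I, Real.exp (η * R i)))
        + Real.log I.card := by
    field_simp
    ring
  linarith

/-- Use `exp x ≤ 1 + x + x ^ 2` for `|x| ≤ 1`. The linear term averages to zero under the current
weights, so only the quadratic one is left. -/
theorem sum_exp_update_le {I : Finset ℕ} (hI : I.Nonempty) (R r : ℕ → ℝ) {η b : ℝ} (hη : 0 ≤ η)
    (hb : η * b ≤ 1) (hr : ∀ i ∈ I, |r i| ≤ b) (hmean : ∑ i ∈ I, expWeight η R I i * r i = 0) :
    Real.log (∑ i ∈ I, Real.exp (η * (R i + r i))) ≤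
      Real.log (∑ i ∈ I, Real.exp (η * R i)) + (η * b) ^ 2 := by
  have hS : 0 < ∑ i ∈ I, Real.exp (η * R i) := Finset.sum_pos (fun _ _ => Real.exp_pos _) hI
  have hmean' : ∑ i ∈ I, Real.exp (η * R i) * r i = 0 := by
    have : ∑ i ∈ I, Real.exp (η * R i) * r i =
        (∑ j ∈ I, Real.exp (η * R j)) * ∑ i ∈ I, expWeight η R I i * r i := by
      rw [Finset.mul_sum]
      refine Finset.sum_congr rfl fun i _ => ?_
      unfold expWeight
      field_simp
    rw [this, hmean, mul_zero]
  have hle : ∑ i ∈ I, Real.exp (η * (R i + r i)) ≤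
      (∑ i ∈ I, Real.exp (η * R i)) * Real.exp ((η * b) ^ 2) := by
    calc ∑ i ∈ I, Real.exp (η * (R i + r i))
        ≤ ∑ i ∈ I, (Real.exp (η * R i) * (1 + (η * b) ^ 2) + η * (Real.exp (η * R i) * r i)) := by
          refine Finset.sum_le_sum fun i hi => ?_
          have hx : |η * r i| ≤ η * b := by
            rw [abs_mul, abs_of_nonneg hη]
            exact mul_le_mul_of_nonneg_left (hr i hi) hη
          have h1 := Real.abs_exp_sub_one_sub_id_le (hx.trans hb)
          have h2 : (η * r i) ^ 2 ≤ (η * b) ^ 2 := by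
            rw [← sq_abs]; exact pow_le_pow_left₀ (abs_nonneg _) hx 2
          have h3 : Real.exp (η * r i) ≤ 1 + (η * b) ^ 2 + η * r i := by
            linarith [(abs_le.1 h1).2]
          rw [mul_add, Real.exp_add]
          have h4 := mul_le_mul_of_nonneg_left h3 (Real.exp_pos (η * R i)).le
          linarith
      _ = (∑ i ∈ I, Real.exp (η * R i)) * (1 + (η * b) ^ 2) := by
          rw [Finset.sum_add_distrib, ← Finset.mul_sum, hmean', ← Finset.sum_mul]; ring
      _ ≤ _ := by
          refine mul_le_mul_of_nonneg_left ?_ hS.le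
          linarith [Real.add_one_le_exp ((η * b) ^ 2)]
  have := Real.log_le_log (Finset.sum_pos (fun _ _ => Real.exp_pos _) hI) hle
  rwa [Real.log_mul hS.ne' (Real.exp_pos _).ne', Real.log_exp] at this

end ExponentialWeights

/-! ### Deterministic regret bound for the Hedge variant -/

section HedgeRegret

variable {X Y : Type u} [MetricSpace Y] {α : ℝ} {y : ℕ → Y} {e : ℕ → List (ℕ × Set X)}

theorem hedgeLevel_nonneg (t : ℕ) : 0 ≤ hedgeLevel α t :=
  mul_nonneg (by positivity) (Real.log_nonneg (by linarith [t.cast_nonneg (α := ℝ)]))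

theorem tendsto_log_succ : Tendsto (fun t : ℕ => Real.log ((t : ℝ) + 1)) atTop atTop :=
  Real.tendsto_log_atTop.comp
    (tendsto_atTop_add_const_right _ _ tendsto_natCast_atTop_atTop)

theorem tendsto_hedgeLevel : Tendsto (hedgeLevel α) atTop atTop :=
  tendsto_log_succ.const_mul_atTop (by positivity)

theorem hedgeLevel_mono : Monotone (hedgeLevel α) := fun s t h => by
  unfold hedgeLevel
  gcongr

theorem hedgeActive_mono : Monotone (hedgeActive α y e) := fun s t h i hi => by
  simp only [hedgeActive, Finset.mem_filter, Finset.mem_range] at hi ⊢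
  have hl : Real.log ((s : ℝ) + 1) ≤ Real.log ((t : ℝ) + 1) := by gcongr
  exact ⟨by omega, hi.2.1.trans hl, fun p hp => (hi.2.2 p hp).trans (hedgeLevel_mono h)⟩

theorem eventually_mem_hedgeActive (i : ℕ) : ∀ᶠ t in atTop, i ∈ hedgeActive α y e t := by
  have h1 : ∀ᶠ t in atTop, ∀ p ∈ e i, powLoss α (y p.1) (y 0) ≤ hedgeLevel α t := by
    have : ∀ l : List (ℕ × Set X),
        ∀ᶠ t in atTop, ∀ p ∈ l, powLoss α (y p.1) (y 0) ≤ hedgeLevel α t := by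
      intro l
      induction l with
      | nil => simp
      | cons q l ih =>
        filter_upwards [ih, tendsto_hedgeLevel.eventually_ge_atTop (powLoss α (y q.1) (y 0))]
          with t h1 h2 p hp
        rcases List.mem_cons.1 hp with rfl | hp
        · exact h2
        · exact h1 p hp
    exact this _
  filter_upwards [h1, eventually_ge_atTop i, tendsto_log_succ.eventually_ge_atTop (i : ℝ)]
    with t h1 h2 h3
  simp only [hedgeActive, Finset.mem_filter, Finset.mem_range]
  exact ⟨by omega, h3, h1⟩

theorem card_hedgeActive_le (t : ℕ) :
    ((hedgeActive α y e t).card : ℝ) ≤ Real.log ((t : ℝ) + 1) + 1 := by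
  have hsub : hedgeActive α y e t ⊆ Finset.range (⌊Real.log ((t : ℝ) + 1)⌋₊ + 1) := fun i hi => by
    simp only [hedgeActive, Finset.mem_filter, Finset.mem_range] at hi ⊢
    exact Nat.lt_succ_of_le (Nat.le_floor hi.2.1)
  have h0 : 0 ≤ Real.log ((t : ℝ) + 1) := Real.log_nonneg (by linarith [t.cast_nonneg (α := ℝ)])
  calc ((hedgeActive α y e t).card : ℝ) ≤ ((⌊Real.log ((t : ℝ) + 1)⌋₊ + 1 : ℕ) : ℝ) := by
        exact_mod_cast (Finset.card_le_card hsub).trans_eq (Finset.card_range _)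
    _ ≤ _ := by push_cast; linarith [Nat.floor_le h0]

theorem powLoss_simpleOfCode_le (hα : 1 ≤ α) {t i : ℕ} (hi : i ∈ hedgeActive α y e t) (x : X) :
    powLoss α (simpleOfCode y (e i) x) (y 0) ≤ hedgeLevel α t := by
  simp only [hedgeActive, Finset.mem_filter] at hi
  rcases simpleOfCode_mem y (e i) x with h | ⟨p, hp, h⟩
  · rw [h, powLoss_self hα]; exact hedgeLevel_nonneg t
  · rw [h]; exact hi.2.2 p hp

theorem powLoss_truncate_le (hα : 1 ≤ α) (t : ℕ) (z : Y) :
    powLoss α (truncate α (y 0) (hedgeLevel α t) z) (y 0) ≤ hedgeLevel α t := by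
  unfold truncate
  split_ifs with h
  · exact h.le
  · rw [powLoss_self hα]; exact hedgeLevel_nonneg t

/-- The factor `2 ^ (1 - α)` in the truncation level is there to cancel the constant of the
quasi-triangle inequality. -/
theorem powLoss_le_two_mul_log (hα : 1 ≤ α) {t : ℕ} {a b : Y}
    (ha : powLoss α a (y 0) ≤ hedgeLevel α t) (hb : powLoss α b (y 0) ≤ hedgeLevel α t) :
    powLoss α a b ≤ 2 * Real.log ((t : ℝ) + 1) := by
  have h := powLoss_triangle hα a (y 0) b
  rw [powLoss_comm (y 0) b] at h
  have h2 : (2 : ℝ) ^ (α - 1) * (hedgeLevel α t + hedgeLevel α t) =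
      2 * Real.log ((t : ℝ) + 1) := by
    have h3 : (2 : ℝ) ^ (α - 1) * 2 ^ (1 - α) = 1 := by
      rw [← Real.rpow_add two_pos]; simp
    unfold hedgeLevel
    linear_combination (2 * Real.log ((t : ℝ) + 1)) * h3
  calc powLoss α a b ≤ _ := h
    _ ≤ (2 : ℝ) ^ (α - 1) * (hedgeLevel α t + hedgeLevel α t) := by gcongr
    _ = _ := h2

theorem hedgeExpertLoss_nonneg (xs : ℕ → X) (ys : ℕ → Y) (t i : ℕ) :
    0 ≤ hedgeExpertLoss α y e xs ys t i := powLoss_nonneg _ _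

theorem hedgeExpertLoss_le (hα : 1 ≤ α) (xs : ℕ → X) (ys : ℕ → Y) {t i : ℕ}
    (hi : i ∈ hedgeActive α y e t) :
    hedgeExpertLoss α y e xs ys t i ≤ 2 * Real.log ((t : ℝ) + 1) :=
  powLoss_le_two_mul_log hα (powLoss_simpleOfCode_le hα hi _) (powLoss_truncate_le hα t _)

/-- The mean loss of the Hedge variant in round `t`, given the past. -/
def hedgeMeanLoss (α : ℝ) (y : ℕ → Y) (e : ℕ → List (ℕ × Set X)) (xs : ℕ → X) (ys : ℕ → Y)
    (t : ℕ) : ℝ :=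
  ∑ j ∈ hedgeActive α y e t, hedgeProb α y e xs ys t j * hedgeExpertLoss α y e xs ys t j

theorem hedgeMeanLoss_nonneg (xs : ℕ → X) (ys : ℕ → Y) (t : ℕ) :
    0 ≤ hedgeMeanLoss α y e xs ys t :=
  Finset.sum_nonneg fun _ _ => mul_nonneg (hedgeProb_nonneg _ _ _ _)
    (hedgeExpertLoss_nonneg _ _ _ _)

theorem hedgeMeanLoss_le (hα : 1 ≤ α) (h0 : e 0 = []) (xs : ℕ → X) (ys : ℕ → Y) (t : ℕ) :
    hedgeMeanLoss α y e xs ys t ≤ 2 * Real.log ((t : ℝ) + 1) := by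
  calc hedgeMeanLoss α y e xs ys t
      ≤ ∑ j ∈ hedgeActive α y e t, hedgeProb α y e xs ys t j * (2 * Real.log ((t : ℝ) + 1)) :=
        Finset.sum_le_sum fun _ hj => mul_le_mul_of_nonneg_left (hedgeExpertLoss_le hα xs ys hj)
          (hedgeProb_nonneg _ _ _ _)
    _ = _ := by rw [← Finset.sum_mul, sum_hedgeProb h0, one_mul]

theorem hedgeRegret_succ (xs : ℕ → X) (ys : ℕ → Y) (t i : ℕ) :
    hedgeRegret α y e xs ys (t + 1) i = hedgeRegret α y e xs ys t i +
      if i ∈ hedgeActive α y e t then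
        hedgeMeanLoss α y e xs ys t - hedgeExpertLoss α y e xs ys t i else 0 := rfl

/-- The active sets increase, so an expert not in use at `t` was never in use before. A newcomer
therefore enters the sum of weights with `exp 0 = 1`. -/
theorem hedgeRegret_eq_zero (xs : ℕ → X) (ys : ℕ → Y) {t i : ℕ}
    (hi : i ∉ hedgeActive α y e t) : hedgeRegret α y e xs ys (t + 1) i = 0 := by
  have : ∀ s ≤ t + 1, hedgeRegret α y e xs ys s i = 0 := by
    intro s
    induction s with
    | zero => exact fun _ => rfl
    | succ s ih =>
      intro hs
      rw [hedgeRegret_succ, ih (by omega),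
        if_neg fun h => hi (hedgeActive_mono (by omega : s ≤ t) h), add_zero]
  exact this _ le_rfl

theorem hedgeRegret_eq_sum (xs : ℕ → X) (ys : ℕ → Y) (t i : ℕ) :
    hedgeRegret α y e xs ys t i = ∑ s ∈ Finset.range t, if i ∈ hedgeActive α y e s then
        hedgeMeanLoss α y e xs ys s - hedgeExpertLoss α y e xs ys s i else 0 := by
  induction t with
  | zero => rfl
  | succ t ih => rw [hedgeRegret_succ, ih, Finset.sum_range_succ]

/-- The exponential weights potential of the Hedge variant. -/
def hedgePotential (α : ℝ) (y : ℕ → Y) (e : ℕ → List (ℕ × Set X)) (xs : ℕ → X) (ys : ℕ → Y)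
    (t : ℕ) : ℝ :=
  max (Real.log (∑ i ∈ hedgeActive α y e t,
    Real.exp (hedgeRate t * hedgeRegret α y e xs ys t i)) / hedgeRate t) 0

theorem hedgeRate_pos {t : ℕ} (ht : 1 ≤ t) : 0 < hedgeRate t := by
  have : (1 : ℝ) ≤ t := by exact_mod_cast ht
  have h1 : 0 < Real.log ((t : ℝ) + 1) := Real.log_pos (by linarith)
  unfold hedgeRate
  positivity

theorem hedgeRate_anti {t : ℕ} (ht : 1 ≤ t) : hedgeRate (t + 1) ≤ hedgeRate t := by
  have : (1 : ℝ) ≤ t := by exact_mod_cast ht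
  have h1 : 0 < Real.log ((t : ℝ) + 1) := Real.log_pos (by linarith)
  unfold hedgeRate
  push_cast
  have h2 : Real.log ((t : ℝ) + 1) ≤ Real.log ((t : ℝ) + 1 + 1) :=
    Real.log_le_log (by linarith) (by linarith)
  have h3 : Real.sqrt ((t : ℝ) + 1) ≤ Real.sqrt ((t : ℝ) + 1 + 1) :=
    Real.sqrt_le_sqrt (by linarith)
  exact one_div_le_one_div_of_le (by positivity)
    (mul_le_mul h2 h3 (Real.sqrt_nonneg _) (h1.le.trans h2))

theorem hedgeRate_mul_log {t : ℕ} (ht : 1 ≤ t) :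
    hedgeRate t * (2 * Real.log ((t : ℝ) + 1)) = 2 / Real.sqrt ((t : ℝ) + 1) := by
  have : (1 : ℝ) ≤ t := by exact_mod_cast ht
  have h1 : 0 < Real.log ((t : ℝ) + 1) := Real.log_pos (by linarith)
  unfold hedgeRate
  field_simp

/-- Newcomers add their number `k` to the sum of weights `A`. Their cost is at most `k` only if the
logarithm is replaced by its positive part, since `A` may be tiny; this is why the potential is a
maximum with `0`. -/
theorem log_add_natCast_le {A : ℝ} (hA : 0 < A) (k : ℕ) :
    Real.log (A + k) ≤ max (Real.log A) 0 + k := by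
  have h1 : A + k ≤ max A 1 * (1 + k) := by
    nlinarith [le_max_left A 1, le_max_right A 1, k.cast_nonneg (α := ℝ)]
  have h2 : Real.log (max A 1) = max (Real.log A) 0 := by
    rcases le_total A 1 with h | h
    · rw [max_eq_right h, max_eq_right (Real.log_nonpos hA.le h), Real.log_one]
    · rw [max_eq_left h, max_eq_left (Real.log_nonneg h)]
  have h3 : Real.log (1 + k) ≤ k := by
    have := Real.log_le_sub_one_of_pos (x := 1 + (k : ℝ)) (by positivity)
    linarith
  calc Real.log (A + k) ≤ Real.log (max A 1 * (1 + k)) := Real.log_le_log (by positivity) h1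
    _ = Real.log (max A 1) + Real.log (1 + k) := Real.log_mul (by positivity) (by positivity)
    _ ≤ _ := by linarith

/-- Three changes occur. The update of the regrets costs `(2 η log (t + 1)) ^ 2 / η`, the
logarithmic term. The decrease of the rate costs `log |I| * (1 / η' - 1 / η)`, at most `|I| * (1 /
η' - 1 / η)`; the newcomers cost `(|I'| - |I|) / η'`. The last two bounds add up to the increment of
`|I| / η`, so they telescope. The condition `3 ≤ t` makes `2 / √(t + 1) ≤ 1`, as the exponential
inequality requires. -/
theorem hedgePotential_succ_le (hα : 1 ≤ α) (h0 : e 0 = []) (xs : ℕ → X) (ys : ℕ → Y) {t : ℕ}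
    (ht : 3 ≤ t) :
    hedgePotential α y e xs ys (t + 1) ≤ hedgePotential α y e xs ys t +
      4 * (Real.log ((t : ℝ) + 1) / Real.sqrt ((t : ℝ) + 1)) +
      (hedgeActive α y e (t + 1)).card / hedgeRate (t + 1) -
        (hedgeActive α y e t).card / hedgeRate t := by
  have ht' : (3 : ℝ) ≤ t := by exact_mod_cast ht
  have hη := hedgeRate_pos (t := t) (by omega)
  have hη' := hedgeRate_pos (t := t + 1) (by omega)
  have hanti := hedgeRate_anti (t := t) (by omega)
  have hmul := hedgeRate_mul_log (t := t) (by omega)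
  set I := hedgeActive α y e t with hI
  set I' := hedgeActive α y e (t + 1) with hI'
  set R := hedgeRegret α y e xs ys t with hR
  set R' := hedgeRegret α y e xs ys (t + 1) with hR'
  have hIne : I.Nonempty := ⟨0, zero_mem_hedgeActive h0 t⟩
  have hsub : I ⊆ I' := hedgeActive_mono (Nat.le_succ t)
  have hN : (1 : ℝ) ≤ I.card := by exact_mod_cast hIne.card_pos
  set r : ℕ → ℝ := fun i => hedgeMeanLoss α y e xs ys t - hedgeExpertLoss α y e xs ys t i with hr
  have hsqrt : 2 ≤ Real.sqrt ((t : ℝ) + 1) := Real.le_sqrt_of_sq_le (by linarith)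
  have hlog : 0 ≤ Real.log ((t : ℝ) + 1) := Real.log_nonneg (by linarith)
  have hup := sum_exp_update_le hIne R r (η := hedgeRate t) (b := 2 * Real.log ((t : ℝ) + 1))
    hη.le (by rw [hmul, div_le_one (by linarith)]; exact hsqrt)
    (fun i hi => by
      have h1 := hedgeMeanLoss_le (y := y) hα h0 xs ys t
      have h2 := hedgeExpertLoss_le hα xs ys hi
      have h3 := hedgeMeanLoss_nonneg (α := α) (y := y) (e := e) xs ys t
      have h4 := hedgeExpertLoss_nonneg (α := α) (y := y) (e := e) xs ys t i
      rw [abs_le]; constructor <;> simp only [hr] <;> linarith)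
    (by
      have h1 : ∑ i ∈ I, expWeight (hedgeRate t) R I i = 1 := sum_expWeight _ _ hIne
      simp only [hr, mul_sub, Finset.sum_sub_distrib, ← Finset.sum_mul, h1, one_mul]
      exact sub_self _)
  have hR1 : ∀ i ∈ I, R i + r i = R' i := fun i hi => by
    rw [hR', hedgeRegret_succ, if_pos hi]
  rw [Finset.sum_congr rfl fun i hi => by rw [hR1 i hi]] at hup
  have hch := log_sum_exp_div_le hIne R' hη' hanti
  have hA : 0 < ∑ i ∈ I, Real.exp (hedgeRate (t + 1) * R' i) :=
    Finset.sum_pos (fun _ _ => Real.exp_pos _) hIne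
  have hsplit : ∑ i ∈ I', Real.exp (hedgeRate (t + 1) * R' i) =
      ∑ i ∈ I, Real.exp (hedgeRate (t + 1) * R' i) + ((I' \ I).card : ℕ) := by
    rw [← Finset.sum_sdiff hsub, add_comm]
    congr 1
    rw [Finset.sum_congr rfl (g := fun _ => (1 : ℝ))]
    · simp
    · intro i hi
      have : R' i = 0 := hedgeRegret_eq_zero xs ys (Finset.mem_sdiff.1 hi).2
      simp [this]
  have hcard : ((I' \ I).card : ℝ) = I'.card - I.card := by
    rw [Finset.card_sdiff_of_subset hsub, Nat.cast_sub (Finset.card_le_card hsub)]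
  have hlogN : Real.log I.card ≤ I.card :=
    (Real.log_le_sub_one_of_pos (by linarith)).trans (by linarith)
  have hinv : 0 ≤ 1 / hedgeRate (t + 1) - 1 / hedgeRate t :=
    sub_nonneg.2 (one_div_le_one_div_of_le hη' hanti)
  have hnew := log_add_natCast_le hA (I' \ I).card
  rw [← hsplit, hcard] at hnew
  have hquad : (hedgeRate t * (2 * Real.log ((t : ℝ) + 1))) ^ 2 / hedgeRate t =
      4 * (Real.log ((t : ℝ) + 1) / Real.sqrt ((t : ℝ) + 1)) := by
    have : (hedgeRate t * (2 * Real.log ((t : ℝ) + 1))) ^ 2 / hedgeRate t =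
        (hedgeRate t * (2 * Real.log ((t : ℝ) + 1))) * (2 * Real.log ((t : ℝ) + 1)) := by
      field_simp
    rw [this, hmul]; ring
  have hup2 : Real.log (∑ i ∈ I, Real.exp (hedgeRate t * R' i)) / hedgeRate t ≤
      Real.log (∑ i ∈ I, Real.exp (hedgeRate t * R i)) / hedgeRate t +
        4 * (Real.log ((t : ℝ) + 1) / Real.sqrt ((t : ℝ) + 1)) := by
    rw [← hquad, ← add_div]
    exact div_le_div_of_nonneg_right hup hη.le
  have hVle : Real.log (∑ i ∈ I, Real.exp (hedgeRate t * R i)) / hedgeRate t ≤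
      hedgePotential α y e xs ys t := le_max_left _ _
  have hV0 : 0 ≤ hedgePotential α y e xs ys t := le_max_right _ _
  have hq0 : 0 ≤ 4 * (Real.log ((t : ℝ) + 1) / Real.sqrt ((t : ℝ) + 1)) := by positivity
  have hcards : (I.card : ℝ) ≤ I'.card := by exact_mod_cast Finset.card_le_card hsub
  have hlogmul : Real.log I.card * (1 / hedgeRate (t + 1) - 1 / hedgeRate t) ≤
      I.card * (1 / hedgeRate (t + 1) - 1 / hedgeRate t) :=
    mul_le_mul_of_nonneg_right hlogN hinv
  have hexp : (I'.card : ℝ) / hedgeRate (t + 1) - I.card / hedgeRate t =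
      I.card * (1 / hedgeRate (t + 1) - 1 / hedgeRate t) +
        (I'.card - I.card) / hedgeRate (t + 1) := by ring
  have hk : 0 ≤ ((I'.card : ℝ) - I.card) / hedgeRate (t + 1) :=
    div_nonneg (by linarith) hη'.le
  have hk2 : 0 ≤ (I.card : ℝ) * (1 / hedgeRate (t + 1) - 1 / hedgeRate t) := by positivity
  refine max_le ?_ (by linarith)
  have h1 : Real.log (∑ i ∈ I', Real.exp (hedgeRate (t + 1) * R' i)) / hedgeRate (t + 1) ≤
      max (Real.log (∑ i ∈ I, Real.exp (hedgeRate (t + 1) * R' i)) / hedgeRate (t + 1)) 0 +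
        (I'.card - I.card) / hedgeRate (t + 1) := by
    have h2 := max_div_div_right hη'.le
      (Real.log (∑ i ∈ I, Real.exp (hedgeRate (t + 1) * R' i))) 0
    rw [zero_div] at h2
    rw [h2, ← add_div]
    exact div_le_div_of_nonneg_right hnew hη'.le
  refine h1.trans ?_
  have h2 : max (Real.log (∑ i ∈ I, Real.exp (hedgeRate (t + 1) * R' i)) / hedgeRate (t + 1)) 0 ≤
      hedgePotential α y e xs ys t + 4 * (Real.log ((t : ℝ) + 1) / Real.sqrt ((t : ℝ) + 1)) +
        I.card * (1 / hedgeRate (t + 1) - 1 / hedgeRate t) := max_le (by linarith) (by linarith)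
  linarith

theorem hedgePotential_le (hα : 1 ≤ α) (h0 : e 0 = []) (xs : ℕ → X) (ys : ℕ → Y) {T : ℕ}
    (hT : 3 ≤ T) :
    hedgePotential α y e xs ys T ≤ hedgePotential α y e xs ys 3 +
      ∑ t ∈ Finset.range T, 4 * (Real.log ((t : ℝ) + 1) / Real.sqrt ((t : ℝ) + 1)) +
        (hedgeActive α y e T).card / hedgeRate T := by
  have hnn : ∀ t : ℕ, 0 ≤ 4 * (Real.log ((t : ℝ) + 1) / Real.sqrt ((t : ℝ) + 1)) := fun t =>
    mul_nonneg (by norm_num) (div_nonneg (Real.log_nonneg (by linarith [t.cast_nonneg (α := ℝ)]))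
      (Real.sqrt_nonneg _))
  induction T, hT using Nat.le_induction with
  | base =>
    have := hedgeRate_pos (t := 3) (by omega)
    have h1 : 0 ≤ ((hedgeActive α y e 3).card : ℝ) / hedgeRate 3 := by positivity
    have h2 := Finset.sum_nonneg fun t (_ : t ∈ Finset.range 3) => hnn t
    linarith
  | succ t ht ih =>
    have := hedgePotential_succ_le (y := y) (e := e) hα h0 xs ys ht
    rw [Finset.sum_range_succ]
    linarith

theorem hedgeRegret_le_potential (xs : ℕ → X) (ys : ℕ → Y) {T i : ℕ} (hT : 1 ≤ T)
    (hi : i ∈ hedgeActive α y e T) :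
    hedgeRegret α y e xs ys T i ≤ hedgePotential α y e xs ys T := by
  have hη := hedgeRate_pos hT
  refine le_trans ?_ (le_max_left _ _)
  rw [le_div_iff₀ hη, mul_comm, ← Real.log_exp (hedgeRate T * _)]
  refine Real.log_le_log (Real.exp_pos _) ?_
  exact Finset.single_le_sum (f := fun i => Real.exp (hedgeRate T * hedgeRegret α y e xs ys T i))
    (fun _ _ => (Real.exp_pos _).le) hi

theorem tendsto_natCast_succ : Tendsto (fun t : ℕ => (t : ℝ) + 1) atTop atTop :=
  tendsto_atTop_add_const_right _ _ tendsto_natCast_atTop_atTop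

theorem eventually_log_div_sqrt_le {ε : ℝ} (hε : 0 < ε) :
    ∀ᶠ t : ℕ in atTop, Real.log ((t : ℝ) + 1) / Real.sqrt ((t : ℝ) + 1) ≤ ε := by
  have h := ((isLittleO_log_rpow_atTop (r := 1 / 2) (by norm_num)).comp_tendsto
    tendsto_natCast_succ).bound hε
  filter_upwards [h] with t ht
  simp only [Function.comp_apply, Real.norm_eq_abs, ← Real.sqrt_eq_rpow] at ht
  rw [div_le_iff₀ (by positivity)]
  rw [abs_of_nonneg (Real.sqrt_nonneg _)] at ht
  exact (le_abs_self _).trans ht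

/-- With at most `log (T + 1) + 1` experts, the quotient is of order `log² T * √T`; comparing the
logarithm with `T ^ (1/4)` makes it `o(T)`. -/
theorem eventually_card_div_hedgeRate_le {ε : ℝ} (hε : 0 < ε) :
    ∀ᶠ T : ℕ in atTop, ((hedgeActive α y e T).card : ℝ) / hedgeRate T ≤ ε * T := by
  have h := ((isLittleO_log_rpow_atTop (r := 1 / 4) (by norm_num)).comp_tendsto
    tendsto_natCast_succ).bound (c := Real.sqrt (ε / 4)) (by positivity)
  filter_upwards [h, eventually_ge_atTop 1, tendsto_log_succ.eventually_ge_atTop 1]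
    with T h1 h2 h3
  have hT : (1 : ℝ) ≤ T := by exact_mod_cast h2
  simp only [Function.comp_apply, Real.norm_eq_abs] at h1
  rw [abs_of_nonneg (by linarith), abs_of_nonneg (by positivity)] at h1
  set L := Real.log ((T : ℝ) + 1) with hL
  have hc := card_hedgeActive_le (α := α) (y := y) (e := e) T
  have hsq : L ^ 2 ≤ ε / 4 * Real.sqrt ((T : ℝ) + 1) := by
    calc L ^ 2 ≤ (Real.sqrt (ε / 4) * ((T : ℝ) + 1) ^ (1 / 4 : ℝ)) ^ 2 :=
          pow_le_pow_left₀ (by linarith) h1 2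
      _ = _ := by
        rw [mul_pow, Real.sq_sqrt (by positivity), ← Real.rpow_natCast, ← Real.rpow_mul
          (by positivity), Real.sqrt_eq_rpow]
        norm_num
  have hs : Real.sqrt ((T : ℝ) + 1) ^ 2 = T + 1 := Real.sq_sqrt (by positivity)
  have hs0 := Real.sqrt_nonneg ((T : ℝ) + 1)
  calc ((hedgeActive α y e T).card : ℝ) / hedgeRate T
      = (hedgeActive α y e T).card * (L * Real.sqrt ((T : ℝ) + 1)) := by
        rw [hedgeRate, div_div_eq_mul_div, div_one]
    _ ≤ (L + 1) * (L * Real.sqrt ((T : ℝ) + 1)) := by gcongr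
    _ = (L * L + L) * Real.sqrt ((T : ℝ) + 1) := by ring
    _ ≤ (2 * L ^ 2) * Real.sqrt ((T : ℝ) + 1) := by
        refine mul_le_mul_of_nonneg_right ?_ hs0
        nlinarith
    _ ≤ (2 * (ε / 4 * Real.sqrt ((T : ℝ) + 1))) * Real.sqrt ((T : ℝ) + 1) := by gcongr
    _ = ε / 2 * Real.sqrt ((T : ℝ) + 1) ^ 2 := by ring
    _ = ε / 2 * (T + 1) := by rw [hs]
    _ ≤ ε * T := by nlinarith

/-- The average regret of the Hedge variant with respect to any of its experts vanishes. -/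
theorem eventually_sum_hedgeMeanLoss_sub_le (hα : 1 ≤ α) (h0 : e 0 = []) (xs : ℕ → X)
    (ys : ℕ → Y) (i : ℕ) {ε : ℝ} (hε : 0 < ε) :
    ∀ᶠ T : ℕ in atTop, ∑ t ∈ Finset.range T,
      (hedgeMeanLoss α y e xs ys t - hedgeExpertLoss α y e xs ys t i) ≤ ε * T := by
  obtain ⟨t₀, ht₀⟩ := eventually_atTop.1 (eventually_mem_hedgeActive (α := α) (y := y) (e := e) i)
  -- The regret recursion ignores the rounds before expert `i` is in use; there are finitely many.
  have h1 := sum_range_eventually_le (t₀ := t₀) (b := fun t =>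
    (hedgeMeanLoss α y e xs ys t - hedgeExpertLoss α y e xs ys t i) -
      if i ∈ hedgeActive α y e t then
        hedgeMeanLoss α y e xs ys t - hedgeExpertLoss α y e xs ys t i else 0)
    (fun t ht => by rw [if_pos (ht₀ t ht), sub_self]) (ε := ε / 4) (by linarith)
  have h2 : ∀ᶠ T : ℕ in atTop, ∑ t ∈ Finset.range T,
      (4 * (Real.log ((t : ℝ) + 1) / Real.sqrt ((t : ℝ) + 1)) - ε / 8) ≤ ε / 8 * T := by
    obtain ⟨t₁, ht₁⟩ := eventually_atTop.1
      (eventually_log_div_sqrt_le (ε := ε / 32) (by linarith))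
    exact sum_range_eventually_le (t₀ := t₁) (fun t ht => by linarith [ht₁ t ht]) (by linarith)
  have h3 : ∀ᶠ T : ℕ in atTop, hedgePotential α y e xs ys 3 ≤ ε / 4 * T :=
    (tendsto_natCast_atTop_atTop.const_mul_atTop (by linarith)).eventually_ge_atTop _
  filter_upwards [h1, h2, h3,
    eventually_card_div_hedgeRate_le (α := α) (y := y) (e := e) (ε := ε / 4) (by linarith),
    eventually_ge_atTop 3, eventually_ge_atTop t₀] with T h1 h2 h3 h4 h5 h6
  rw [Finset.sum_sub_distrib, ← hedgeRegret_eq_sum] at h1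
  rw [Finset.sum_sub_distrib, Finset.sum_const, Finset.card_range, nsmul_eq_mul] at h2
  have h7 := hedgeRegret_le_potential xs ys (by omega : 1 ≤ T) (ht₀ T h6)
  have h8 := hedgePotential_le (y := y) (e := e) hα h0 xs ys h5
  linarith

end HedgeRegret

/-! ### A strong law for orthogonal variables of logarithmic size -/

section OrthogonalSLLN

variable {Ω : Type*} [MeasurableSpace Ω] {P : Measure Ω} [IsProbabilityMeasure P] {Z : ℕ → Ω → ℝ}
  {b : ℕ → ℝ}

theorem integrable_mul_of_ae_abs_le (hm : ∀ t, Measurable (Z t))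
    (hb : ∀ t, ∀ᵐ ω ∂P, |Z t ω| ≤ b t) (s t : ℕ) : Integrable (fun ω => Z s ω * Z t ω) P := by
  refine Integrable.of_bound ((hm s).mul (hm t)).aestronglyMeasurable (b s * b t) ?_
  filter_upwards [hb s, hb t] with ω h1 h2
  rw [Real.norm_eq_abs, abs_mul]
  exact mul_le_mul h1 h2 (abs_nonneg _) ((abs_nonneg _).trans h1)

theorem integrable_sum_sq_of_ae_abs_le (hm : ∀ t, Measurable (Z t))
    (hb : ∀ t, ∀ᵐ ω ∂P, |Z t ω| ≤ b t) (n : ℕ) :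
    Integrable (fun ω => (∑ t ∈ Finset.range n, Z t ω) ^ 2) P := by
  simp only [sq, Finset.sum_mul_sum]
  exact integrable_finsetSum _ fun s _ => integrable_finsetSum _ fun t _ =>
    integrable_mul_of_ae_abs_le hm hb s t

theorem integral_sum_sq_le (hm : ∀ t, Measurable (Z t)) (hb : ∀ t, ∀ᵐ ω ∂P, |Z t ω| ≤ b t)
    (horth : ∀ s t, s < t → ∫ ω, Z s ω * Z t ω ∂P = 0) (n : ℕ) :
    ∫ ω, (∑ t ∈ Finset.range n, Z t ω) ^ 2 ∂P ≤ ∑ t ∈ Finset.range n, b t ^ 2 := by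
  induction n with
  | zero => simp
  | succ n ih =>
    have h1 : ∀ ω, (∑ t ∈ Finset.range (n + 1), Z t ω) ^ 2 =
        (∑ t ∈ Finset.range n, Z t ω) ^ 2 + (2 * ∑ t ∈ Finset.range n, Z t ω * Z n ω) +
          Z n ω * Z n ω := fun ω => by
      rw [Finset.sum_range_succ, ← Finset.sum_mul]; ring
    have hi1 := integrable_sum_sq_of_ae_abs_le hm hb n
    have hi2 : Integrable (fun ω => ∑ t ∈ Finset.range n, Z t ω * Z n ω) P :=
      integrable_finsetSum _ fun t _ => integrable_mul_of_ae_abs_le hm hb t n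
    have hi3 := integrable_mul_of_ae_abs_le hm hb n n
    have hi4 : Integrable (fun ω => 2 * ∑ t ∈ Finset.range n, Z t ω * Z n ω) P := hi2.const_mul 2
    have hi5 : Integrable (fun ω => (∑ t ∈ Finset.range n, Z t ω) ^ 2 +
        2 * ∑ t ∈ Finset.range n, Z t ω * Z n ω) P := hi1.add hi4
    have h2 : ∫ ω, Z n ω * Z n ω ∂P ≤ b n ^ 2 := by
      have : ∫ ω, Z n ω * Z n ω ∂P ≤ ∫ _, b n ^ 2 ∂P := by
        refine integral_mono_ae hi3 (integrable_const _) ?_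
        filter_upwards [hb n] with ω h
        rw [← sq, ← sq_abs]
        exact pow_le_pow_left₀ (abs_nonneg _) h 2
      simpa using this
    simp only [h1]
    rw [integral_add hi5 hi3, integral_add hi1 hi4, integral_const_mul,
      integral_finsetSum _ fun t _ => integrable_mul_of_ae_abs_le hm hb t n,
      Finset.sum_eq_zero fun t ht => horth t n (Finset.mem_range.1 ht), Finset.sum_range_succ]
    linarith

/-- A strong law of large numbers for orthogonal random variables of logarithmic size. -/
theorem ae_eventually_abs_sum_le (hm : ∀ t, Measurable (Z t))
    (hb : ∀ t : ℕ, ∀ᵐ ω ∂P, |Z t ω| ≤ 2 * Real.log ((t : ℝ) + 1))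
    (horth : ∀ s t, s < t → ∫ ω, Z s ω * Z t ω ∂P = 0) :
    ∀ᵐ ω ∂P, ∀ ε : ℝ, 0 < ε → ∀ᶠ T : ℕ in atTop, |∑ t ∈ Finset.range T, Z t ω| ≤ ε * T := by
  have hmS : ∀ n, Measurable fun ω => ∑ t ∈ Finset.range n, Z t ω := fun n =>
    Finset.measurable_fun_sum _ fun t _ => hm t
  -- Along the squares `T = (k + 1) ^ 2`, the logarithm is at most `8 (k + 1) ^ (1/4)`. The second
  -- moment of the average is then at most `256 (k + 1) ^ (-3/2)`, which is summable, so the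
  -- averages tend to `0` almost surely along squares.
  have hlog : ∀ k : ℕ, ∀ t ∈ Finset.range ((k + 1) ^ 2),
      (2 * Real.log ((t : ℝ) + 1)) ^ 2 ≤ 256 * ((k : ℝ) + 1) ^ (1 / 2 : ℝ) := by
    intro k t ht
    have ht' : (t : ℝ) + 1 ≤ ((k : ℝ) + 1) ^ 2 := by exact_mod_cast Finset.mem_range.1 ht
    have h0 : 0 ≤ Real.log ((t : ℝ) + 1) := Real.log_nonneg (by linarith [t.cast_nonneg (α := ℝ)])
    have h1 : Real.log ((t : ℝ) + 1) ≤ 2 * Real.log ((k : ℝ) + 1) := by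
      have := Real.log_le_log (by positivity) ht'
      rwa [Real.log_pow, Nat.cast_ofNat] at this
    have h2 := Real.log_le_rpow_div (x := (k : ℝ) + 1) (by positivity)
      (by norm_num : (0 : ℝ) < 1 / 4)
    have h3 : (((k : ℝ) + 1) ^ (1 / 4 : ℝ)) ^ 2 = ((k : ℝ) + 1) ^ (1 / 2 : ℝ) := by
      rw [← Real.rpow_natCast, ← Real.rpow_mul (by positivity)]; norm_num
    rw [← h3]
    calc (2 * Real.log ((t : ℝ) + 1)) ^ 2 ≤ (16 * ((k : ℝ) + 1) ^ (1 / 4 : ℝ)) ^ 2 :=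
          pow_le_pow_left₀ (by positivity) (by linarith) 2
      _ = _ := by ring
  have hsq : ∀ k : ℕ, ∫ ω, (∑ t ∈ Finset.range ((k + 1) ^ 2), Z t ω) ^ 2 ∂P ≤
      256 * ((k : ℝ) + 1) ^ (1 / 2 : ℝ) * ((k : ℝ) + 1) ^ 2 := by
    intro k
    refine (integral_sum_sq_le hm hb horth _).trans ((Finset.sum_le_sum (hlog k)).trans_eq ?_)
    rw [Finset.sum_const, Finset.card_range, nsmul_eq_mul]
    push_cast
    ring
  have hE : ∀ k : ℕ, ∫⁻ ω, ENNReal.ofReal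
      ((∑ t ∈ Finset.range ((k + 1) ^ 2), Z t ω) ^ 2 / (((k : ℝ) + 1) ^ 2) ^ 2) ∂P ≤
        ENNReal.ofReal (256 * ((k : ℝ) + 1) ^ (-(3 / 2) : ℝ)) := by
    intro k
    have hi := (integrable_sum_sq_of_ae_abs_le hm hb ((k + 1) ^ 2)).div_const
      ((((k : ℝ) + 1) ^ 2) ^ 2)
    rw [← ofReal_integral_eq_lintegral_ofReal hi (ae_of_all _ fun ω => by positivity)]
    refine ENNReal.ofReal_le_ofReal ?_
    rw [integral_div, div_le_iff₀ (by positivity)]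
    refine (hsq k).trans_eq ?_
    have hk : (0 : ℝ) < (k : ℝ) + 1 := by positivity
    have h1 : ((((k : ℝ) + 1) ^ 2) ^ 2) = ((k : ℝ) + 1) ^ (4 : ℝ) := by
      rw [← pow_mul, ← Real.rpow_natCast]; norm_num
    have h2 : (((k : ℝ) + 1) ^ 2) = ((k : ℝ) + 1) ^ (2 : ℝ) := by
      rw [← Real.rpow_natCast]; norm_num
    rw [h1, h2, mul_assoc, mul_assoc, ← Real.rpow_add hk, ← Real.rpow_add hk]
    norm_num
  have hsum : ∫⁻ ω, ∑' k : ℕ, ENNReal.ofReal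
      ((∑ t ∈ Finset.range ((k + 1) ^ 2), Z t ω) ^ 2 / (((k : ℝ) + 1) ^ 2) ^ 2) ∂P ≠ ⊤ := by
    rw [lintegral_tsum fun k => (((hmS _).pow_const 2).div_const _).ennreal_ofReal.aemeasurable]
    refine ne_top_of_le_ne_top ?_ (ENNReal.tsum_le_tsum hE)
    have hs : Summable fun k : ℕ => 256 * ((k : ℝ) + 1) ^ (-(3 / 2) : ℝ) := by
      have := (summable_nat_add_iff 1).2
        (Real.summable_nat_rpow (p := (-(3 / 2) : ℝ)) |>.2 (by norm_num))
      simpa using this.mul_left 256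
    exact hs.tsum_ofReal_ne_top
  have hfin := ae_lt_top (Measurable.tsum fun k =>
    (((hmS ((k + 1) ^ 2)).pow_const 2).div_const ((((k : ℝ) + 1) ^ 2) ^ 2)).ennreal_ofReal) hsum
  filter_upwards [hfin, ae_all_iff.2 hb] with ω hω hbω ε hε
  have hlim := ENNReal.tendsto_atTop_zero_of_tsum_ne_top hω.ne
  have hev := hlim.eventually_lt_const
    (u := ENNReal.ofReal ((ε / 2) ^ 2)) (by simpa using pow_pos (half_pos hε) 2)
  obtain ⟨k₀, hk₀⟩ := eventually_atTop.1 hev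
  filter_upwards [eventually_ge_atTop ((k₀ + 1) ^ 2),
    eventually_log_div_sqrt_le (ε := ε / 16) (by positivity)] with T hT hlogT
  obtain ⟨k, hk⟩ : ∃ k, Nat.sqrt T = k + 1 := by
    have : k₀ + 1 ≤ Nat.sqrt T := Nat.le_sqrt'.2 hT
    exact ⟨Nat.sqrt T - 1, by omega⟩
  have hkk : k₀ ≤ k := by
    have : k₀ + 1 ≤ Nat.sqrt T := Nat.le_sqrt'.2 hT
    omega
  have hle : (k + 1) ^ 2 ≤ T := hk ▸ Nat.sqrt_le' T
  have hlt : T < (k + 2) ^ 2 := by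
    have := Nat.lt_succ_sqrt' T
    rwa [hk] at this
  have hT1 : (1 : ℝ) ≤ T := by
    exact_mod_cast (Nat.one_le_pow 2 (k + 1) (by omega)).trans hle
  have h1 := (ENNReal.ofReal_lt_ofReal_iff_of_nonneg (by positivity)).1 (hk₀ k hkk)
  rw [← div_pow] at h1
  have h2 := abs_lt_of_sq_lt_sq h1 (by positivity)
  rw [abs_lt, lt_div_iff₀ (by positivity), div_lt_iff₀ (by positivity)] at h2
  have hleR : ((k : ℝ) + 1) ^ 2 ≤ T := by exact_mod_cast hle
  have h3 : |∑ t ∈ Finset.range ((k + 1) ^ 2), Z t ω| ≤ ε / 2 * T := by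
    rw [abs_le]
    have : ε / 2 * ((k : ℝ) + 1) ^ 2 ≤ ε / 2 * T := by gcongr
    constructor <;> linarith
  have hL : 0 ≤ Real.log ((T : ℝ) + 1) := Real.log_nonneg (by linarith)
  -- Between consecutive squares there are only about `2 √T` terms, each at most `2 log (T + 1)`.
  have h4 : |∑ t ∈ Finset.Ico ((k + 1) ^ 2) T, Z t ω| ≤ ε / 2 * T := by
    have h5 : |∑ t ∈ Finset.Ico ((k + 1) ^ 2) T, Z t ω| ≤
        (T - (k + 1) ^ 2 : ℕ) * (2 * Real.log ((T : ℝ) + 1)) := by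
      refine (Finset.abs_sum_le_sum_abs _ _).trans ?_
      rw [← Nat.card_Ico, ← nsmul_eq_mul, ← Finset.sum_const]
      refine Finset.sum_le_sum fun t ht => (hbω t).trans ?_
      have : (t : ℝ) ≤ T := by exact_mod_cast (Finset.mem_Ico.1 ht).2.le
      gcongr
    have h6 : ((T - (k + 1) ^ 2 : ℕ) : ℝ) ≤ 2 * Real.sqrt ((T : ℝ) + 1) := by
      have h7 : T - (k + 1) ^ 2 ≤ 2 * (k + 1) := by
        have : (k + 2) ^ 2 = (k + 1) ^ 2 + 2 * (k + 1) + 1 := by ring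
        omega
      have h8 : (k : ℝ) + 1 ≤ Real.sqrt ((T : ℝ) + 1) := Real.le_sqrt_of_sq_le (by linarith)
      calc ((T - (k + 1) ^ 2 : ℕ) : ℝ) ≤ ((2 * (k + 1) : ℕ) : ℝ) := by exact_mod_cast h7
        _ ≤ _ := by push_cast; linarith
    rw [div_le_iff₀ (by positivity)] at hlogT
    calc |∑ t ∈ Finset.Ico ((k + 1) ^ 2) T, Z t ω|
        ≤ (T - (k + 1) ^ 2 : ℕ) * (2 * Real.log ((T : ℝ) + 1)) := h5
      _ ≤ 2 * Real.sqrt ((T : ℝ) + 1) * (2 * (ε / 16 * Real.sqrt ((T : ℝ) + 1))) := by gcongr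
      _ = ε / 4 * Real.sqrt ((T : ℝ) + 1) ^ 2 := by ring
      _ = ε / 4 * (T + 1) := by rw [Real.sq_sqrt (by positivity)]
      _ ≤ ε / 2 * T := by nlinarith
  rw [← Finset.sum_range_add_sum_Ico _ hle]
  calc _ ≤ _ := abs_add_le _ _
    _ ≤ ε / 2 * T + ε / 2 * T := add_le_add h3 h4
    _ = ε * T := by ring

end OrthogonalSLLN

/-! ### Fubini for the seed of a round given the history -/

section AdversarialProcess

variable {X Y : Type u} [MeasurableSpace X] [MeasurableSpace Y] {f : LearningRule X Y}

/-- What is determined before the seed of round `t` is drawn: the instances, the responses up to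
round `t`, and the earlier seeds. -/
abbrev LearningRule.History (f : LearningRule X Y) (t : ℕ) : Type u :=
  (ℕ → X) × (Fin (t + 1) → Y) × (Fin t → f.Seed)

/-- The history of round `t` along a path. -/
def LearningRule.history (f : LearningRule X Y) (t : ℕ) (ω : f.Path) : f.History t :=
  (ω.1, (fun s : Fin (t + 1) => ω.2.1 s), (fun s : Fin t => ω.2.2 s))

/-- A path with a given history of round `t` and a given seed in round `t`. -/
def LearningRule.extendPath (f : LearningRule X Y) (t : ℕ) (p : f.History t × f.Seed) : f.Path :=
  -- The seed `p.2` is the padding value, which places it at index `t`; the values at later indices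
  -- are immaterial.
  (p.1.1, extendSeq (p.1.2.1 0) p.1.2.1, extendSeq p.2 p.1.2.2)

theorem LearningRule.measurable_history (f : LearningRule X Y) (t : ℕ) :
    Measurable (f.history t) := by
  unfold LearningRule.history
  fun_prop

theorem LearningRule.measurable_extendPath (f : LearningRule X Y) (t : ℕ) :
    Measurable (f.extendPath t) := by
  unfold LearningRule.extendPath
  exact Measurable.prodMk (by fun_prop) (Measurable.prodMk
    (measurable_extendSeq (by fun_prop) (by fun_prop))
    (measurable_extendSeq (by fun_prop) (by fun_prop)))

theorem LearningRule.measurable_prediction (f : LearningRule X Y) (t : ℕ) :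
    Measurable fun ω : f.Path => f.prediction ω t :=
  (f.measurable_predict t).comp (by fun_prop :
    Measurable fun ω : f.Path => (ω.2.2 t, (fun s : Fin t => ω.1 s), (fun s : Fin t => ω.2.1 s),
      ω.1 t))

theorem LearningRule.prediction_congr {ω ω' : f.Path} {t : ℕ} (hx : ω.1 = ω'.1)
    (hy : ∀ s < t, ω.2.1 s = ω'.2.1 s) (hr : ω.2.2 t = ω'.2.2 t) :
    f.prediction ω t = f.prediction ω' t := by
  have : (fun s : Fin t => ω.2.1 s) = fun s : Fin t => ω'.2.1 s := funext fun s => hy s s.2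
  unfold LearningRule.prediction
  rw [hx, hr, this]

theorem LearningRule.extendPath_response (f : LearningRule X Y) {s t : ℕ} (ω : f.Path)
    (hs : s ≤ t) (r : f.Seed) :
    (f.extendPath t (f.history t ω, r)).2.1 s = ω.2.1 s :=
  extendSeq_apply _ _ (Nat.lt_succ_of_le hs)

theorem LearningRule.extendPath_seed_lt (f : LearningRule X Y) {s t : ℕ} (ω : f.Path)
    (hs : s < t) (r : f.Seed) :
    (f.extendPath t (f.history t ω, r)).2.2 s = ω.2.2 s :=
  extendSeq_apply _ _ hs

theorem LearningRule.extendPath_seed (f : LearningRule X Y) (t : ℕ) (v : f.History t)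
    (r : f.Seed) : (f.extendPath t (v, r)).2.2 t = r := by
  simp [LearningRule.extendPath, extendSeq]

theorem LearningRule.extendPath_seed_le (f : LearningRule X Y) {s t : ℕ} (ω : f.Path)
    (hs : s ≤ t) : (f.extendPath t (f.history t ω, ω.2.2 t)).2.2 s = ω.2.2 s := by
  rcases hs.lt_or_eq with h | rfl
  · exact f.extendPath_seed_lt ω h _
  · exact f.extendPath_seed _ _ _

theorem measurable_prediction_extendPath (f : LearningRule X Y) (t : ℕ) (v : f.History t) :
    Measurable fun r => f.prediction (f.extendPath t (v, r)) t :=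
  (f.measurable_prediction t).comp ((f.measurable_extendPath t).comp measurable_prodMk_left)

/-- Independence makes this a product law. Conditioning on the past becomes integration over the
last seed at a fixed history, so no conditional expectation is needed. -/
theorem IsAdversarialProcess.map_history_seed {μ : ProbabilityMeasure (ℕ → X)}
    {P : ProbabilityMeasure f.Path} (h : IsAdversarialProcess f μ P) (t : ℕ) :
    (P : Measure f.Path).map (fun ω => (f.history t ω, ω.2.2 t)) =
      ((P : Measure f.Path).map (f.history t)).prod (f.law t : Measure f.Seed) := by
  rw [← h.seed_law t]
  exact (indepFun_iff_map_prod_eq_prod_map_map (f.measurable_history t).aemeasurable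
    (by fun_prop : Measurable fun ω : f.Path => ω.2.2 t).aemeasurable).1 (h.seed_indep t).symm

/-- A property of the path up to round `t` that holds for almost all seeds of round `t`, whatever
the history, holds almost surely. -/
theorem IsAdversarialProcess.ae_of_forall_history {μ : ProbabilityMeasure (ℕ → X)}
    {P : ProbabilityMeasure f.Path} (h : IsAdversarialProcess f μ P) (t : ℕ) {p : f.Path → Prop}
    (hp : MeasurableSet {ω | p ω})
    (hcausal : ∀ ω, p (f.extendPath t (f.history t ω, ω.2.2 t)) → p ω)
    (hv : ∀ v, ∀ᵐ r ∂(f.law t : Measure f.Seed), p (f.extendPath t (v, r))) :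
    ∀ᵐ ω ∂(P : Measure f.Path), p ω := by
  have hm : Measurable fun ω : f.Path => (f.history t ω, ω.2.2 t) :=
    (f.measurable_history t).prodMk (by fun_prop)
  have hms : MeasurableSet {q | p (f.extendPath t q)} := f.measurable_extendPath t hp
  have h1 : ∀ᵐ q ∂((P : Measure f.Path).map (f.history t)).prod (f.law t : Measure f.Seed),
      p (f.extendPath t q) :=
    (Measure.ae_prod_iff_ae_ae hms).2 (ae_of_all _ hv)
  rw [← h.map_history_seed t, ae_map_iff hm.aemeasurable hms] at h1
  exact h1.mono hcausal

/-- Causal variables of mean zero given the history are orthogonal to earlier ones. -/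
theorem IsAdversarialProcess.integral_mul_eq_zero {μ : ProbabilityMeasure (ℕ → X)}
    {P : ProbabilityMeasure f.Path} (h : IsAdversarialProcess f μ P) {t : ℕ} {Z W : f.Path → ℝ}
    (hZm : Measurable Z) (hWm : Measurable W)
    (hint : Integrable (fun ω => Z ω * W ω) (P : Measure f.Path))
    (hZ : ∀ ω, Z (f.extendPath t (f.history t ω, ω.2.2 t)) = Z ω)
    (hZs : ∀ v r r', Z (f.extendPath t (v, r)) = Z (f.extendPath t (v, r')))
    (hW : ∀ ω, W (f.extendPath t (f.history t ω, ω.2.2 t)) = W ω)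
    (hmean : ∀ v, ∫ r, W (f.extendPath t (v, r)) ∂(f.law t : Measure f.Seed) = 0) :
    ∫ ω, Z ω * W ω ∂(P : Measure f.Path) = 0 := by
  have hm : Measurable fun ω : f.Path => (f.history t ω, ω.2.2 t) :=
    (f.measurable_history t).prodMk (by fun_prop)
  have hF : Measurable fun q => Z (f.extendPath t q) * W (f.extendPath t q) :=
    (hZm.comp (f.measurable_extendPath t)).mul (hWm.comp (f.measurable_extendPath t))
  have h1 : (fun ω => Z ω * W ω) = (fun q => Z (f.extendPath t q) * W (f.extendPath t q)) ∘
      fun ω => (f.history t ω, ω.2.2 t) := funext fun ω => by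
    simp only [Function.comp_apply, hZ ω, hW ω]
  rw [h1] at hint
  rw [← integrable_map_measure hF.aestronglyMeasurable hm.aemeasurable] at hint
  rw [h1]
  refine (integral_map hm.aemeasurable hF.aestronglyMeasurable).symm.trans ?_
  rw [h.map_history_seed t] at hint ⊢
  rw [integral_prod _ hint]
  have hne : Nonempty f.Seed := (f.law t).nonempty
  obtain ⟨r₀⟩ := hne
  refine integral_eq_zero_of_ae (ae_of_all _ fun v => ?_)
  change ∫ r, Z (f.extendPath t (v, r)) * W (f.extendPath t (v, r)) ∂(f.law t : Measure f.Seed) = 0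
  rw [integral_congr_ae (ae_of_all _ fun r => congrArg (· * W (f.extendPath t (v, r))) (hZs v r r₀) :
    (fun r => Z (f.extendPath t (v, r)) * W (f.extendPath t (v, r))) =ᵐ[_]
      fun r => Z (f.extendPath t (v, r₀)) * W (f.extendPath t (v, r))),
    integral_const_mul, hmean, mul_zero]

end AdversarialProcess

theorem hedgeMeanLoss_congr {X Y : Type u} [MetricSpace Y] {α : ℝ} {y : ℕ → Y}
    {e : ℕ → List (ℕ × Set X)} {xs xs' : ℕ → X} {ys ys' : ℕ → Y} {t : ℕ}
    (hx : ∀ s ≤ t, xs s = xs' s) (hy : ∀ s ≤ t, ys s = ys' s) :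
    hedgeMeanLoss α y e xs ys t = hedgeMeanLoss α y e xs' ys' t := by
  unfold hedgeMeanLoss
  rw [hedgeProb_congr (fun s hs => hx s hs.le) (fun s hs => hy s hs.le)]
  simp only [hedgeExpertLoss, hx t le_rfl, hy t le_rfl]

/-! ### The realised loss and its mean given the past -/

section HedgeMartingale

variable {X Y : Type u} [MeasurableSpace X] [MeasurableSpace Y] [MetricSpace Y]
  {α : ℝ} {y : ℕ → Y} {e : ℕ → List (ℕ × Set X)} {f : LearningRule X Y}

/-- The difference between the loss of the Hedge variant in round `t`, with respect to the truncated
response, and its mean given the past. -/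
def hedgeNoise (α : ℝ) (y : ℕ → Y) (e : ℕ → List (ℕ × Set X)) (f : LearningRule X Y) (t : ℕ)
    (ω : f.Path) : ℝ :=
  powLoss α (f.prediction ω t) (truncate α (y 0) (hedgeLevel α t) (ω.2.1 t)) -
    hedgeMeanLoss α y e ω.1 ω.2.1 t

theorem hedgeNoise_congr {ω ω' : f.Path} {t : ℕ} (hx : ω.1 = ω'.1)
    (hy : ∀ s ≤ t, ω.2.1 s = ω'.2.1 s) (hr : ω.2.2 t = ω'.2.2 t) :
    hedgeNoise α y e f t ω = hedgeNoise α y e f t ω' := by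
  unfold hedgeNoise
  rw [LearningRule.prediction_congr hx (fun s hs => hy s hs.le) hr, hy t le_rfl, hx,
    hedgeMeanLoss_congr (fun s _ => rfl) hy]

/-- The law of the prediction of the Hedge variant given the past. -/
theorem LearningRule.IsTruncatedHedge.map_prediction (hf : f.IsTruncatedHedge α y e) (t : ℕ)
    (v : f.History t) :
    (f.law t : Measure f.Seed).map (fun r => f.prediction (f.extendPath t (v, r)) t) =
      ∑ i ∈ hedgeActive α y e t,
        ENNReal.ofReal (hedgeProb α y e v.1 (extendSeq (v.2.1 0) v.2.1) t i) •
          Measure.dirac (simpleOfCode y (e i) (v.1 t)) := by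
  rw [← hf]
  congr 1
  funext r
  unfold LearningRule.prediction
  rw [f.extendPath_seed]
  rfl

variable [SecondCountableTopology Y] [BorelSpace Y]

theorem measurable_hedgeNoise (he : ∀ i, ∀ p ∈ e i, MeasurableSet p.2) (t : ℕ) :
    Measurable (hedgeNoise α y e f t) := by
  refine ((f.measurable_prediction t).powLoss
    ((measurable_truncate _ _).comp (by fun_prop))).sub ?_
  unfold hedgeMeanLoss
  refine Finset.measurable_fun_sum _ fun j _ => ?_
  exact ((measurable_hedgeProb he t j).comp (by fun_prop :
      Measurable fun ω : f.Path => (ω.1, ω.2.1))).mul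
    ((measurable_hedgeExpertLoss he t j).comp (by fun_prop :
      Measurable fun ω : f.Path => (ω.1, ω.2.1)))

/-- A truncated Hedge rule is only specified through the law of its predictions, so the bound can
hold only almost surely. The atoms of that law are values of active experts. -/
theorem LearningRule.IsTruncatedHedge.ae_powLoss_prediction_le (hα : 1 ≤ α)
    (hf : f.IsTruncatedHedge α y e) {μ : ProbabilityMeasure (ℕ → X)}
    {P : ProbabilityMeasure f.Path} (h : IsAdversarialProcess f μ P) (t : ℕ) :
    ∀ᵐ ω ∂(P : Measure f.Path), powLoss α (f.prediction ω t) (y 0) ≤ hedgeLevel α t := by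
  refine h.ae_of_forall_history t (p := fun ω =>
    powLoss α (f.prediction ω t) (y 0) ≤ hedgeLevel α t)
    (measurableSet_le ((f.measurable_prediction t).powLoss measurable_const) measurable_const)
    (fun ω hω => ?_) fun v => ?_
  · have : f.prediction (f.extendPath t (f.history t ω, ω.2.2 t)) t = f.prediction ω t :=
      LearningRule.prediction_congr rfl
        (fun s hs => f.extendPath_response ω hs.le _) (f.extendPath_seed_le ω le_rfl)
    rwa [this] at hω
  · have hS : MeasurableSet {z : Y | powLoss α z (y 0) ≤ hedgeLevel α t} :=
      measurableSet_le (measurable_id.powLoss measurable_const) measurable_const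
    refine (ae_map_iff (measurable_prediction_extendPath f t v).aemeasurable hS).1 ?_
    rw [hf.map_prediction]
    rw [ae_iff]
    simp only [Measure.coe_finsetSum, Finset.sum_apply, Measure.smul_apply, smul_eq_mul]
    refine Finset.sum_eq_zero fun i hi => ?_
    have hS' : MeasurableSet {z : Y | ¬ powLoss α z (y 0) ≤ hedgeLevel α t} := hS.compl
    rw [Measure.dirac_apply' _ hS', Set.indicator_of_notMem, mul_zero]
    simpa using powLoss_simpleOfCode_le hα hi (v.1 t)

/-- The history contains the response of round `t`, so its truncation is a fixed point `z`, and
integrating the loss to `z` against the law of the prediction gives the mean loss. -/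
theorem LearningRule.IsTruncatedHedge.integral_hedgeNoise
    (hf : f.IsTruncatedHedge α y e) (t : ℕ) (v : f.History t) :
    ∫ r, hedgeNoise α y e f t (f.extendPath t (v, r)) ∂(f.law t : Measure f.Seed) = 0 := by
  set ys : ℕ → Y := extendSeq (v.2.1 0) v.2.1 with hys
  set z : Y := truncate α (y 0) (hedgeLevel α t) (ys t) with hz
  have hg : Measurable fun w : Y => powLoss α w z := measurable_id.powLoss measurable_const
  have hm := measurable_prediction_extendPath f t v
  have hint : Integrable (fun w : Y => powLoss α w z) ((f.law t : Measure f.Seed).map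
      fun r => f.prediction (f.extendPath t (v, r)) t) := by
    rw [hf.map_prediction]
    refine (integrable_finsetSum_measure).2 fun i _ => ?_
    exact Integrable.smul_measure (integrable_dirac' hg.stronglyMeasurable (by simp))
      ENNReal.ofReal_ne_top
  have h1 : ∫ r, powLoss α (f.prediction (f.extendPath t (v, r)) t) z
      ∂(f.law t : Measure f.Seed) = hedgeMeanLoss α y e v.1 ys t := by
    rw [← integral_map hm.aemeasurable hg.aestronglyMeasurable
      (f := fun w : Y => powLoss α w z), hf.map_prediction, integral_finsetSum_measure]
    · unfold hedgeMeanLoss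
      refine Finset.sum_congr rfl fun i _ => ?_
      rw [integral_smul_measure, integral_dirac' _ _ hg.stronglyMeasurable,
        ENNReal.toReal_ofReal (hedgeProb_nonneg _ _ _ _)]
      rfl
    · exact fun i _ => Integrable.smul_measure
        (integrable_dirac' hg.stronglyMeasurable (by simp)) ENNReal.ofReal_ne_top
  have hint' : Integrable (fun r => powLoss α (f.prediction (f.extendPath t (v, r)) t) z)
      (f.law t : Measure f.Seed) := hint.comp_measurable hm
  change ∫ r, (powLoss α (f.prediction (f.extendPath t (v, r)) t) z -
    hedgeMeanLoss α y e v.1 ys t) ∂(f.law t : Measure f.Seed) = 0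
  rw [integral_sub hint' (integrable_const _), h1]
  simp

/-- Almost surely, the cumulative loss of the Hedge variant is asymptotic to its compensator. -/
theorem LearningRule.IsTruncatedHedge.ae_eventually_abs_sum_hedgeNoise_le (hα : 1 ≤ α)
    (hf : f.IsTruncatedHedge α y e) (he : ∀ i, ∀ p ∈ e i, MeasurableSet p.2) (h0 : e 0 = [])
    {μ : ProbabilityMeasure (ℕ → X)} {P : ProbabilityMeasure f.Path}
    (h : IsAdversarialProcess f μ P) :
    ∀ᵐ ω ∂(P : Measure f.Path), ∀ ε : ℝ, 0 < ε → ∀ᶠ T : ℕ in atTop,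
      |∑ t ∈ Finset.range T, hedgeNoise α y e f t ω| ≤ ε * T := by
  have hb : ∀ t : ℕ, ∀ᵐ ω ∂(P : Measure f.Path),
      |hedgeNoise α y e f t ω| ≤ 2 * Real.log ((t : ℝ) + 1) := by
    intro t
    filter_upwards [hf.ae_powLoss_prediction_le hα h t] with ω hω
    have h1 := powLoss_le_two_mul_log hα hω (powLoss_truncate_le hα t (ω.2.1 t))
    have h2 := powLoss_nonneg (α := α) (f.prediction ω t)
      (truncate α (y 0) (hedgeLevel α t) (ω.2.1 t))
    have h3 := hedgeMeanLoss_le (y := y) hα h0 ω.1 ω.2.1 t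
    have h4 := hedgeMeanLoss_nonneg (α := α) (y := y) (e := e) ω.1 ω.2.1 t
    unfold hedgeNoise
    rw [abs_le]
    constructor <;> linarith
  refine ae_eventually_abs_sum_le (fun t => measurable_hedgeNoise he t) hb fun s t hst => ?_
  refine h.integral_mul_eq_zero (t := t) (measurable_hedgeNoise he s)
    (measurable_hedgeNoise he t)
    (integrable_mul_of_ae_abs_le (fun t => measurable_hedgeNoise he t) hb s t)
    (fun ω => hedgeNoise_congr rfl (fun r hr => f.extendPath_response ω (hr.trans hst.le) _)
      (f.extendPath_seed_le ω hst.le))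
    (fun v r r' => hedgeNoise_congr rfl (fun _ _ => rfl) ?_)
    (fun ω => hedgeNoise_congr rfl (fun r hr => f.extendPath_response ω hr _)
      (f.extendPath_seed_le ω le_rfl))
    (fun v => hf.integral_hedgeNoise t v)
  simp [LearningRule.extendPath, extendSeq, hst]

end HedgeMartingale

/-! ### Approximation of measurable functions by experts under `CS` -/

section Approximation

variable {X Y : Type u}

/-- When all sets of the list that contain `x` carry the same value, the order of the list no longer
matters. This holds off the set where the approximating sets differ from a partition. -/
theorem simpleOfCode_eq_of_forall {y : ℕ → Y} {c : List (ℕ × Set X)} {x : X} {v : Y}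
    (h : ∀ q ∈ c, x ∈ q.2 → y q.1 = v) (h' : y 0 = v ∨ ∃ q ∈ c, x ∈ q.2) :
    simpleOfCode y c x = v := by
  classical
  unfold simpleOfCode
  generalize y 0 = w at h'
  induction c generalizing w with
  | nil => simpa using h'
  | cons p c ih =>
    simp only [List.foldl_cons]
    refine ih (fun q hq => h q (by simp [hq])) _ ?_
    by_cases hp : x ∈ p.2
    · rw [if_pos hp]
      exact Or.inl (h p (by simp) hp)
    · rw [if_neg hp]
      rcases h' with h' | ⟨q, hq, hx⟩
      · exact Or.inl h'
      · rcases List.mem_cons.1 hq with rfl | hq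
        · exact absurd hx hp
        · exact Or.inr ⟨q, hq, hx⟩

variable [MeasurableSpace X]

theorem expUpperFreq_biUnion_le (μ : ProbabilityMeasure (ℕ → X)) {A : ℕ → Set X}
    (hA : ∀ k, MeasurableSet (A k)) (n : ℕ) :
    expUpperFreq μ (⋃ k ∈ Finset.range n, A k) ≤ ∑ k ∈ Finset.range n, expUpperFreq μ (A k) := by
  induction n with
  | zero => simp [expUpperFreq_empty]
  | succ n ih =>
    rw [Finset.sum_range_succ, Finset.range_add_one, Finset.set_biUnion_insert, Set.union_comm]
    exact (expUpperFreq_union_le μ (Finset.measurableSet_biUnion _ fun k _ => hA k) _).trans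
      (add_le_add ih le_rfl)

/-- The upper level sets of a finite-valued function decrease to `∅`; applied to the size of `g` and
to the label approximating it. -/
theorem exists_expUpperFreq_lt {μ : ProbabilityMeasure (ℕ → X)} (hμ : μ ∈ CSProcesses X)
    {h : X → ℕ} (hh : Measurable h) {ε : ℝ≥0∞} (hε : 0 < ε) :
    ∃ K : ℕ, expUpperFreq μ {x | K ≤ h x} < ε :=
  ((hμ (fun K => {x | K ≤ h x}) (fun _ => hh measurableSet_Ici)
    (fun _ _ hab _ hx => le_trans hab hx) (by
      ext x
      simp only [Set.mem_iInter, Set.mem_ofPred_eq, Set.mem_empty_iff_false, iff_false, not_forall]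
      exact ⟨h x + 1, by omega⟩)).eventually_lt_const hε).exists

variable [MeasurableSpace Y] [MetricSpace Y] [SecondCountableTopology Y] [BorelSpace Y] {α : ℝ}
  {𝒯 : Set (Set X)} {y : ℕ → Y} {e : ℕ → List (ℕ × Set X)}

open scoped Classical in
/-- Under a `CS` process, a measurable function is approximated by one of the experts, up to a set
of small expected frequency, and up to a set whose expected frequency is small even when weighted
by the range of the expert. -/
theorem IsHedgeData.exists_expert_approx (hα : 1 ≤ α) (hd : IsHedgeData 𝒯 y e)
    {μ : ProbabilityMeasure (ℕ → X)} (hμ : μ ∈ CSProcesses X) {g : X → Y} (hg : Measurable g)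
    {θ : ℝ} (hθ : 0 < θ) :
    ∃ (i : ℕ) (D G : Set X) (M : ℝ), MeasurableSet D ∧ MeasurableSet G ∧ 0 ≤ M ∧
      expUpperFreq μ D ≤ ENNReal.ofReal θ ∧
      ENNReal.ofReal M * expUpperFreq μ G ≤ ENNReal.ofReal θ ∧
      ∀ (x : X) (z : Y), max (powLoss α (simpleOfCode y (e i) x) z - powLoss α (g x) z) 0 ≤
        2 ^ α * (θ * (1 + powLoss α (y 0) z) + powLoss α (y 0) z * (if x ∈ D then 1 else 0) +
          M * (if x ∈ G then 1 else 0)) := by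
  have hθ3 : (0 : ℝ≥0∞) < ENNReal.ofReal (θ / 3) := by simp; positivity
  obtain ⟨m, hm⟩ := exists_expUpperFreq_lt hμ
    (h := fun x => ⌊powLoss α (y 0) (g x)⌋₊) (Nat.measurable_floor.comp
      (measurable_const.powLoss hg)) hθ3
  -- The relative error is tuned so that, where `ℓ(y^0, g x) ≤ m`, it costs at most `θ / 2 * (1 +
  -- ℓ(y^0, z))`; the term with `C₁` takes the other `θ / 2`.
  obtain ⟨C₁, hC₁, hC⟩ := exists_powLoss_le_add (Y := Y) hα
    (ε := θ / (2 * 2 ^ (α - 1) * (m + 1))) (by positivity)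
  have hfind : ∀ x, ∃ n, powLoss α (y n) (g x) < θ / (2 * C₁) := by
    intro x
    have hδ : (0 : ℝ) < (θ / (2 * C₁)) ^ (1 / α) := by positivity
    obtain ⟨n, hn⟩ := hd.dense_values.exists_dist_lt (g x) hδ
    refine ⟨n, ?_⟩
    have h1 : powLoss α (y n) (g x) < ((θ / (2 * C₁)) ^ (1 / α)) ^ α := by
      rw [powLoss, dist_comm]
      exact Real.rpow_lt_rpow dist_nonneg hn (by linarith)
    rwa [← Real.rpow_mul (by positivity), one_div_mul_cancel (by linarith), Real.rpow_one] at h1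
  set l : X → ℕ := fun x => Nat.find (hfind x) with hl
  have hlm : Measurable l := measurable_find hfind fun n =>
    measurableSet_lt (measurable_const.powLoss hg) measurable_const
  have hlspec : ∀ x, powLoss α (y (l x)) (g x) < θ / (2 * C₁) := fun x => Nat.find_spec (hfind x)
  obtain ⟨K, hK⟩ := exists_expUpperFreq_lt hμ hlm hθ3
  set F : Set X := {x | m ≤ ⌊powLoss α (y 0) (g x)⌋₊} with hF
  set H : Set X := {x | K ≤ l x} with hH
  have hFm : MeasurableSet F := (Nat.measurable_floor.comp (measurable_const.powLoss hg))
    measurableSet_Ici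
  have hHm : MeasurableSet H := hlm measurableSet_Ici
  set M : ℝ := ∑ p ∈ Finset.range K, powLoss α (y p) (y 0) with hM
  have hM0 : 0 ≤ M := Finset.sum_nonneg fun _ _ => powLoss_nonneg _ _
  set S : ℕ → Set X := fun p => Fᶜ ∩ {x | l x = p} with hS
  have hSm : ∀ p, MeasurableSet (S p) := fun p => hFm.compl.inter (hlm (measurableSet_singleton p))
  -- There are `K` pieces, so this precision gives their total error set a frequency at most `θ / (3
  -- (M + 1))`: small by itself, and small when multiplied by `M`.
  have hex : ∀ p, ∃ G ∈ 𝒯,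
      expUpperFreq μ (symmDiff G (S p)) < ENNReal.ofReal (θ / (3 * (M + 1) * (K + 1))) := by
    intro p
    have h1 := hd.dense_sets μ hμ (S p) (hSm p)
    have h2 : ⨅ G ∈ 𝒯, expUpperFreq μ (symmDiff G (S p)) <
        ENNReal.ofReal (θ / (3 * (M + 1) * (K + 1))) := by
      rw [h1, ENNReal.ofReal_pos]; positivity
    obtain ⟨G, hG⟩ := iInf_lt_iff.1 h2
    obtain ⟨hG1, hG2⟩ := iInf_lt_iff.1 hG
    exact ⟨G, hG1, hG2⟩
  choose A hA𝒯 hA using hex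
  set G : Set X := ⋃ p ∈ Finset.range K, symmDiff (A p) (S p) with hG
  have hsm : ∀ p, MeasurableSet (symmDiff (A p) (S p)) := fun p =>
    (hd.measurable _ (hA𝒯 p)).symmDiff (hSm p)
  have hGm : MeasurableSet G := Finset.measurableSet_biUnion _ fun p _ => hsm p
  have hGfreq : expUpperFreq μ G ≤ ENNReal.ofReal (θ / (3 * (M + 1))) := by
    refine (expUpperFreq_biUnion_le μ hsm K).trans
      ((Finset.sum_le_sum fun p _ => (hA p).le).trans ?_)
    rw [Finset.sum_const, Finset.card_range, nsmul_eq_mul, ← ENNReal.ofReal_natCast,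
      ← ENNReal.ofReal_mul (by positivity)]
    refine ENNReal.ofReal_le_ofReal ?_
    rw [mul_div_assoc', div_le_div_iff₀ (by positivity) (by positivity)]
    have : 0 ≤ θ * (3 * (M + 1)) := by positivity
    nlinarith
  obtain ⟨i, hi⟩ : (List.range K).map (fun p => (p, A p)) ∈ Set.range e := by
    rw [hd.range_codes]
    intro q hq
    obtain ⟨p, -, rfl⟩ := List.mem_map.1 hq
    exact hA𝒯 p
  refine ⟨i, F ∪ H ∪ G, G, M, (hFm.union hHm).union hGm, hGm, hM0, ?_, ?_, ?_⟩
  · refine (expUpperFreq_union_le μ (hFm.union hHm) G).trans ?_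
    have h3 : expUpperFreq μ G ≤ ENNReal.ofReal (θ / 3) := hGfreq.trans
      (ENNReal.ofReal_le_ofReal (div_le_div_of_nonneg_left hθ.le (by norm_num) (by linarith)))
    calc _ ≤ (ENNReal.ofReal (θ / 3) + ENNReal.ofReal (θ / 3)) + ENNReal.ofReal (θ / 3) :=
          add_le_add ((expUpperFreq_union_le μ hFm H).trans (add_le_add hm.le hK.le)) h3
      _ = ENNReal.ofReal θ := by
          rw [← ENNReal.ofReal_add (by positivity) (by positivity),
            ← ENNReal.ofReal_add (by positivity) (by positivity)]
          congr 1; ring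
  · calc _ ≤ ENNReal.ofReal M * ENNReal.ofReal (θ / (3 * (M + 1))) := by gcongr
      _ = ENNReal.ofReal (M * (θ / (3 * (M + 1)))) := (ENNReal.ofReal_mul hM0).symm
      _ ≤ _ := by
        refine ENNReal.ofReal_le_ofReal ?_
        rw [mul_div_assoc', div_le_iff₀ (by positivity)]
        nlinarith
  intro x z
  rw [hi]
  set v := simpleOfCode y ((List.range K).map fun p => (p, A p)) x with hv
  have ha : 0 ≤ powLoss α (y 0) z := powLoss_nonneg _ _
  have h2α : (2 : ℝ) ^ α = 2 * 2 ^ (α - 1) := by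
    rw [Real.rpow_sub two_pos, Real.rpow_one]; ring
  have h1α : (1 : ℝ) ≤ 2 ^ (α - 1) := Real.one_le_rpow (by norm_num) (by linarith)
  have hgz : 0 ≤ powLoss α (g x) z := powLoss_nonneg _ _
  refine max_le ?_ (by positivity)
  -- Three regimes. On `G` the expert takes a value within loss `M` of `y 0`. On the rest of `D` no
  -- approximating set contains `x`, so the expert predicts `y 0`. Off `D` it predicts `y (l x)`,
  -- which is close to `g x`.
  by_cases hxG : x ∈ G
  · have hvM : powLoss α v (y 0) ≤ M := by
      rcases simpleOfCode_mem y ((List.range K).map fun p => (p, A p)) x with h | ⟨q, hq, h⟩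
      · rw [hv, h, powLoss_self hα]; exact hM0
      · obtain ⟨p, hp, rfl⟩ := List.mem_map.1 hq
        rw [hv, h]
        exact Finset.single_le_sum (f := fun p => powLoss α (y p) (y 0))
          (fun _ _ => powLoss_nonneg _ _) (Finset.mem_range.2 (List.mem_range.1 hp))
    have h1 := powLoss_triangle hα v (y 0) z
    rw [if_pos hxG, if_pos (show x ∈ F ∪ H ∪ G from Or.inr hxG)]
    have h2 : (2 : ℝ) ^ (α - 1) * (powLoss α v (y 0) + powLoss α (y 0) z) ≤
        2 ^ α * (M + powLoss α (y 0) z) := by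
      rw [h2α]
      refine mul_le_mul (by linarith) (by linarith) ?_ (by positivity)
      have := powLoss_nonneg (α := α) v (y 0)
      linarith
    have h3 : 0 ≤ (2 : ℝ) ^ α * (θ * (1 + powLoss α (y 0) z)) := by positivity
    nlinarith
  have hAS : ∀ p < K, (x ∈ A p ↔ x ∈ S p) := by
    intro p hp
    have : x ∉ symmDiff (A p) (S p) := fun h => hxG (Set.mem_biUnion (Finset.mem_range.2 hp) h)
    rw [Set.mem_symmDiff] at this
    tauto
  by_cases hxD : x ∈ F ∪ H ∪ G
  · have hv0 : v = y 0 := by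
      refine simpleOfCode_eq_of_forall (fun q hq hx => ?_) (Or.inl rfl)
      obtain ⟨p, hp, rfl⟩ := List.mem_map.1 hq
      have hxS : x ∈ S p := (hAS p (List.mem_range.1 hp)).1 hx
      exfalso
      rcases hxD with (h | h) | h
      · exact hxS.1 h
      · have h1 : l x = p := hxS.2
        have h2 : K ≤ l x := h
        have := List.mem_range.1 hp
        omega
      · exact hxG h
    rw [hv0, if_neg hxG, if_pos hxD]
    have h3 : 0 ≤ (2 : ℝ) ^ α * (θ * (1 + powLoss α (y 0) z)) := by positivity
    have h4 : powLoss α (y 0) z ≤ 2 ^ α * powLoss α (y 0) z :=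
      le_mul_of_one_le_left ha (by linarith)
    nlinarith
  · rw [if_neg hxG, if_neg hxD]
    simp only [Set.mem_union, not_or] at hxD
    have hlK : l x < K := not_le.1 hxD.1.2
    have hv0 : v = y (l x) := by
      refine simpleOfCode_eq_of_forall (fun q hq hx => ?_)
        (Or.inr ⟨(l x, A (l x)), List.mem_map.2 ⟨l x, List.mem_range.2 hlK, rfl⟩,
          (hAS _ hlK).2 ⟨hxD.1.1, rfl⟩⟩)
      obtain ⟨p, hp, rfl⟩ := List.mem_map.1 hq
      have hxS : x ∈ S p := (hAS p (List.mem_range.1 hp)).1 hx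
      exact congrArg y hxS.2.symm
    have hgm : powLoss α (y 0) (g x) ≤ m := by
      have : ⌊powLoss α (y 0) (g x)⌋₊ < m := not_le.1 hxD.1.1
      exact ((Nat.floor_lt (powLoss_nonneg _ _)).1 this).le
    have h1 := hC v (g x) z
    have h2 := powLoss_triangle hα (g x) (y 0) z
    rw [powLoss_comm (g x) (y 0)] at h2
    have h3 : C₁ * powLoss α v (g x) ≤ θ / 2 := by
      rw [hv0]
      calc C₁ * powLoss α (y (l x)) (g x) ≤ C₁ * (θ / (2 * C₁)) := by
            gcongr; exact (hlspec x).le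
        _ = θ / 2 := by field_simp
    have h4 : θ / (2 * 2 ^ (α - 1) * (m + 1)) * powLoss α (g x) z ≤
        θ / 2 * (1 + powLoss α (y 0) z) := by
      calc θ / (2 * 2 ^ (α - 1) * (m + 1)) * powLoss α (g x) z
          ≤ θ / (2 * 2 ^ (α - 1) * (m + 1)) *
              (2 ^ (α - 1) * ((m + 1) * (1 + powLoss α (y 0) z))) := by
            refine mul_le_mul_of_nonneg_left (h2.trans ?_) (by positivity)
            refine mul_le_mul_of_nonneg_left ?_ (by positivity)
            have : (0 : ℝ) ≤ m := m.cast_nonneg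
            nlinarith
        _ = θ / 2 * (1 + powLoss α (y 0) z) := by field_simp
    have h5 : θ * (1 + powLoss α (y 0) z) ≤ 2 ^ α * (θ * (1 + powLoss α (y 0) z)) :=
      le_mul_of_one_le_left (by positivity) (by linarith)
    nlinarith

/-- Under a `CS` process, almost surely, some expert is nearly as good as a given measurable
function, for all empirically integrable responses. -/
theorem IsHedgeData.ae_exists_expert (hα : 1 ≤ α) (hd : IsHedgeData 𝒯 y e)
    {μ : ProbabilityMeasure (ℕ → X)} (hμ : μ ∈ CSProcesses X) {g : X → Y} (hg : Measurable g) :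
    ∀ᵐ x ∂(μ : Measure (ℕ → X)), ∀ ys : ℕ → Y, SeqUI (fun t => powLoss α (y 0) (ys t)) →
      ∀ ε : ℝ, 0 < ε → ∃ i, ∀ᶠ T : ℕ in atTop, ∑ t ∈ Finset.range T,
        max (powLoss α (simpleOfCode y (e i) (x t)) (ys t) - powLoss α (g (x t)) (ys t)) 0 ≤
          ε * T := by
  classical
  -- The errors `2 ^ (-k)` are summable, so almost surely both `D k` and the weighted `G k` have
  -- frequencies tending to `0`. This null set depends neither on the responses nor on the
  -- tolerance.
  choose i D G M hD hG hM hDf hGf hbound using fun k : ℕ =>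
    hd.exists_expert_approx hα hμ hg (θ := (1 / 2 : ℝ) ^ k) (by positivity)
  have hmeas : ∀ k, Measurable fun x : ℕ → X =>
      upperFreq x (D k) + ENNReal.ofReal (M k) * upperFreq x (G k) := fun k =>
    (measurable_upperFreq (hD k)).add ((measurable_upperFreq (hG k)).const_mul _)
  have hfin : ∫⁻ x, ∑' k, (upperFreq x (D k) + ENNReal.ofReal (M k) * upperFreq x (G k))
      ∂(μ : Measure (ℕ → X)) ≠ ⊤ := by
    rw [lintegral_tsum fun k => (hmeas k).aemeasurable]
    have hle : ∀ k, ∫⁻ x, (upperFreq x (D k) + ENNReal.ofReal (M k) * upperFreq x (G k))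
        ∂(μ : Measure (ℕ → X)) ≤ ENNReal.ofReal (2 * (1 / 2 : ℝ) ^ k) := by
      intro k
      rw [lintegral_add_left (measurable_upperFreq (hD k)),
        lintegral_const_mul _ (measurable_upperFreq (hG k)), two_mul,
        ENNReal.ofReal_add (by positivity) (by positivity)]
      exact add_le_add (hDf k) (hGf k)
    refine ne_top_of_le_ne_top ?_ (ENNReal.tsum_le_tsum hle)
    exact ((summable_geometric_of_lt_one (by norm_num) (by norm_num)).mul_left 2).tsum_ofReal_ne_top
  filter_upwards [ae_lt_top (Measurable.tsum hmeas) hfin] with x hx ys hUI ε hε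
  have hlim := ENNReal.tendsto_atTop_zero_of_tsum_ne_top hx.ne
  have ha : ∀ t, 0 ≤ powLoss α (y 0) (ys t) := fun t => powLoss_nonneg _ _
  obtain ⟨C₀, hC₀, hsum⟩ := hUI.sum_le
  set c : ℝ := (2 : ℝ) ^ α with hc
  have hcpos : 0 < c := by positivity
  -- Four errors of size `ε' * T` occur: one from `θ`, two from `D` (frequent small losses and rare
  -- large ones) and one from `G`.
  set ε' : ℝ := ε / (4 * c) with hε'
  have hε'pos : 0 < ε' := by positivity
  obtain ⟨M₀, hM₀, hprod⟩ := hUI.sum_mul_le hε'pos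
  set ρ : ℝ := ε' / (M₀ + 1) with hρ
  have hρpos : 0 < ρ := by positivity
  have hθ : ∀ᶠ k : ℕ in atTop, (1 / 2 : ℝ) ^ k < ε' / (1 + C₀) :=
    (tendsto_pow_atTop_nhds_zero_of_lt_one (by norm_num) (by norm_num)).eventually_lt_const
      (by positivity)
  obtain ⟨k, hk1, hk2⟩ := (hθ.and (hlim.eventually_lt_const
    (u := ENNReal.ofReal ρ) (by simpa using hρpos))).exists
  refine ⟨i k, ?_⟩
  have hDx := sum_indicator_le_of_upperFreq_lt (lt_of_le_of_lt le_self_add hk2)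
  have hGx : ∀ᶠ T : ℕ in atTop,
      M k * ∑ t ∈ Finset.range T, (if x t ∈ G k then (1 : ℝ) else 0) ≤ ε' * T := by
    rcases (hM k).eq_or_lt with h0 | h0
    · refine Eventually.of_forall fun T => ?_
      rw [← h0, zero_mul]; positivity
    · have h1 : ENNReal.ofReal (M k) * upperFreq x (G k) < ENNReal.ofReal ρ :=
        lt_of_le_of_lt le_add_self hk2
      have h2 : upperFreq x (G k) < ENNReal.ofReal (ρ / M k) := by
        rw [ENNReal.ofReal_div_of_pos h0, ENNReal.lt_div_iff_mul_lt (Or.inl (by simpa using h0))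
          (Or.inl ENNReal.ofReal_ne_top), mul_comm]
        exact h1
      filter_upwards [sum_indicator_le_of_upperFreq_lt h2] with T hT
      calc _ ≤ M k * (ρ / M k * T) := by gcongr
        _ = ρ * T := by field_simp
        _ ≤ ε' * T := by
          refine mul_le_mul_of_nonneg_right ?_ T.cast_nonneg
          rw [hρ]
          exact div_le_self hε'pos.le (by linarith)
  filter_upwards [hDx, hGx, hsum, hprod] with T h1 h2 h3 h4
  have h5 := h4 (fun t => if x t ∈ D k then 1 else 0) (fun t => by split_ifs <;> norm_num)
    (fun t => by split_ifs <;> norm_num)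
  have h6 : M₀ * ∑ t ∈ Finset.range T, (if x t ∈ D k then (1 : ℝ) else 0) ≤ ε' * T := by
    calc _ ≤ M₀ * (ρ * T) := by gcongr
      _ ≤ (M₀ + 1) * (ρ * T) := by gcongr; linarith
      _ = ε' * T := by rw [hρ]; field_simp
  have h7 : ∑ t ∈ Finset.range T, (1 / 2 : ℝ) ^ k * (1 + powLoss α (y 0) (ys t)) ≤ ε' * T := by
    rw [← Finset.mul_sum, Finset.sum_add_distrib, Finset.sum_const, Finset.card_range,
      nsmul_eq_mul, mul_one]
    calc _ ≤ (1 / 2 : ℝ) ^ k * ((1 + C₀) * T) := by gcongr; linarith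
      _ ≤ ε' / (1 + C₀) * ((1 + C₀) * T) := by gcongr
      _ = ε' * T := by field_simp
  calc _ ≤ ∑ t ∈ Finset.range T, c * ((1 / 2 : ℝ) ^ k * (1 + powLoss α (y 0) (ys t)) +
        powLoss α (y 0) (ys t) * (if x t ∈ D k then 1 else 0) +
          M k * (if x t ∈ G k then 1 else 0)) :=
        Finset.sum_le_sum fun t _ => hbound k (x t) (ys t)
    _ = c * (∑ t ∈ Finset.range T, (1 / 2 : ℝ) ^ k * (1 + powLoss α (y 0) (ys t)) +
        ∑ t ∈ Finset.range T, powLoss α (y 0) (ys t) * (if x t ∈ D k then 1 else 0) +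
          M k * ∑ t ∈ Finset.range T, (if x t ∈ G k then (1 : ℝ) else 0)) := by
        rw [← Finset.mul_sum, Finset.sum_add_distrib, Finset.sum_add_distrib, Finset.mul_sum
          (a := M k)]
    _ ≤ c * (ε' * T + (ε' * T + ε' * T) + ε' * T) := by
        gcongr
        linarith
    _ = ε * T := by rw [hε']; field_simp; ring

end Approximation

/-! ### Consistency of the truncated Hedge rule -/

section HedgeConsistency

theorem IsHedgeData.measurableSet_code {X Y : Type u} [MeasurableSpace X] [MetricSpace Y]
    {𝒯 : Set (Set X)} {y : ℕ → Y} {e : ℕ → List (ℕ × Set X)} (hd : IsHedgeData 𝒯 y e) (i : ℕ) :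
    ∀ p ∈ e i, MeasurableSet p.2 := fun p hp => by
  have : e i ∈ {c | ∀ p ∈ c, p.2 ∈ 𝒯} := hd.range_codes ▸ Set.mem_range_self i
  exact hd.measurable _ (this p hp)

variable {X Y : Type u} [MeasurableSpace X] [MeasurableSpace Y] [MetricSpace Y]
  {α : ℝ} {y : ℕ → Y} {e : ℕ → List (ℕ × Set X)} {f : LearningRule X Y}

/-- The excess loss of the Hedge variant in one round. -/
theorem excess_le_of_mem_hedgeActive (hα : 1 ≤ α) (ω : f.Path) {t i : ℕ}
    (hpred : powLoss α (f.prediction ω t) (y 0) ≤ hedgeLevel α t)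
    (hi : i ∈ hedgeActive α y e t) (z : Y) :
    powLoss α (f.prediction ω t) (ω.2.1 t) - powLoss α z (ω.2.1 t) ≤
      hedgeNoise α y e f t ω +
      (hedgeMeanLoss α y e ω.1 ω.2.1 t - hedgeExpertLoss α y e ω.1 ω.2.1 t i) +
      max (powLoss α (simpleOfCode y (e i) (ω.1 t)) (ω.2.1 t) - powLoss α z (ω.2.1 t)) 0 +
      (2 ^ α + 1) *
        (if hedgeLevel α t ≤ powLoss α (y 0) (ω.2.1 t) then powLoss α (y 0) (ω.2.1 t) else 0) := by
  have h0 := powLoss_nonneg (α := α) z (ω.2.1 t)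
  have hexp := powLoss_simpleOfCode_le hα hi (ω.1 t)
  unfold hedgeNoise hedgeExpertLoss truncate
  rw [powLoss_comm (ω.2.1 t) (y 0)]
  by_cases htr : hedgeLevel α t ≤ powLoss α (y 0) (ω.2.1 t)
  -- The prediction and the expert are both within the level, hence within `ℓ(y^0, Y_t)`, of `y^0`.
  -- The factor `2 ^ α` pays for the prediction, the extra `1` for the expert's loss subtracted in
  -- the regret.
  · rw [if_neg (not_lt.2 htr), if_pos htr]
    have h1 := powLoss_triangle hα (f.prediction ω t) (y 0) (ω.2.1 t)
    have h2 := powLoss_nonneg (α := α) (f.prediction ω t) (y 0)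
    have h3 := le_max_right
      (powLoss α (simpleOfCode y (e i) (ω.1 t)) (ω.2.1 t) - powLoss α z (ω.2.1 t)) 0
    have h4 : (2 : ℝ) ^ (α - 1) * (powLoss α (f.prediction ω t) (y 0) +
        powLoss α (y 0) (ω.2.1 t)) ≤ 2 ^ α * powLoss α (y 0) (ω.2.1 t) := by
      have h2α : (2 : ℝ) ^ α = 2 ^ (α - 1) * 2 := by
        rw [Real.rpow_sub two_pos, Real.rpow_one]; ring
      rw [h2α, mul_assoc]
      exact mul_le_mul_of_nonneg_left (by linarith) (by positivity)
    linarith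
  · rw [if_pos (not_le.1 htr), if_neg htr]
    have h3 := le_max_left
      (powLoss α (simpleOfCode y (e i) (ω.1 t)) (ω.2.1 t) - powLoss α z (ω.2.1 t)) 0
    linarith

variable [SecondCountableTopology Y] [BorelSpace Y] {𝒯 : Set (Set X)}

/-- The truncated Hedge variant is universally consistent under every `CS` process. -/
theorem LearningRule.IsTruncatedHedge.universallyConsistent (hα : 1 ≤ α)
    (hd : IsHedgeData 𝒯 y e) (hf : f.IsTruncatedHedge α y e) {μ : ProbabilityMeasure (ℕ → X)}
    (hμ : μ ∈ CSProcesses X) : f.UniversallyConsistent α μ := by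
  intro P hP hint g hg
  have happrox := hd.ae_exists_expert hα hμ hg
  rw [← hP.instance_law] at happrox
  filter_upwards [hint.ae_seqUI hα (y 0),
    hf.ae_eventually_abs_sum_hedgeNoise_le hα hd.measurableSet_code hd.code_zero hP,
    ae_of_ae_map measurable_fst.aemeasurable happrox,
    ae_all_iff.2 fun t => hf.ae_powLoss_prediction_le hα hP t] with ω hUI hnoise hex hpred
  -- Five shares of `c / 5`: the rounds before the expert is in use, the approximation, the noise,
  -- the regret and the truncation.
  refine limsup_le_of_sum_le fun c hc => ?_
  obtain ⟨i, hi⟩ := hex _ hUI (c / 5) (by positivity)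
  obtain ⟨t₀, ht₀⟩ := eventually_atTop.1 (eventually_mem_hedgeActive (α := α) (y := y) (e := e) i)
  have hC : (0 : ℝ) < 2 ^ α + 1 := by positivity
  have h1 := sum_range_eventually_le (t₀ := t₀) (fun t ht => sub_nonpos.2
    (excess_le_of_mem_hedgeActive hα ω (hpred t) (ht₀ t ht) (g (ω.1 t))))
    (ε := c / 5) (by positivity)
  filter_upwards [h1, hi, hnoise (c / 5) (by positivity),
    eventually_sum_hedgeMeanLoss_sub_le (y := y) hα hd.code_zero ω.1 ω.2.1 i (ε := c / 5) (by positivity),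
    hUI.sum_ge_level_le (fun t => powLoss_nonneg _ _) (tendsto_hedgeLevel (α := α))
      (ε := c / 5 / (2 ^ α + 1)) (by positivity)] with T h1 h2 h3 h4 h5
  simp only [Finset.sum_sub_distrib, Finset.sum_add_distrib, ← Finset.mul_sum] at h1 h4 ⊢
  have h6 := mul_le_mul_of_nonneg_left h5 hC.le
  rw [← mul_assoc, mul_div_cancel₀ _ hC.ne'] at h6
  have h7 := (abs_le.1 h3).2
  linarith

end HedgeConsistency

/-! ### Hard sequences for a random number of rounds -/

section HardSequences

theorem sum_range_mul_eq {Q n : ℕ} (ψ : ℕ → ℝ) :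
    ∑ t ∈ Finset.range (Q * n), ψ t =
      ∑ q ∈ Finset.range Q, ∑ k ∈ Finset.range n, ψ (q * n + k) := by
  induction Q with
  | zero => simp
  | succ Q ih => rw [Nat.succ_mul, Finset.sum_range_add, ih, Finset.sum_range_succ]

theorem apply_eq_sum_indicator {Ω : Type*} {N : Ω → ℕ} {m : ℕ} (hN : ∀ ω, N ω ∈ Finset.Icc 1 m)
    (F : ℕ → Ω → ℝ) (ω : Ω) :
    F (N ω) ω = ∑ n ∈ Finset.Icc 1 m, (N ⁻¹' {n}).indicator (F n) ω := by
  rw [Finset.sum_eq_single_of_mem _ (hN ω)]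
  · simp
  · intro n _ hn
    rw [Set.indicator_of_notMem]
    simpa using hn.symm

theorem integral_apply_nat {Ω : Type*} [MeasurableSpace Ω] {ν : Measure Ω} {N : Ω → ℕ} {m : ℕ}
    (hNm : Measurable N) (hN : ∀ ω, N ω ∈ Finset.Icc 1 m) {F : ℕ → Ω → ℝ}
    (hF : ∀ n, Integrable (F n) ν) :
    ∫ ω, F (N ω) ω ∂ν = ∑ n ∈ Finset.Icc 1 m, ∫ ω in N ⁻¹' {n}, F n ω ∂ν := by
  simp only [apply_eq_sum_indicator hN F]
  rw [integral_finsetSum _ fun n _ => (hF n).indicator (hNm (measurableSet_singleton n))]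
  exact Finset.sum_congr rfl fun n _ => integral_indicator (hNm (measurableSet_singleton n))

variable {Y : Type u} [MeasurableSpace Y] [MetricSpace Y] [SecondCountableTopology Y]
  [BorelSpace Y] {α : ℝ}

/-- If finite-time mean estimation fails on `S`, then every causal family of predictors, run for a
random number of rounds, incurs a linear expected regret on some sequences in `S` which depend only
on the number of rounds, with respect to a fixed point of `S`. -/
theorem exists_hard_sequences [Nonempty Y] {S : Set Y} (hS : ¬ FTiMEOn α S) :
    ∃ η : ℝ, 0 < η ∧ ∀ (Ω : Type u) [MeasurableSpace Ω] (ν : Measure Ω) [IsProbabilityMeasure ν]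
      (N : Ω → ℕ) (m : ℕ) (h : ℕ → Ω → (ℕ → Y) → Y) (B : ℝ),
      Measurable N → (∀ ω, N ω ∈ Finset.Icc 1 m) →
      (∀ k, Measurable fun p : Ω × (ℕ → Y) => h k p.1 p.2) →
      (∀ k ω z z', (∀ j < k, z j = z' j) → h k ω z = h k ω z') →
      (∀ k ω z, ∀ s ∈ S, powLoss α (h k ω z) s ≤ B) →
      ∃ c ∈ S, ∃ z : ℕ → ℕ → Y, (∀ n j, z n j ∈ S) ∧
        η ≤ ∫ ω, (∑ k ∈ Finset.range (N ω), (powLoss α (h k ω (z (N ω))) (z (N ω) k) -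
          powLoss α c (z (N ω) k))) / N ω ∂ν := by
  unfold FTiMEOn at hS
  push Not at hS
  obtain ⟨η, hη, hS⟩ := hS
  refine ⟨η, hη, fun Ω _ ν _ N m h B hNm hN hhm hcausal hB => ?_⟩
  -- A horizon divisible by every possible value of `N`, so that restarts every `N` rounds produce
  -- whole blocks only.
  set M : ℕ := m.factorial with hM
  have hM1 : 1 ≤ M := Nat.factorial_pos m
  have hdvd : ∀ n ∈ Finset.Icc 1 m, n ∣ M := fun n hn =>
    Nat.dvd_factorial (Finset.mem_Icc.1 hn).1 (Finset.mem_Icc.1 hn).2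
  obtain ⟨y₀⟩ := ‹Nonempty Y›
  -- The whole sample point is redrawn in every round. F-TiME only involves the expected loss of
  -- each round, so by linearity this is as good as one sample point kept throughout.
  let g : LearningRule PUnit.{u + 1} Y :=
    { Seed := Ω
      law := fun _ => ⟨ν, inferInstance⟩
      -- The predictor is shown the responses since the start `t - t % N ω` of the current block.
      predict := fun t ω _ yy _ => h (t % N ω) ω fun j => extendSeq y₀ yy (t - t % N ω + j)
      measurable_predict := fun t => by
        have h1 : Measurable fun q : ℕ × (Ω × (Fin t → Y)) =>
            h (t % q.1) q.2.1 fun j => extendSeq y₀ q.2.2 (t - t % q.1 + j) := by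
          refine measurable_from_prod_countable_right fun n => ?_
          refine (hhm (t % n)).comp (Measurable.prodMk measurable_fst ?_)
          refine measurable_pi_lambda _ fun j => ?_
          exact measurable_pi_iff.1 (measurable_extendSeq (Ω := Ω × (Fin t → Y)) (t := t)
            (z₀ := fun _ => y₀) (z := fun q => q.2) measurable_const measurable_snd)
            (t - t % n + j)
        exact h1.comp (by fun_prop : Measurable fun p : Ω × (Fin t → PUnit.{u + 1}) ×
          (Fin t → Y) × PUnit.{u + 1} => (N p.1, (p.1, p.2.2.1))) }
  obtain ⟨y', hy', c, hc, hreg⟩ := hS M hM1 g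
  set y : ℕ → Y := fun t => if t < M then y' t else c with hy
  have hyS : ∀ t, y t ∈ S := fun t => by
    simp only [hy]; split_ifs with h
    · exact hy' t h
    · exact hc
  have hyy : ∀ t < M, y t = y' t := fun t ht => by simp [hy, ht]
  set H : ℕ → ℕ → Ω → ℝ := fun q n ω => ∑ k ∈ Finset.range n,
    (powLoss α (h k ω fun j => y (q * n + j)) (y (q * n + k)) - powLoss α c (y (q * n + k))) with hH
  set φ : ℕ → Ω → ℝ := fun t ω =>
    powLoss α (h (t % N ω) ω fun j => y (t - t % N ω + j)) (y t) with hφ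
  have hφm : ∀ t, Measurable (φ t) := fun t => by
    have h1 : Measurable fun q : ℕ × Ω =>
        powLoss α (h (t % q.1) q.2 fun j => y (t - t % q.1 + j)) (y t) := by
      refine measurable_from_prod_countable_right fun n => ?_
      exact Measurable.powLoss (f := fun ω => h (t % n) ω fun j => y (t - t % n + j))
        ((hhm (t % n)).comp (measurable_id.prodMk measurable_const)) measurable_const
    exact h1.comp (hNm.prodMk measurable_id)
  have hφ0 : ∀ t ω, 0 ≤ φ t ω := fun t ω => powLoss_nonneg _ _
  have hφB : ∀ t ω, φ t ω ≤ B := fun t ω => hB _ _ _ _ (hyS t)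
  have hφi : ∀ t, Integrable (φ t) ν := fun t =>
    Integrable.of_bound (hφm t).aestronglyMeasurable B
      (ae_of_all _ fun ω => by rw [Real.norm_eq_abs, abs_of_nonneg (hφ0 t ω)]; exact hφB t ω)
  have hpred : ∀ t < M, ∀ ω, powLoss α (g.predict t ω (fun _ => PUnit.unit)
      (fun s : Fin t => y' s) PUnit.unit) (y' t) = φ t ω := by
    intro t ht ω
    simp only [hφ, g]
    rw [hyy t ht]
    congr 1
    refine hcausal _ _ _ _ fun j hj => ?_
    have hle := Nat.mod_le t (N ω)
    have hlt : t - t % N ω + j < t := by omega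
    rw [extendSeq_apply _ _ hlt, hyy _ (hlt.trans ht)]
  have hreg' : ∑ t ∈ Finset.range M, powLoss α c (y t) + η * M <
      ∑ t ∈ Finset.range M, ∫ ω, φ t ω ∂ν := by
    have h1 : ∑ t ∈ Finset.range M, ∫⁻ r, ENNReal.ofReal (powLoss α (g.predict t r
        (fun _ => PUnit.unit) (fun s : Fin t => y' s) PUnit.unit) (y' t))
          ∂(g.law t : Measure g.Seed) = ENNReal.ofReal (∑ t ∈ Finset.range M, ∫ ω, φ t ω ∂ν) := by
      rw [ENNReal.ofReal_sum_of_nonneg fun t _ => integral_nonneg (hφ0 t)]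
      refine Finset.sum_congr rfl fun t ht => ?_
      rw [ofReal_integral_eq_lintegral_ofReal (hφi t) (ae_of_all _ (hφ0 t))]
      exact lintegral_congr fun ω => by rw [hpred t (Finset.mem_range.1 ht) ω]
    have h2 : ∑ t ∈ Finset.range M, ENNReal.ofReal (powLoss α c (y' t)) + ENNReal.ofReal (η * M) =
        ENNReal.ofReal (∑ t ∈ Finset.range M, powLoss α c (y t) + η * M) := by
      rw [ENNReal.ofReal_add (Finset.sum_nonneg fun _ _ => powLoss_nonneg _ _) (by positivity),
        ENNReal.ofReal_sum_of_nonneg fun t _ => powLoss_nonneg _ _]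
      congr 1
      exact Finset.sum_congr rfl fun t ht => by rw [hyy t (Finset.mem_range.1 ht)]
    rw [h1, h2, ENNReal.ofReal_lt_ofReal_iff_of_nonneg
      (add_nonneg (Finset.sum_nonneg fun _ _ => powLoss_nonneg _ _) (by positivity))] at hreg
    exact hreg
  have hblock : ∀ ω, ∑ t ∈ Finset.range M, (φ t ω - powLoss α c (y t)) =
      ∑ q ∈ Finset.range (M / N ω), H q (N ω) ω := by
    intro ω
    have hpos : 0 < N ω := (Finset.mem_Icc.1 (hN ω)).1
    rw [← Nat.div_mul_cancel (hdvd _ (hN ω)), sum_range_mul_eq, Nat.mul_div_cancel _ hpos]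
    refine Finset.sum_congr rfl fun q _ => Finset.sum_congr rfl fun k hk => ?_
    have hk' := Finset.mem_range.1 hk
    have hmod : (q * N ω + k) % N ω = k := by
      rw [Nat.add_comm, Nat.add_mul_mod_self_right, Nat.mod_eq_of_lt hk']
    simp only [hφ]
    rw [hmod, Nat.add_sub_cancel]
  have hHi : ∀ q n, Integrable (H q n) ν := fun q n => by
    refine integrable_finsetSum _ fun k _ => Integrable.sub ?_ (integrable_const _)
    refine Integrable.of_bound (((hhm k).comp (measurable_id.prodMk measurable_const)).powLoss
      measurable_const).aestronglyMeasurable B (ae_of_all _ fun ω => ?_)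
    rw [Real.norm_eq_abs, abs_of_nonneg (powLoss_nonneg _ _)]
    exact hB _ _ _ _ (hyS _)
  have hsum : η * M ≤ ∑ n ∈ Finset.Icc 1 m, ∑ q ∈ Finset.range (M / n),
      ∫ ω in N ⁻¹' {n}, H q n ω ∂ν := by
    have h1 : ∫ ω, ∑ t ∈ Finset.range M, (φ t ω - powLoss α c (y t)) ∂ν =
        ∑ t ∈ Finset.range M, ∫ ω, φ t ω ∂ν - ∑ t ∈ Finset.range M, powLoss α c (y t) := by
      have hi : ∀ t ∈ Finset.range M, Integrable (fun ω => φ t ω - powLoss α c (y t)) ν :=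
        fun t _ => (hφi t).sub (integrable_const _)
      rw [integral_finsetSum _ hi, ← Finset.sum_sub_distrib]
      refine Finset.sum_congr rfl fun t _ => ?_
      rw [integral_sub (hφi t) (integrable_const _)]
      simp
    have h2 : ∫ ω, ∑ t ∈ Finset.range M, (φ t ω - powLoss α c (y t)) ∂ν =
        ∑ n ∈ Finset.Icc 1 m, ∑ q ∈ Finset.range (M / n), ∫ ω in N ⁻¹' {n}, H q n ω ∂ν := by
      simp only [hblock]
      rw [integral_apply_nat hNm hN (F := fun n ω => ∑ q ∈ Finset.range (M / n), H q n ω)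
        fun n => integrable_finsetSum _ fun q _ => hHi q n]
      exact Finset.sum_congr rfl fun n _ =>
        integral_finsetSum _ fun q _ => (hHi q n).integrableOn
    rw [← h2, h1]
    linarith
  -- For each `n`, keep the block with the largest regret on `{N = n}`. It dominates the average
  -- over the `M / n` blocks, whose number becomes the division by `N`.
  have hmax : ∀ n, ∃ q, n ∈ Finset.Icc 1 m → ∀ q' ∈ Finset.range (M / n),
      ∫ ω in N ⁻¹' {n}, H q' n ω ∂ν ≤ ∫ ω in N ⁻¹' {n}, H q n ω ∂ν := by
    intro n
    by_cases hn : n ∈ Finset.Icc 1 m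
    · have hne : (Finset.range (M / n)).Nonempty :=
        Finset.nonempty_range_iff.2 (Nat.div_pos (Nat.le_of_dvd hM1 (hdvd n hn))
          (Finset.mem_Icc.1 hn).1).ne'
      obtain ⟨q, -, hq⟩ := Finset.exists_max_image _
        (fun q => ∫ ω in N ⁻¹' {n}, H q n ω ∂ν) hne
      exact ⟨q, fun _ => hq⟩
    · exact ⟨0, fun h => absurd h hn⟩
  choose q hq using hmax
  refine ⟨c, hc, fun n j => y (q n * n + j), fun n j => hyS _, ?_⟩
  have hfinal : ∫ ω, H (q (N ω)) (N ω) ω / N ω ∂ν =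
      ∑ n ∈ Finset.Icc 1 m, (∫ ω in N ⁻¹' {n}, H (q n) n ω ∂ν) / n := by
    rw [integral_apply_nat hNm hN (F := fun n ω => H (q n) n ω / n)
      fun n => (hHi _ _).div_const _]
    exact Finset.sum_congr rfl fun n _ => integral_div _ _
  change η ≤ ∫ ω, H (q (N ω)) (N ω) ω / N ω ∂ν
  rw [hfinal]
  have hMpos : (0 : ℝ) < M := by exact_mod_cast hM1
  refine le_of_mul_le_mul_right (hsum.trans ?_) hMpos
  rw [Finset.sum_mul]
  refine Finset.sum_le_sum fun n hn => ?_
  have hn0 : (0 : ℝ) < n := by exact_mod_cast (Finset.mem_Icc.1 hn).1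
  refine (Finset.sum_le_card_nsmul _ _ _ (hq n hn)).trans_eq ?_
  rw [Finset.card_range, nsmul_eq_mul, Nat.cast_div (hdvd n hn) hn0.ne']
  field_simp

end HardSequences

/-! ### Stages of visits to disjoint sets when `CS` fails -/

section VisitStages

open scoped Classical in
/-- A sequence of stages at which a process of law `μ` visits pairwise disjoint sets a positive
fraction of the time. -/
structure VisitStages {X : Type u} [MeasurableSpace X] (μ : ProbabilityMeasure (ℕ → X)) where
  /-- the guaranteed fraction of visits, and lower bound on the probability of success -/
  frac : ℝ
  frac_pos : 0 < frac
  /-- the time at which a stage starts -/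
  start : ℕ → ℕ
  strictMono_start : StrictMono start
  /-- the set visited during a stage -/
  target : ℕ → Set X
  measurableSet_target : ∀ i, MeasurableSet (target i)
  disjoint_target : Pairwise fun i j => Disjoint (target i) (target j)
  /-- the event that a stage succeeds -/
  success : ℕ → Set (ℕ → X)
  measurableSet_success : ∀ i, MeasurableSet (success i)
  le_measure_success : ∀ i, ENNReal.ofReal frac ≤ (μ : Measure (ℕ → X)) (success i)
  /-- the end of a successful stage -/
  finish : ℕ → (ℕ → X) → ℕ
  measurable_finish : ∀ i, Measurable (finish i)
  start_lt_finish : ∀ i, ∀ x ∈ success i, start i < finish i x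
  finish_le_start : ∀ i, ∀ x ∈ success i, finish i x ≤ start (i + 1)
  -- All that precedes stage `i` fills at most a fraction `1 / (i + 1)` of the time up to its end.
  mul_start_le_finish : ∀ i, ∀ x ∈ success i, (i + 1) * start i ≤ finish i x
  -- On success, the data of later stages cannot have been used before the next stage starts.
  notMem_target : ∀ i, ∀ x ∈ success i, ∀ t < start (i + 1), ∀ j, i < j → x t ∉ target j
  frac_mul_finish_le : ∀ i, ∀ x ∈ success i,
    frac * finish i x ≤ Nat.count (fun t => start i ≤ t ∧ x t ∈ target i) (finish i x)

open scoped Classical in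
theorem sum_indicator_eq_count {X : Type u} (x : ℕ → X) (A : Set X) (T : ℕ) :
    ∑ t ∈ Finset.range T, (if x t ∈ A then (1 : ℝ) else 0) =
      Nat.count (fun t => x t ∈ A) T := by
  rw [Nat.count_eq_card_filter_range, Finset.sum_boole]

theorem count_le_add_count {p q : ℕ → Prop} [DecidablePred p] [DecidablePred q] {s T : ℕ}
    (h : ∀ t < T, s ≤ t → p t → q t) : Nat.count p T ≤ s + Nat.count q T := by
  rw [Nat.count_eq_card_filter_range, Nat.count_eq_card_filter_range, ← Finset.card_range s]
  refine (Finset.card_le_card fun t ht => ?_).trans (Finset.card_union_le _ _)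
  simp only [Finset.mem_filter, Finset.mem_range, Finset.mem_union] at ht ⊢
  by_cases hs : t < s
  · exact Or.inl hs
  · exact Or.inr ⟨ht.1, h t ht.1 (not_lt.1 hs) ht.2⟩

variable {X : Type u} [MeasurableSpace X]

/-- The expected frequencies are nonincreasing, so without `CS` they stay above some `ε`. A
frequency is at most `1`, hence its mean is at most `ε / 2` plus the probability that it exceeds `ε
/ 2`; take `δ = ε / 2`. -/
theorem exists_lt_expUpperFreq {μ : ProbabilityMeasure (ℕ → X)} (hμ : μ ∉ CSProcesses X) :
    ∃ (δ : ℝ) (A : ℕ → Set X), 0 < δ ∧ (∀ k, MeasurableSet (A k)) ∧ Antitone A ∧ ⋂ k, A k = ∅ ∧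
      ∀ k, ENNReal.ofReal δ ≤
        (μ : Measure (ℕ → X)) {x | ENNReal.ofReal δ < upperFreq x (A k)} := by
  simp only [CSProcesses, Set.mem_ofPred_eq, not_forall] at hμ
  obtain ⟨A, hAm, hA, hAe, hlim⟩ := hμ
  have hanti : Antitone fun k => expUpperFreq μ (A k) := fun i j h => expUpperFreq_mono μ (hA h)
  rw [ENNReal.tendsto_atTop_zero_iff_le_of_antitone hanti] at hlim
  push Not at hlim
  obtain ⟨ε, hε, hlim⟩ := hlim
  have hle1 : expUpperFreq μ (A 0) ≤ 1 := by
    calc expUpperFreq μ (A 0) ≤ ∫⁻ _, 1 ∂(μ : Measure (ℕ → X)) :=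
          lintegral_mono fun x => upperFreq_le_one x _
      _ = 1 := by simp
  have hεtop : ε ≠ ⊤ := ne_top_of_lt ((hlim 0).trans_le (hle1.trans_lt ENNReal.one_lt_top).le)
  have hδ : 0 < ε.toReal / 2 := half_pos (ENNReal.toReal_pos hε.ne' hεtop)
  refine ⟨ε.toReal / 2, A, hδ, hAm, hA, hAe, fun k => ?_⟩
  set c := ENNReal.ofReal (ε.toReal / 2) with hc
  have hcc : c + c = ε := by
    rw [hc, ← ENNReal.ofReal_add hδ.le hδ.le, add_halves, ENNReal.ofReal_toReal hεtop]
  have hms : MeasurableSet {x : ℕ → X | c < upperFreq x (A k)} :=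
    measurableSet_lt measurable_const (measurable_upperFreq (hAm k))
  have h1 : expUpperFreq μ (A k) ≤ c + (μ : Measure (ℕ → X)) {x | c < upperFreq x (A k)} := by
    calc expUpperFreq μ (A k)
        ≤ ∫⁻ x, (c + {x | c < upperFreq x (A k)}.indicator 1 x) ∂(μ : Measure (ℕ → X)) := by
          refine lintegral_mono fun x => ?_
          by_cases hx : c < upperFreq x (A k)
          · rw [Set.indicator_of_mem (by exact hx)]
            exact (upperFreq_le_one x _).trans le_add_self
          · exact (not_lt.1 hx).trans le_self_add
      _ = _ := by
          rw [lintegral_add_left measurable_const, lintegral_indicator_one hms]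
          simp
  have h2 : c + c ≤ c + (μ : Measure (ℕ → X)) {x | c < upperFreq x (A k)} :=
    hcc.le.trans ((hlim k).le.trans h1)
  exact (ENNReal.add_le_add_iff_left ENNReal.ofReal_ne_top).1 h2

open scoped Classical in
theorem measurable_count {p : (ℕ → X) → ℕ → Prop} (hp : ∀ t, MeasurableSet {x | p x t}) (t : ℕ) :
    Measurable fun x => Nat.count (p x) t := by
  induction t with
  | zero => simp
  | succ t ih =>
    simp only [Nat.count_succ]
    exact ih.add (Measurable.ite (hp t) measurable_const measurable_const)

-- Times and levels are chosen alternately. Given a set `A k` and a starting time, a deterministic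
-- time `b` is found before which the average number of visits to `A k` exceeds `δ` at some late
-- time, with probability above `δ / 2`. Given `b`, a deeper set is avoided up to `b` except with
-- probability `δ / 4`. The target is the difference of the two sets, and success has probability at
-- least `δ / 4`.
open scoped Classical in
theorem nonempty_visitStages {μ : ProbabilityMeasure (ℕ → X)} (hμ : μ ∉ CSProcesses X) :
    Nonempty (VisitStages μ) := by
  obtain ⟨δ, A, hδ, hAm, hA, hAe, hfreq⟩ := exists_lt_expUpperFreq hμ
  obtain ⟨L, hL⟩ := exists_nat_ge (2 / δ)
  set good : ℕ → ℕ → (ℕ → X) → ℕ → Prop := fun k a x T =>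
    a ≤ T ∧ δ * T < Nat.count (fun t => x t ∈ A k) T with hgood
  have hgoodm : ∀ k a T, MeasurableSet {x | good k a x T} := fun k a T => by
    have h : MeasurableSet {x : ℕ → X | δ * T < (Nat.count (fun t => x t ∈ A k) T : ℝ)} := by
      refine measurableSet_lt measurable_const ?_
      exact (measurable_of_countable (fun n : ℕ => (n : ℝ))).comp
        (measurable_count (fun t => (hAm k).preimage (measurable_pi_apply t)) T)
    exact (MeasurableSet.const _).inter h
  set U : ℕ → ℕ → ℕ → Set (ℕ → X) := fun k a b => {x | ∃ T ≤ b, good k a x T} with hU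
  set V : ℕ → ℕ → Set (ℕ → X) := fun k b => {x | ∃ t < b, x t ∈ A k} with hV
  have hUm : ∀ k a b, MeasurableSet (U k a b) := fun k a b => by
    have : U k a b = ⋃ T ∈ Finset.range (b + 1), {x | good k a x T} := by
      ext x; simp [hU]
    rw [this]
    exact Finset.measurableSet_biUnion _ fun T _ => hgoodm k a T
  have hVm : ∀ k b, MeasurableSet (V k b) := fun k b => by
    have : V k b = ⋃ t ∈ Finset.range b, {x | x t ∈ A k} := by
      ext x; simp [hV]
    rw [this]
    exact Finset.measurableSet_biUnion _ fun t _ => (hAm k).preimage (measurable_pi_apply t)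
  have hex1 : ∀ k a, ∃ b, ENNReal.ofReal (δ / 2) < (μ : Measure (ℕ → X)) (U k a b) := by
    intro k a
    have hmono : Monotone (U k a) := fun b b' h x ⟨T, hT, hx⟩ => ⟨T, hT.trans h, hx⟩
    have hsub : {x | ENNReal.ofReal δ < upperFreq x (A k)} ⊆ ⋃ b, U k a b := fun x hx => by
      obtain ⟨T, hT1, hT2⟩ :=
        ((frequently_lt_sum_indicator hx hδ.le).and_eventually (eventually_ge_atTop a)).exists
      rw [sum_indicator_eq_count] at hT1
      exact Set.mem_iUnion.2 ⟨T, T, le_rfl, hT2, hT1⟩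
    have hlt : ENNReal.ofReal (δ / 2) < (μ : Measure (ℕ → X)) (⋃ b, U k a b) :=
      ((ENNReal.ofReal_lt_ofReal_iff hδ).2 (half_lt_self hδ)).trans_le
        ((hfreq k).trans (measure_mono hsub))
    exact ((tendsto_measure_iUnion_atTop hmono).eventually_const_lt hlt).exists
  have hex2 : ∀ k b, ∃ k', k ≤ k' ∧ (μ : Measure (ℕ → X)) (V k' b) < ENNReal.ofReal (δ / 4) := by
    intro k b
    have hanti : Antitone fun k => V k b := fun k k' h x ⟨t, ht, hx⟩ => ⟨t, ht, hA h hx⟩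
    have hemp : ⋂ k, V k b = ∅ := by
      ext x
      simp only [Set.mem_iInter, Set.mem_empty_iff_false, iff_false, not_forall]
      have hk : ∀ t, ∃ k, x t ∉ A k := fun t => by
        by_contra hcon
        push Not at hcon
        have : x t ∈ ⋂ k, A k := Set.mem_iInter.2 hcon
        rw [hAe] at this
        exact this
      choose κ hκ using hk
      refine ⟨(Finset.range b).sup κ, ?_⟩
      rintro ⟨t, ht, hx⟩
      exact hκ t (hA (Finset.le_sup (f := κ) (Finset.mem_range.2 ht)) hx)
    have h := tendsto_measure_iInter_atTop (μ := (μ : Measure (ℕ → X)))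
      (fun k => (hVm k b).nullMeasurableSet) hanti ⟨0, measure_ne_top _ _⟩
    rw [hemp, measure_empty] at h
    obtain ⟨k', h1, h2⟩ := ((h.eventually_lt_const (u := ENNReal.ofReal (δ / 4))
      (by simpa using hδ)).and (eventually_ge_atTop k)).exists
    exact ⟨k', h2, h1⟩
  -- This exceeds `s`, `(s + 1) * s` and `L * s`: a good time lies after the start, is long compared
  -- with it, and the first `s` rounds hold at most a fraction `δ / 2` of the time.
  set a : ℕ → ℕ := fun s => (s + 1 + L) * (s + 1) with ha
  have hnext : ∀ p : ℕ × ℕ, ∃ q : ℕ × ℕ, p.2 ≤ q.2 ∧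
      ENNReal.ofReal (δ / 2) < (μ : Measure (ℕ → X)) (U p.2 (a p.1) q.1) ∧
      (μ : Measure (ℕ → X)) (V q.2 q.1) < ENNReal.ofReal (δ / 4) := by
    intro p
    obtain ⟨b, hb⟩ := hex1 p.2 (a p.1)
    obtain ⟨k', hk, hk'⟩ := hex2 p.2 b
    exact ⟨(b, k'), hk, hb, hk'⟩
  choose next hn1 hn2 hn3 using hnext
  set st : ℕ → ℕ × ℕ := fun i => Nat.rec (0, 0) (fun _ p => next p) i with hst
  have hst' : ∀ i, st (i + 1) = next (st i) := fun i => rfl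
  have hkmono : Monotone fun i => (st i).2 := monotone_nat_of_le_succ fun i => by
    rw [hst']; exact hn1 _
  have hslt : ∀ i, (st i).1 < (st (i + 1)).1 := fun i => by
    have h1 := hn2 (st i)
    rw [← hst'] at h1
    have hne : (U (st i).2 (a (st i).1) (st (i + 1)).1).Nonempty :=
      nonempty_of_measure_ne_zero (ne_bot_of_gt h1)
    obtain ⟨x, T, hT, hT', -⟩ := hne
    have : (st i).1 < a (st i).1 := by simp only [ha]; nlinarith
    omega
  have hsmono : StrictMono fun i => (st i).1 := strictMono_nat_of_lt_succ hslt
  set τ : ℕ → (ℕ → X) → ℕ := fun i x =>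
    Nat.findGreatest (good (st i).2 (a (st i).1) x) (st (i + 1)).1 with hτ
  set E : ℕ → Set (ℕ → X) := fun i =>
    U (st i).2 (a (st i).1) (st (i + 1)).1 \ V (st (i + 1)).2 (st (i + 1)).1 with hE
  have hτgood : ∀ i, ∀ x ∈ E i, good (st i).2 (a (st i).1) x (τ i x) := fun i x hx => by
    obtain ⟨⟨T, hT, hgT⟩, -⟩ := hx
    exact Nat.findGreatest_spec hT hgT
  have haL : ∀ s, s < a s ∧ (s + 1) * s ≤ a s ∧ L * s ≤ a s := fun s => by
    simp only [ha]
    refine ⟨by nlinarith, by nlinarith, by nlinarith⟩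
  have hnotV : ∀ i, ∀ x ∈ E i, ∀ t < (st (i + 1)).1, x t ∉ A (st (i + 1)).2 :=
    fun i x hx t ht h => hx.2 ⟨t, ht, h⟩
  refine ⟨⟨δ / 4, by linarith, fun i => (st i).1, hsmono,
    fun i => A (st i).2 \ A (st (i + 1)).2, fun i => (hAm _).diff (hAm _), ?_, E,
    fun i => (hUm _ _ _).diff (hVm _ _), ?_, τ, ?_, ?_, ?_, ?_, ?_, ?_⟩⟩
  · have hdis : ∀ i j, i < j →
        Disjoint (A (st i).2 \ A (st (i + 1)).2) (A (st j).2 \ A (st (j + 1)).2) := by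
      intro i j hij
      rw [Set.disjoint_left]
      exact fun x hx hx' => hx.2 (hA (hkmono (Nat.succ_le_of_lt hij)) hx'.1)
    intro i j hij
    rcases lt_or_gt_of_ne hij with h | h
    · exact hdis i j h
    · exact (hdis j i h).symm
  · intro i
    have h1 := hn2 (st i)
    have h2 := hn3 (st i)
    rw [← hst'] at h1 h2
    have h3 : (μ : Measure (ℕ → X)) (U (st i).2 (a (st i).1) (st (i + 1)).1) ≤
        (μ : Measure (ℕ → X)) (E i) + ENNReal.ofReal (δ / 4) :=
      (measure_mono (Set.subset_sdiff_union _ (V (st (i + 1)).2 (st (i + 1)).1))).trans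
        ((measure_union_le _ _).trans (add_le_add le_rfl h2.le))
    have h4 : ENNReal.ofReal (δ / 4) + ENNReal.ofReal (δ / 4) ≤
        (μ : Measure (ℕ → X)) (E i) + ENNReal.ofReal (δ / 4) := by
      rw [← ENNReal.ofReal_add (by positivity) (by positivity),
        show δ / 4 + δ / 4 = δ / 2 by ring]
      exact h1.le.trans h3
    exact (ENNReal.add_le_add_iff_right ENNReal.ofReal_ne_top).1 h4
  · exact fun i => measurable_findGreatest fun T _ => hgoodm _ _ T
  · exact fun i x hx => (haL _).1.trans_le (hτgood i x hx).1
  · exact fun i x _ => Nat.findGreatest_le _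
  · intro i x hx
    have hi : i ≤ (st i).1 := hsmono.le_apply
    calc (i + 1) * (st i).1 ≤ ((st i).1 + 1) * (st i).1 := by gcongr
      _ ≤ _ := (haL _).2.1.trans (hτgood i x hx).1
  · intro i x hx t ht j hij h
    exact hnotV i x hx t ht (hA (hkmono (Nat.succ_le_of_lt hij)) h.1)
  · intro i x hx
    obtain ⟨h1, h2⟩ := hτgood i x hx
    have hle : τ i x ≤ (st (i + 1)).1 := Nat.findGreatest_le _
    have h4 : (L : ℝ) * (st i).1 ≤ τ i x := by exact_mod_cast (haL _).2.2.trans h1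
    have h5 : 2 / δ * (st i).1 ≤ τ i x :=
      (mul_le_mul_of_nonneg_right hL (Nat.cast_nonneg _)).trans h4
    have h6 : 2 * ((st i).1 : ℝ) ≤ δ * τ i x := by
      have := mul_le_mul_of_nonneg_left h5 hδ.le
      rwa [← mul_assoc, mul_div_cancel₀ _ hδ.ne'] at this
    have h7 : (0 : ℝ) ≤ δ * τ i x := by positivity
    have key : ∀ n : ℕ, Nat.count (fun t => x t ∈ A (st i).2) (τ i x) ≤ (st i).1 + n →
        δ / 4 * τ i x ≤ n := fun n hn => by
      have : (Nat.count (fun t => x t ∈ A (st i).2) (τ i x) : ℝ) ≤ (st i).1 + n := by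
        exact_mod_cast hn
      linarith
    refine key _ (le_of_le_of_eq (count_le_add_count
      (q := fun t => (st i).1 ≤ t ∧ x t ∈ A (st i).2 \ A (st (i + 1)).2) (s := (st i).1)
      fun t ht hs hxt => ⟨hs, hxt, hnotV i x hx t (ht.trans_le hle)⟩) ?_)
    congr

end VisitStages

/-! ### Indexing rounds by the number of visits -/

section VisitTime

open scoped Classical in
/-- The time of visit number `k`, among the times `t ≤ m` at which `p` holds. -/
def visitTime (p : ℕ → Prop) (m k : ℕ) : ℕ :=
  Nat.findGreatest (fun t => p t ∧ Nat.count p t = k) m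

open scoped Classical in
theorem visitTime_count {p : ℕ → Prop} {m t : ℕ} (hp : p t) (ht : t ≤ m) :
    visitTime p m (Nat.count p t) = t := by
  have h := Nat.findGreatest_spec (P := fun s => p s ∧ Nat.count p s = Nat.count p t) ht ⟨hp, rfl⟩
  exact Nat.count_injective h.1 hp h.2

-- Also true when visit `k` does not exist: the default time `0` has nothing before it. This gives
-- causality of the predictors indexed by visits.
open scoped Classical in
theorem count_lt_of_lt_visitTime {p : ℕ → Prop} {m k s : ℕ} (hs : s < visitTime p m k)
    (hp : p s) : Nat.count p s < k := by
  have h := Nat.findGreatest_of_ne_zero (P := fun t => p t ∧ Nat.count p t = k) (n := m) rfl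
    (Nat.ne_zero_of_lt hs)
  exact (Nat.count_strict_mono hp hs).trans_eq h.2

open scoped Classical in
theorem sum_visitTime (p : ℕ → Prop) (m : ℕ) (F : ℕ → ℕ → ℝ) {T : ℕ} (hT : T ≤ m + 1) :
    ∑ k ∈ Finset.range (Nat.count p T), F k (visitTime p m k) =
      ∑ t ∈ Finset.range T, if p t then F (Nat.count p t) t else 0 := by
  induction T with
  | zero => simp
  | succ T ih =>
    rw [Finset.sum_range_succ, ← ih (by omega), Nat.count_succ]
    split_ifs with h
    · rw [Finset.sum_range_succ, visitTime_count h (by omega)]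
    · simp

open scoped Classical in
theorem measurable_visitTime {X : Type*} [MeasurableSpace X] {p : (ℕ → X) → ℕ → Prop}
    (hp : ∀ t, MeasurableSet {x | p x t}) (m k : ℕ) :
    Measurable fun x => visitTime (p x) m k :=
  measurable_findGreatest fun t _ =>
    (hp t).inter ((measurable_count hp t) (measurableSet_singleton k))

theorem Measurable.apply_nat {Ω β : Type*} [MeasurableSpace Ω] [MeasurableSpace β] {g : ℕ → Ω → β}
    {N : Ω → ℕ} (hg : ∀ n, Measurable (g n)) (hN : Measurable N) :
    Measurable fun ω => g (N ω) ω :=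
  (measurable_from_prod_countable_right (f := fun q : ℕ × Ω => g q.1 q.2) hg).comp
    (hN.prodMk measurable_id)

/-- Recursive choice: coordinate `i` is selected after the earlier ones, and later updates leave `P
i` intact because it only reads the coordinates up to `i`. -/
theorem exists_forall_of_update {β : Type*} [Nonempty β] {P : ℕ → (ℕ → β) → Prop}
    (h : ∀ i d, ∃ v, P i (Function.update d i v))
    (hc : ∀ i d d', (∀ j ≤ i, d j = d' j) → P i d → P i d') : ∃ d, ∀ i, P i d := by
  choose v hv using h
  obtain ⟨b⟩ := ‹Nonempty β›
  let D : ℕ → ℕ → β := fun n => Nat.rec (fun _ => b) (fun n d => Function.update d n (v n d)) n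
  have hD : ∀ n, D (n + 1) = Function.update (D n) n (v n (D n)) := fun n => rfl
  have hst : ∀ j n, D (j + 1 + n) j = D (j + 1) j := fun j n => by
    induction n with
    | zero => rfl
    | succ n ih => rw [← add_assoc, hD, Function.update_of_ne (by omega), ih]
  refine ⟨fun j => D (j + 1) j, fun i => hc i (D (i + 1)) _ (fun j hj => ?_) ?_⟩
  · obtain ⟨n, rfl⟩ := Nat.exists_eq_add_of_le hj
    rw [show j + n + 1 = j + 1 + n by ring]
    exact hst j n
  · rw [hD]
    exact hv i _

end VisitTime

/-! ### The responses prescribed by the data of the stages -/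

section Response

open scoped Classical

variable {X Y : Type u} [MeasurableSpace X] {μ : ProbabilityMeasure (ℕ → X)}

/-- The instance sequence `x` is in the target of stage `i` at time `t`. -/
def VisitStages.Visit (V : VisitStages μ) (i : ℕ) (x : ℕ → X) (t : ℕ) : Prop :=
  V.start i ≤ t ∧ x t ∈ V.target i

/-- The number of visits of a stage. -/
def VisitStages.visits (V : VisitStages μ) (i : ℕ) (x : ℕ → X) : ℕ :=
  Nat.count (V.Visit i x) (V.finish i x)

/-- The response of stage `i` at a visit at time `t`, given a value and, for each number of visits,
a sequence of values. -/
def VisitStages.stageValue (V : VisitStages μ) (i : ℕ) (v : Y × (ℕ → ℕ → Y)) (x : ℕ → X)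
    (t : ℕ) : Y :=
  -- After the stage, or if it fails, the response is the comparison value `v.1`, so the comparison
  -- function incurs no loss at such visits.
  if x ∈ V.success i ∧ t < V.finish i x then v.2 (V.visits i x) (Nat.count (V.Visit i x) t) else v.1

/-- The last stage the target of which is visited at time `t`. -/
def VisitStages.stageAt (V : VisitStages μ) (x : ℕ → X) (t : ℕ) : ℕ :=
  Nat.findGreatest (fun j => V.Visit j x t) t

/-- The responses determined by the instances and the data of the stages. -/
def VisitStages.response (V : VisitStages μ) (y : Y) (d : ℕ → Y × (ℕ → ℕ → Y)) (x : ℕ → X)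
    (t : ℕ) : Y :=
  if V.Visit (V.stageAt x t) x t then V.stageValue (V.stageAt x t) (d (V.stageAt x t)) x t else y

variable {V : VisitStages μ}

theorem VisitStages.Visit.unique {i j : ℕ} {x : ℕ → X} {t : ℕ} (hi : V.Visit i x t)
    (hj : V.Visit j x t) : i = j := by
  by_contra h
  exact Set.disjoint_left.1 (V.disjoint_target h) hi.2 hj.2

theorem VisitStages.Visit.stageAt_eq {i : ℕ} {x : ℕ → X} {t : ℕ} (hi : V.Visit i x t) :
    V.stageAt x t = i :=
  VisitStages.Visit.unique (Nat.findGreatest_spec (P := fun j => V.Visit j x t)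
    (V.strictMono_start.le_apply.trans hi.1) hi) hi

theorem VisitStages.response_of_visit {y : Y} {d : ℕ → Y × (ℕ → ℕ → Y)} {i : ℕ} {x : ℕ → X} {t : ℕ}
    (hi : V.Visit i x t) : V.response y d x t = V.stageValue i (d i) x t := by
  unfold VisitStages.response
  rw [hi.stageAt_eq, if_pos hi]

theorem VisitStages.response_of_forall_not {y : Y} {d : ℕ → Y × (ℕ → ℕ → Y)} {x : ℕ → X} {t : ℕ}
    (h : ∀ i, ¬ V.Visit i x t) : V.response y d x t = y :=
  if_neg (h _)

theorem VisitStages.response_congr {y : Y} {d d' : ℕ → Y × (ℕ → ℕ → Y)} {x : ℕ → X} {t : ℕ}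
    (h : ∀ i, V.Visit i x t → V.stageValue i (d i) x t = V.stageValue i (d' i) x t) :
    V.response y d x t = V.response y d' x t := by
  unfold VisitStages.response
  split_ifs with hv
  · exact h _ hv
  · rfl

theorem VisitStages.response_congr_of_success {y : Y} {d d' : ℕ → Y × (ℕ → ℕ → Y)} {i : ℕ}
    {x : ℕ → X} {t : ℕ} (hx : x ∈ V.success i) (ht : t < V.start (i + 1))
    (h : ∀ j ≤ i, d j = d' j) : V.response y d x t = V.response y d' x t := by
  refine VisitStages.response_congr fun j hj => ?_
  rw [h j (not_lt.1 fun hij => V.notMem_target i x hx t ht j hij hj.2)]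

theorem VisitStages.response_mem {y : Y} {d : ℕ → Y × (ℕ → ℕ → Y)} {K : Set Y} (hy : y ∈ K)
    (hd : ∀ i, (d i).1 ∈ K) (hd' : ∀ i n k, (d i).2 n k ∈ K) (x : ℕ → X) (t : ℕ) :
    V.response y d x t ∈ K := by
  unfold VisitStages.response VisitStages.stageValue
  split_ifs
  exacts [hd' _ _ _, hd _, hy]

theorem VisitStages.measurableSet_visit (V : VisitStages μ) (i t : ℕ) :
    MeasurableSet {x | V.Visit i x t} :=
  (MeasurableSet.const _).inter ((V.measurableSet_target i).preimage (measurable_pi_apply t))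

theorem VisitStages.measurable_visits (V : VisitStages μ) (i : ℕ) : Measurable (V.visits i) :=
  Measurable.apply_nat (g := fun n x => Nat.count (V.Visit i x) n)
    (measurable_count (V.measurableSet_visit i)) (V.measurable_finish i)

theorem VisitStages.measurable_response [MeasurableSpace Y] (V : VisitStages μ) (y : Y) (t : ℕ) :
    Measurable fun q : (ℕ → Y × (ℕ → ℕ → Y)) × (ℕ → X) => V.response y q.1 q.2 t := by
  have hval : ∀ i, Measurable fun q : (ℕ → Y × (ℕ → ℕ → Y)) × (ℕ → X) =>
      V.stageValue i (q.1 i) q.2 t := fun i => by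
    unfold VisitStages.stageValue
    refine Measurable.ite ?_ ?_ (by fun_prop)
    · exact measurable_snd ((V.measurableSet_success i).inter
        (measurableSet_lt measurable_const (V.measurable_finish i)))
    · refine Measurable.apply_nat (g := fun n (q : (ℕ → Y × (ℕ → ℕ → Y)) × (ℕ → X)) =>
        (q.1 i).2 n (Nat.count (V.Visit i q.2) t)) (fun n => ?_)
        ((V.measurable_visits i).comp measurable_snd)
      exact Measurable.apply_nat (g := fun k (q : (ℕ → Y × (ℕ → ℕ → Y)) × (ℕ → X)) =>
        (q.1 i).2 n k) (fun k => by fun_prop)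
        ((measurable_count (V.measurableSet_visit i) t).comp measurable_snd)
  have hst : Measurable fun q : (ℕ → Y × (ℕ → ℕ → Y)) × (ℕ → X) => V.stageAt q.2 t :=
    (measurable_findGreatest fun j _ => V.measurableSet_visit j t).comp measurable_snd
  refine Measurable.apply_nat (g := fun i (q : (ℕ → Y × (ℕ → ℕ → Y)) × (ℕ → X)) =>
    if V.Visit i q.2 t then V.stageValue i (q.1 i) q.2 t else y) (fun i => ?_) hst
  exact Measurable.ite (measurable_snd (V.measurableSet_visit i t)) (hval i) measurable_const

theorem VisitStages.frac_mul_finish_le_visits (V : VisitStages μ) {i : ℕ} {x : ℕ → X}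
    (hx : x ∈ V.success i) : V.frac * V.finish i x ≤ V.visits i x := by
  refine (V.frac_mul_finish_le i x hx).trans_eq ?_
  unfold VisitStages.visits VisitStages.Visit
  congr

theorem VisitStages.visits_mem (V : VisitStages μ) {i : ℕ} {x : ℕ → X} (hx : x ∈ V.success i) :
    V.visits i x ∈ Finset.Icc 1 (V.start (i + 1)) := by
  rw [Finset.mem_Icc]
  refine ⟨?_, (Nat.count_le _).trans (V.finish_le_start i x hx)⟩
  have h1 : 0 < V.finish i x := (Nat.zero_le _).trans_lt (V.start_lt_finish i x hx)
  have h2 : (0 : ℝ) < V.visits i x :=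
    (mul_pos V.frac_pos (Nat.cast_pos.2 h1)).trans_le (V.frac_mul_finish_le_visits hx)
  exact_mod_cast h2

end Response

/-! ### Clipping predictions to a neighbourhood of the ball -/

section Clip

open scoped Classical in
/-- The points at distance more than `2 * R` from `y` are moved to `y`. -/
def clip {Y : Type*} [MetricSpace Y] (y : Y) (R : ℝ) (w : Y) : Y :=
  if dist w y ≤ 2 * R then w else y

variable {Y : Type u} [MetricSpace Y] {y w s : Y} {R α : ℝ}

/-- A point farther than `2 * R` from `y` is farther than `R` from `s`, whereas `y` is within `R` of
`s`. -/
theorem powLoss_clip_le (hα : 1 ≤ α) (hs : dist y s ≤ R) :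
    powLoss α (clip y R w) s ≤ powLoss α w s := by
  unfold clip
  split_ifs with h
  · rfl
  · unfold powLoss
    refine Real.rpow_le_rpow dist_nonneg ?_ (by linarith)
    have := dist_triangle_right w y s
    linarith

theorem powLoss_clip_le_bound (hα : 1 ≤ α) (hR : 0 ≤ R) (hs : dist y s ≤ R) :
    powLoss α (clip y R w) s ≤ (3 * R) ^ α := by
  unfold clip powLoss
  refine Real.rpow_le_rpow dist_nonneg ?_ (by linarith)
  split_ifs with h
  · have := dist_triangle w y s
    linarith
  · linarith

theorem powLoss_le_bound (hα : 1 ≤ α) (hR : 0 ≤ R) (hw : dist y w ≤ R) (hs : dist y s ≤ R) :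
    powLoss α w s ≤ (3 * R) ^ α := by
  unfold powLoss
  refine Real.rpow_le_rpow dist_nonneg ?_ (by linarith)
  have := dist_triangle_left w s y
  linarith

theorem measurable_clip [MeasurableSpace Y] [SecondCountableTopology Y]
    [OpensMeasurableSpace Y] (y : Y) (R : ℝ) :
    Measurable (clip y R) :=
  Measurable.ite (measurableSet_le (measurable_id.dist measurable_const) measurable_const)
    measurable_id measurable_const

end Clip

/-! ### The adversarial process attached to the data of the stages -/

section StagePath

open scoped Classical

variable {X Y : Type u} [MeasurableSpace X] [MeasurableSpace Y] {μ : ProbabilityMeasure (ℕ → X)}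
  {f : LearningRule X Y} {V : VisitStages μ}

/-- The law of the seeds. -/
def LearningRule.seedMeasure (f : LearningRule X Y) : Measure (ℕ → f.Seed) :=
  Measure.infinitePi fun t => (f.law t : Measure f.Seed)

instance (f : LearningRule X Y) : IsProbabilityMeasure f.seedMeasure := by
  unfold LearningRule.seedMeasure
  infer_instance

/-- The path with given instances and seeds, and the responses determined by the data `d`. -/
def VisitStages.path (V : VisitStages μ) (f : LearningRule X Y) (y : Y) (d : ℕ → Y × (ℕ → ℕ → Y))
    (q : (ℕ → X) × (ℕ → f.Seed)) : f.Path :=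
  (q.1, V.response y d q.1, q.2)

theorem VisitStages.measurable_path (V : VisitStages μ) (f : LearningRule X Y) (y : Y)
    {Z : Type*} [MeasurableSpace Z] {D : Z → ℕ → Y × (ℕ → ℕ → Y)} (hD : Measurable D)
    {Q : Z → (ℕ → X) × (ℕ → f.Seed)} (hQ : Measurable Q) :
    Measurable fun z => V.path f y (D z) (Q z) := by
  refine (measurable_fst.comp hQ).prodMk (Measurable.prodMk ?_ (measurable_snd.comp hQ))
  exact measurable_pi_iff.2 fun t =>
    (V.measurable_response y t).comp (hD.prodMk (measurable_fst.comp hQ))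

/-- The responses are functions of the instances, so the history of round `t` is a function of the
instances and the earlier seeds. The seed of round `t` is independent of these by the product
structure. -/
theorem VisitStages.isAdversarialProcess_path (V : VisitStages μ) (f : LearningRule X Y) (y : Y)
    (d : ℕ → Y × (ℕ → ℕ → Y)) {P : ProbabilityMeasure f.Path}
    (hP : (P : Measure f.Path) =
      ((μ : Measure (ℕ → X)).prod f.seedMeasure).map (V.path f y d)) :
    IsAdversarialProcess f μ P := by
  have hpath : Measurable (V.path f y d) := V.measurable_path f y measurable_const measurable_id
  refine ⟨?_, fun t => ?_, fun t => ?_⟩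
  · rw [hP, Measure.map_map measurable_fst hpath]
    exact Measure.map_fst_prod.trans (by simp)
  · rw [hP, Measure.map_map (by fun_prop) hpath]
    have h : (fun ω : f.Path => ω.2.2 t) ∘ V.path f y d = (fun r => r t) ∘ Prod.snd := rfl
    rw [h, ← Measure.map_map (by fun_prop) measurable_snd, Measure.map_snd_prod, measure_univ,
      one_smul]
    exact Measure.infinitePi_map_eval (fun t => (f.law t : Measure f.Seed)) t
  · have hi : IndepFun (fun r : ℕ → f.Seed => r t) (fun r (s : Fin t) => r s) f.seedMeasure := by
      have h := (iIndepFun_infinitePi (P := fun t => (f.law t : Measure f.Seed))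
        (X := fun _ r => r) fun _ => measurable_id).indepFun_finset {t} (Finset.range t)
        (by simp) fun _ => by fun_prop
      exact h.comp (φ := fun a : ({t} : Finset ℕ) → f.Seed => a ⟨t, Finset.mem_singleton_self t⟩)
        (ψ := fun (a : Finset.range t → f.Seed) (s : Fin t) => a ⟨s, Finset.mem_range.2 s.2⟩) (measurable_pi_apply _)
        (measurable_pi_iff.2 fun _ => measurable_pi_apply _)
    have hi' : IndepFun (fun q : (ℕ → X) × (ℕ → f.Seed) => q.2 t)
        (fun q : (ℕ → X) × (ℕ → f.Seed) => (q.1, fun s : Fin t => q.2 s))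
        ((μ : Measure (ℕ → X)).prod f.seedMeasure) := by
      rw [indepFun_iff_measure_inter_preimage_eq_mul] at hi ⊢
      intro A B hA hB
      have hA' : MeasurableSet ((fun q : (ℕ → X) × (ℕ → f.Seed) => q.2 t) ⁻¹' A) :=
        (by fun_prop : Measurable fun q : (ℕ → X) × (ℕ → f.Seed) => q.2 t) hA
      have hB' : MeasurableSet ((fun q : (ℕ → X) × (ℕ → f.Seed) =>
          (q.1, fun s : Fin t => q.2 s)) ⁻¹' B) :=
        (by fun_prop : Measurable fun q : (ℕ → X) × (ℕ → f.Seed) =>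
          (q.1, fun s : Fin t => q.2 s)) hB
      rw [Measure.prod_apply (hA'.inter hB'), Measure.prod_apply hA', Measure.prod_apply hB']
      have h1 : ∀ x : ℕ → X, f.seedMeasure (Prod.mk x ⁻¹'
          ((fun q : (ℕ → X) × (ℕ → f.Seed) => q.2 t) ⁻¹' A ∩
            (fun q : (ℕ → X) × (ℕ → f.Seed) => (q.1, fun s : Fin t => q.2 s)) ⁻¹' B)) =
          f.seedMeasure ((fun r : ℕ → f.Seed => r t) ⁻¹' A) * f.seedMeasure (Prod.mk x ⁻¹'
            ((fun q : (ℕ → X) × (ℕ → f.Seed) => (q.1, fun s : Fin t => q.2 s)) ⁻¹' B)) :=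
        fun x => hi A (Prod.mk x ⁻¹' B) hA (measurable_prodMk_left hB)
      simp only [h1]
      rw [lintegral_const_mul _ (measurable_measure_prodMk_left hB')]
      congr 1
      have h2 : ∀ x : ℕ → X, f.seedMeasure (Prod.mk x ⁻¹'
          ((fun q : (ℕ → X) × (ℕ → f.Seed) => q.2 t) ⁻¹' A)) =
          f.seedMeasure ((fun r : ℕ → f.Seed => r t) ⁻¹' A) := fun x => rfl
      simp [h2]
    rw [indepFun_iff_measure_inter_preimage_eq_mul] at hi' ⊢
    intro A B hA hB
    have hmA : Measurable fun ω : f.Path => ω.2.2 t := by fun_prop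
    have hmB := f.measurable_history t
    change (P : Measure f.Path) (_ ∩ f.history t ⁻¹' B) = _ * (P : Measure f.Path) (f.history t ⁻¹' B)
    rw [hP, Measure.map_apply hpath ((hmA hA).inter (hmB hB)), Measure.map_apply hpath (hmA hA),
      Measure.map_apply hpath (hmB hB)]
    have hresp : Measurable fun x : ℕ → X => fun s : Fin (t + 1) => V.response y d x s :=
      measurable_pi_iff.2 fun s => (V.measurable_response y s).comp
        (measurable_const.prodMk measurable_id)
    exact hi' A ((fun p : (ℕ → X) × (Fin t → f.Seed) =>
      ((p.1, (fun s : Fin (t + 1) => V.response y d p.1 s), p.2) : f.History t)) ⁻¹' B) hA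
      ((measurable_fst.prodMk ((hresp.comp measurable_fst).prodMk measurable_snd)) hB)

end StagePath

/-! ### Expected excess loss of the learner during a stage -/

section StageExcess

open scoped Classical

variable {X Y : Type u} [MeasurableSpace X] [MeasurableSpace Y] [MetricSpace Y]
  {μ : ProbabilityMeasure (ℕ → X)} {f : LearningRule X Y} {V : VisitStages μ} {α R : ℝ} {y : Y}

/-- The average excess loss of the clipped predictions during the visits of stage `i`. -/
def VisitStages.stageExcess (V : VisitStages μ) (f : LearningRule X Y) (α R : ℝ) (y : Y) (i : ℕ)
    (d : ℕ → Y × (ℕ → ℕ → Y)) (q : (ℕ → X) × (ℕ → f.Seed)) : ℝ :=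
  (∑ t ∈ Finset.range (V.finish i q.1), if V.Visit i q.1 t then
    powLoss α (clip y R (f.prediction (V.path f y d q) t)) (V.response y d q.1 t) -
      powLoss α (d i).1 (V.response y d q.1 t) else 0) / V.visits i q.1

theorem VisitStages.measurable_stageExcess [SecondCountableTopology Y] [BorelSpace Y]
    (V : VisitStages μ) (f : LearningRule X Y) (α R : ℝ) (y : Y) (i : ℕ)
    (d : ℕ → Y × (ℕ → ℕ → Y)) : Measurable (V.stageExcess f α R y i d) := by
  have hpath : Measurable (V.path f y d) := V.measurable_path f y measurable_const measurable_id
  have hresp : ∀ t, Measurable fun q : (ℕ → X) × (ℕ → f.Seed) => V.response y d q.1 t := fun t =>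
    (V.measurable_response y t).comp (measurable_const.prodMk measurable_fst)
  refine Measurable.div ?_ ((measurable_of_countable (fun n : ℕ => (n : ℝ))).comp
    ((V.measurable_visits i).comp measurable_fst))
  refine Measurable.apply_nat (g := fun n (q : (ℕ → X) × (ℕ → f.Seed)) =>
    ∑ t ∈ Finset.range n, if V.Visit i q.1 t then
    powLoss α (clip y R (f.prediction (V.path f y d q) t)) (V.response y d q.1 t) -
      powLoss α (d i).1 (V.response y d q.1 t) else 0) (fun n => ?_)
    ((V.measurable_finish i).comp measurable_fst)
  refine Finset.measurable_sum _ fun t _ => Measurable.ite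
    (measurable_fst (V.measurableSet_visit i t)) (Measurable.sub ?_ ?_) measurable_const
  · exact Measurable.powLoss ((measurable_clip y R).comp ((f.measurable_prediction t).comp hpath))
      (hresp t)
  · exact Measurable.powLoss measurable_const (hresp t)

theorem VisitStages.abs_stageExcess_le (hα : 1 ≤ α) (hR : 0 ≤ R) {d : ℕ → Y × (ℕ → ℕ → Y)}
    (hd : ∀ i, dist y (d i).1 ≤ R) (hd' : ∀ i n k, dist y ((d i).2 n k) ≤ R) (i : ℕ)
    (q : (ℕ → X) × (ℕ → f.Seed)) : |V.stageExcess f α R y i d q| ≤ (3 * R) ^ α := by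
  have hB : 0 ≤ (3 * R) ^ α := by positivity
  have hresp : ∀ t, dist y (V.response y d q.1 t) ≤ R :=
    VisitStages.response_mem (K := {s | dist y s ≤ R}) (by simpa using hR) hd hd' q.1
  unfold VisitStages.stageExcess
  rw [abs_div, Nat.abs_cast]
  refine div_le_of_le_mul₀ (Nat.cast_nonneg _) hB ?_
  have h := sum_visitTime (V.Visit i q.1) (V.finish i q.1) (fun _ _ => (3 * R) ^ α) (Nat.le_succ _)
  rw [Finset.sum_const, Finset.card_range, nsmul_eq_mul] at h
  refine (Finset.abs_sum_le_sum_abs _ _).trans ?_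
  rw [mul_comm]
  refine (Finset.sum_le_sum fun t _ => ?_).trans_eq h.symm
  split_ifs
  · exact abs_sub_le_of_nonneg_of_le (powLoss_nonneg _ _)
      (powLoss_clip_le_bound hα hR (hresp t)) (powLoss_nonneg _ _)
      (powLoss_le_bound hα hR (hd i) (hresp t))
  · simp

theorem VisitStages.stageExcess_congr {d d' : ℕ → Y × (ℕ → ℕ → Y)} {i : ℕ}
    (h : ∀ j ≤ i, d j = d' j) {q : (ℕ → X) × (ℕ → f.Seed)} (hq : q.1 ∈ V.success i) :
    V.stageExcess f α R y i d q = V.stageExcess f α R y i d' q := by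
  have hresp : ∀ t < V.finish i q.1, V.response y d q.1 t = V.response y d' q.1 t := fun t ht =>
    VisitStages.response_congr_of_success hq (ht.trans_le (V.finish_le_start i _ hq)) h
  unfold VisitStages.stageExcess
  congr 1
  refine Finset.sum_congr rfl fun t ht => ?_
  rw [Finset.mem_range] at ht
  rw [hresp t ht, h i le_rfl, f.prediction_congr (ω := V.path f y d q) (ω' := V.path f y d' q)
    rfl (fun s hs => hresp s (hs.trans ht)) rfl]

/-- The data of a stage can be chosen so that the clipped predictions do badly during the stage. -/
theorem VisitStages.exists_stage_data [SecondCountableTopology Y] [BorelSpace Y] [Nonempty Y]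
    (hα : 1 ≤ α) {S : Set Y} (hR : 0 ≤ R) (hSR : ∀ s ∈ S, dist y s ≤ R) (hS : ¬ FTiMEOn α S) :
    ∃ η : ℝ, 0 < η ∧ ∀ {μ : ProbabilityMeasure (ℕ → X)} (V : VisitStages μ) (f : LearningRule X Y)
      (i : ℕ) (d : ℕ → Y × (ℕ → ℕ → Y)), ∃ v : Y × (ℕ → ℕ → Y), v.1 ∈ S ∧ (∀ n k, v.2 n k ∈ S) ∧
        V.frac * η ≤ ∫ q in V.success i ×ˢ Set.univ,
          V.stageExcess f α R y i (Function.update d i v) q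
            ∂((μ : Measure (ℕ → X)).prod f.seedMeasure) := by
  obtain ⟨η, hη, hard⟩ := exists_hard_sequences hS
  refine ⟨η, hη, fun {μ} V f i d => ?_⟩
  set M : Measure ((ℕ → X) × (ℕ → f.Seed)) := (μ : Measure (ℕ → X)).prod f.seedMeasure with hM
  set E : Set ((ℕ → X) × (ℕ → f.Seed)) := V.success i ×ˢ Set.univ with hE
  have hEm : MeasurableSet E := (V.measurableSet_success i).prod MeasurableSet.univ
  have hME : ENNReal.ofReal V.frac ≤ M E := by
    rw [hM, hE, Measure.prod_prod, measure_univ, mul_one]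
    exact V.le_measure_success i
  have hME0 : M E ≠ 0 := ((ENNReal.ofReal_pos.2 V.frac_pos).trans_le hME).ne'
  have : IsProbabilityMeasure (cond M E) := cond_isProbabilityMeasure hME0
  -- The value `1` off success only keeps `N` in the admissible range; the measure is conditioned on
  -- success.
  set N : (ℕ → X) × (ℕ → f.Seed) → ℕ := fun q => if q.1 ∈ V.success i then V.visits i q.1 else 1
    with hN
  -- The predictor must be defined on a single sequence `z`, so stage `i` uses `z` for every number
  -- of visits; the sequence for the actual number is substituted afterwards. The first component
  -- `y` is not read during a successful stage.
  set D : (ℕ → Y) → ℕ → Y × (ℕ → ℕ → Y) := fun z => Function.update d i (y, fun _ => z) with hD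
  set h : ℕ → (ℕ → X) × (ℕ → f.Seed) → (ℕ → Y) → Y := fun k q z =>
    clip y R (f.prediction (V.path f y (D z) q)
      (visitTime (V.Visit i q.1) (V.start (i + 1)) k)) with hh
  have hDm : Measurable D := measurable_pi_iff.2 fun j => by
    by_cases hj : j = i
    · subst hj
      simp only [hD, Function.update_self]
      fun_prop
    · simp only [hD, Function.update_of_ne hj]
      fun_prop
  obtain ⟨c, hc, z, hz, hint⟩ := hard _ (cond M E) N (V.start (i + 1)) h ((3 * R) ^ α)
    (Measurable.ite (measurable_fst (V.measurableSet_success i))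
      ((V.measurable_visits i).comp measurable_fst) measurable_const)
    (fun q => by
      simp only [hN]
      split_ifs with hq
      · exact V.visits_mem hq
      · exact Finset.mem_Icc.2 ⟨le_rfl, (Nat.zero_le _).trans_lt (V.strictMono_start (Nat.lt_succ_self i))⟩)
    (fun k => by
      refine (measurable_clip y R).comp (Measurable.apply_nat
        (g := fun t (p : ((ℕ → X) × (ℕ → f.Seed)) × (ℕ → Y)) =>
          f.prediction (V.path f y (D p.2) p.1) t) (fun t => ?_) ?_)
      · exact (f.measurable_prediction t).comp
          (V.measurable_path f y (hDm.comp measurable_snd) measurable_fst)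
      · exact (measurable_visitTime (V.measurableSet_visit i) _ k).comp
          (measurable_fst.comp measurable_fst))
    (fun k q z z' hzz => by
      simp only [hh]
      rw [f.prediction_congr (ω := V.path f y (D z) q) (ω' := V.path f y (D z') q) rfl
        (fun s hs => ?_) rfl]
      refine VisitStages.response_congr fun j hj => ?_
      by_cases hji : j = i
      · subst hji
        simp only [hD, Function.update_self, VisitStages.stageValue]
        rw [hzz _ (count_lt_of_lt_visitTime hs hj)]
      · simp only [hD, Function.update_of_ne hji])
    (fun k q z s hs => powLoss_clip_le_bound hα hR (hSR s hs))
  refine ⟨(c, z), hc, hz, ?_⟩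
  rw [show cond M E = (M E)⁻¹ • M.restrict E from rfl, integral_smul_measure, smul_eq_mul,
    ENNReal.toReal_inv] at hint
  have hpos : 0 < (M E).toReal := ENNReal.toReal_pos hME0 (measure_ne_top _ _)
  have hfr : V.frac ≤ (M E).toReal :=
    (ENNReal.ofReal_le_iff_le_toReal (measure_ne_top _ _)).1 hME
  rw [inv_mul_eq_div, le_div_iff₀ hpos] at hint
  refine (mul_le_mul_of_nonneg_right hfr hη.le).trans ?_
  rw [mul_comm]
  refine hint.trans_eq (setIntegral_congr_fun hEm fun q hq => ?_)
  have hqs : q.1 ∈ V.success i := hq.1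
  have hNq : N q = V.visits i q.1 := if_pos hqs
  have hresp : ∀ s < V.finish i q.1,
      V.response y (D (z (V.visits i q.1))) q.1 s =
        V.response y (Function.update d i (c, z)) q.1 s := fun s hs => by
    refine VisitStages.response_congr fun j hj => ?_
    by_cases hji : j = i
    · subst hji
      simp only [hD, Function.update_self, VisitStages.stageValue, hqs, hs, and_self, if_true]
    · simp only [hD, Function.update_of_ne hji]
  simp only [VisitStages.stageExcess, hNq]
  congr 1
  refine (sum_visitTime (V.Visit i q.1) (V.start (i + 1)) (fun k t =>
      powLoss α (clip y R (f.prediction (V.path f y (D (z (V.visits i q.1))) q) t))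
        (z (V.visits i q.1) k) - powLoss α c (z (V.visits i q.1) k))
    ((V.finish_le_start i _ hqs).trans (Nat.le_succ _))).trans ?_
  refine Finset.sum_congr rfl fun t ht => ?_
  rw [Finset.mem_range] at ht
  split_ifs with hv
  · have hr : V.response y (Function.update d i (c, z)) q.1 t =
        z (V.visits i q.1) (Nat.count (V.Visit i q.1) t) := by
      rw [VisitStages.response_of_visit hv, Function.update_self, VisitStages.stageValue,
        if_pos ⟨hqs, ht⟩]
    rw [hr, Function.update_self, f.prediction_congr
      (ω := V.path f y (D (z (V.visits i q.1))) q)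
      (ω' := V.path f y (Function.update d i (c, z)) q) rfl
      (fun s hs => hresp s (hs.trans ht)) rfl]
  · rfl

end StageExcess

/-! ### Universal consistency forces `CS` -/

section Necessity

open scoped Classical

variable {X Y : Type u} [MeasurableSpace X] [MetricSpace Y]
  {μ : ProbabilityMeasure (ℕ → X)} {V : VisitStages μ} {α R : ℝ} {y : Y}

theorem exists_dist_le_of_mem_lossBall (hα : 1 ≤ α) (y : Y) (r : ℝ) :
    ∃ R : ℝ, 0 ≤ R ∧ ∀ s ∈ lossBall α y r, dist y s ≤ R := by
  refine ⟨(max r 0) ^ α⁻¹, by positivity, fun s hs => ?_⟩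
  have hs' : dist y s ^ α < r := hs
  rw [← Real.rpow_rpow_inv dist_nonneg (by linarith : α ≠ 0)]
  exact Real.rpow_le_rpow (by positivity) (hs'.le.trans (le_max_left _ _)) (by positivity)

theorem empiricallyIntegrable_of_forall_le {Ω : Type u} [MeasurableSpace Ω]
    {P : ProbabilityMeasure Ω} {Z : Ω → ℕ → Y} {B : ℝ} (hB : 0 ≤ B)
    (h : ∀ᵐ ω ∂(P : Measure Ω), ∀ t, powLoss α y (Z ω t) ≤ B) : EmpiricallyIntegrable α P Z := by
  refine ⟨y, fun ε hε => ?_⟩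
  filter_upwards [h] with ω hω
  refine ⟨B + 1, by linarith, ?_⟩
  have h0 : ∀ t, Set.indicator {z : Y | B + 1 ≤ powLoss α y z} (fun z => powLoss α y z) (Z ω t) = 0 :=
    fun t => Set.indicator_of_notMem (fun hz => by
      have h1 : B + 1 ≤ powLoss α y (Z ω t) := hz
      linarith [hω t]) _
  simp only [h0, Finset.sum_const_zero, zero_div, EReal.coe_zero, limsup_const]
  exact_mod_cast hε.le

/-- A measurable function taking given values on the targets of the stages. -/
theorem VisitStages.exists_measurable_eq {Y : Type*} [MeasurableSpace Y] (V : VisitStages μ)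
    (y : Y) (c : ℕ → Y) :
    ∃ g : X → Y, Measurable g ∧ (∀ i, ∀ x ∈ V.target i, g x = c i) ∧
      ∀ x, (∀ i, x ∉ V.target i) → g x = y := by
  obtain ⟨g, hg, hgt⟩ := exists_measurable_piecewise
    (fun o : Option ℕ => o.elim (⋃ i, V.target i)ᶜ V.target)
    (fun o => by
      cases o with
      | none => exact (MeasurableSet.iUnion V.measurableSet_target).compl
      | some i => exact V.measurableSet_target i)
    (fun o _ => o.elim y c) (fun o => measurable_const)
    (fun o o' hoo x hx => by
      cases o with
      | none =>
        cases o' with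
        | none => exact absurd rfl hoo
        | some j => exact absurd (Set.mem_iUnion.2 ⟨j, hx.2⟩) hx.1
      | some i =>
        cases o' with
        | none => exact absurd (Set.mem_iUnion.2 ⟨i, hx.1⟩) hx.2
        | some j =>
          exact absurd hx.2 (Set.disjoint_left.1
            (V.disjoint_target fun h => hoo (congrArg some h)) hx.1))
  exact ⟨g, hg, fun i x hx => hgt (some i) hx,
    fun x hx => hgt none fun h => (Set.mem_iUnion.1 h).elim hx⟩

variable [MeasurableSpace Y] {f : LearningRule X Y}

/-- At the end of a successful stage, the excess of the clipped predictions during the visits is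
controlled by the total excess loss. -/
theorem VisitStages.visits_mul_stageExcess_le (hα : 1 ≤ α) (hR : 0 ≤ R)
    {d : ℕ → Y × (ℕ → ℕ → Y)} (hd : ∀ i, dist y (d i).1 ≤ R)
    (hd' : ∀ i n k, dist y ((d i).2 n k) ≤ R) {g : X → Y}
    (hg : ∀ i, ∀ x ∈ V.target i, g x = (d i).1) (hgy : ∀ x, (∀ i, x ∉ V.target i) → g x = y)
    {i : ℕ} {q : (ℕ → X) × (ℕ → f.Seed)} (hq : q.1 ∈ V.success i) :
    V.visits i q.1 * V.stageExcess f α R y i d q ≤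
      ∑ t ∈ Finset.range (V.finish i q.1),
        (powLoss α (f.prediction (V.path f y d q) t) (V.response y d q.1 t) -
          powLoss α (g (q.1 t)) (V.response y d q.1 t)) + V.start i * (3 * R) ^ α := by
  have hN : (0 : ℝ) < V.visits i q.1 := by
    exact_mod_cast (Finset.mem_Icc.1 (V.visits_mem hq)).1
  have hB : 0 ≤ (3 * R) ^ α := by positivity
  have hresp : ∀ t, dist y (V.response y d q.1 t) ≤ R :=
    VisitStages.response_mem (K := {s | dist y s ≤ R}) (by simpa using hR) hd hd' q.1
  have hgR : ∀ x, dist y (g x) ≤ R := fun x => by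
    by_cases hx : ∃ i, x ∈ V.target i
    · obtain ⟨j, hj⟩ := hx
      rw [hg j x hj]
      exact hd j
    · rw [hgy x fun j hj => hx ⟨j, hj⟩, dist_self]
      exact hR
  have hst : V.start i ≤ V.finish i q.1 := (V.start_lt_finish i _ hq).le
  have hsum : ∑ t ∈ Finset.range (V.finish i q.1), (if t < V.start i then (3 * R) ^ α else 0) =
      V.start i * (3 * R) ^ α := by
    rw [← Finset.sum_filter, Finset.sum_const, nsmul_eq_mul]
    congr
    rw [show (Finset.range (V.finish i q.1)).filter (fun t => t < V.start i) =
      Finset.range (V.start i) by ext t; simp; omega, Finset.card_range]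
  rw [VisitStages.stageExcess, mul_div_cancel₀ _ hN.ne', ← hsum, ← Finset.sum_add_distrib]
  refine Finset.sum_le_sum fun t ht => ?_
  rw [Finset.mem_range] at ht
  -- Round by round: at a visit, clipping can only lower the loss; before the stage, the comparison
  -- loss is at most `(3 * R) ^ α`; at the other rounds it vanishes.
  by_cases hv : V.Visit i q.1 t
  · rw [if_pos hv, if_neg (not_lt.2 hv.1), add_zero, hg i _ hv.2]
    exact sub_le_sub_right (powLoss_clip_le hα (hresp t)) _
  · rw [if_neg hv]
    have h0 := powLoss_nonneg (α := α) (f.prediction (V.path f y d q) t) (V.response y d q.1 t)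
    split_ifs with hs
    · have := powLoss_le_bound hα hR (hgR (q.1 t)) (hresp t)
      linarith
    · rw [not_lt] at hs
      -- A round of the stage that is not a visit falls in an earlier target, whose stage is over,
      -- or in no target at all.
      have hgt : g (q.1 t) = V.response y d q.1 t := by
        by_cases hx : ∃ j, q.1 t ∈ V.target j
        · obtain ⟨j, hj⟩ := hx
          have hji : j < i := by
            rcases lt_trichotomy j i with h | h | h
            · exact h
            · exact absurd ⟨hs, h ▸ hj⟩ hv
            · exact absurd hj (V.notMem_target i _ hq t
                (ht.trans_le (V.finish_le_start i _ hq)) j h)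
          have hjs : V.start (j + 1) ≤ t :=
            (V.strictMono_start.monotone (Nat.succ_le_of_lt hji)).trans hs
          have hvj : V.Visit j q.1 t :=
            ⟨(V.strictMono_start.monotone (Nat.le_succ j)).trans hjs, hj⟩
          rw [hg j _ hj, VisitStages.response_of_visit hvj, VisitStages.stageValue, if_neg]
          exact fun h => absurd (h.2.trans_le (V.finish_le_start j _ h.1)) (not_lt.2 hjs)
        · rw [hgy _ fun j hj => hx ⟨j, hj⟩,
            VisitStages.response_of_forall_not fun j hj => hx ⟨j, hj.2⟩]
      rw [hgt, powLoss_self (by linarith)]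
      linarith

/-- If some ball does not satisfy finite-time mean estimation, then universal consistency is only
possible under `CS` processes. -/
theorem SOLAR_subset_CSProcesses [SecondCountableTopology Y] [BorelSpace Y] (hα : 1 ≤ α)
    (hball : ∃ (y : Y) (r : ℝ), ¬ FTiMEOn α (lossBall α y r)) :
    SOLAR X Y α ⊆ CSProcesses X := by
  rintro μ ⟨f, hf⟩
  by_contra hμ
  obtain ⟨V⟩ := nonempty_visitStages hμ
  obtain ⟨y, r, hS⟩ := hball
  obtain ⟨R, hR, hSR⟩ := exists_dist_le_of_mem_lossBall hα y r
  have : Nonempty Y := ⟨y⟩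
  obtain ⟨η, hη, hdata⟩ := VisitStages.exists_stage_data (X := X) hα hR hSR hS
  set M : Measure ((ℕ → X) × (ℕ → f.Seed)) := (μ : Measure (ℕ → X)).prod f.seedMeasure with hM
  have hEm : ∀ i, MeasurableSet (V.success i ×ˢ (Set.univ : Set (ℕ → f.Seed))) := fun i =>
    (V.measurableSet_success i).prod MeasurableSet.univ
  obtain ⟨d, hd⟩ := exists_forall_of_update
    (P := fun i d => (d i).1 ∈ lossBall α y r ∧ (∀ n k, (d i).2 n k ∈ lossBall α y r) ∧
      V.frac * η ≤ ∫ q in V.success i ×ˢ Set.univ, V.stageExcess f α R y i d q ∂M)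
    (fun i d => by
      obtain ⟨v, h1, h2, h3⟩ := hdata V f i d
      exact ⟨v, by simpa using h1, by simpa using h2, h3⟩)
    (fun i d d' hdd h => by
      refine ⟨hdd i le_rfl ▸ h.1, hdd i le_rfl ▸ h.2.1, h.2.2.trans_eq ?_⟩
      exact setIntegral_congr_fun (hEm i) fun q hq => VisitStages.stageExcess_congr hdd hq.1)
  have hd1 : ∀ i, dist y (d i).1 ≤ R := fun i => hSR _ (hd i).1
  have hd2 : ∀ i n k, dist y ((d i).2 n k) ≤ R := fun i n k => hSR _ ((hd i).2.1 n k)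
  have hpath : Measurable (V.path f y d) := V.measurable_path f y measurable_const measurable_id
  have hPp : IsProbabilityMeasure (M.map (V.path f y d)) :=
    Measure.isProbabilityMeasure_map hpath.aemeasurable
  set P : ProbabilityMeasure f.Path := ⟨M.map (V.path f y d), hPp⟩ with hP
  have hresp : ∀ x t, dist y (V.response y d x t) ≤ R :=
    VisitStages.response_mem (K := {s | dist y s ≤ R}) (by simpa using hR) hd1 hd2
  have hB : 0 ≤ (3 * R) ^ α := by positivity
  have hint : EmpiricallyIntegrable α P fun ω : f.Path => ω.2.1 := by
    refine empiricallyIntegrable_of_forall_le (y := y) hB ?_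
    have hms : MeasurableSet {ω : f.Path | ∀ t, powLoss α y (ω.2.1 t) ≤ (3 * R) ^ α} := by
      simp only [Set.ofPred_forall]
      exact MeasurableSet.iInter fun t => measurableSet_le
        (Measurable.powLoss measurable_const (by fun_prop)) measurable_const
    exact (ae_map_iff hpath.aemeasurable hms).2 (ae_of_all _ fun q t =>
      powLoss_le_bound hα hR (by simpa using hR) (hresp q.1 t))
  obtain ⟨g, hgm, hg, hgy⟩ := V.exists_measurable_eq y fun i => (d i).1
  have hcons := ae_of_ae_map hpath.aemeasurable
    (hf P (V.isAdversarialProcess_path f y d rfl) hint g hgm)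
  have hF := V.measurable_stageExcess f α R y
  have hFb := VisitStages.abs_stageExcess_le (f := f) (V := V) hα hR hd1 hd2
  -- Consistency bounds the excess only from above, hence the positive part.
  set G : ℕ → (ℕ → X) × (ℕ → f.Seed) → ℝ := fun i =>
    (V.success i ×ˢ Set.univ).indicator fun q => max (V.stageExcess f α R y i d q) 0 with hG
  have hlim : ∀ᵐ q ∂M, Tendsto (fun i => G i q) atTop (𝓝 0) := by
    filter_upwards [hcons] with q hq
    rw [Metric.tendsto_atTop]
    intro ε hε
    -- The total excess and the rounds before the stage each cost at most this multiple of the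
    -- finish time; dividing by the visits, at least `frac` times the finish time, leaves `2 * ε /
    -- 3`.
    have hε' : 0 < V.frac * ε / 3 := by have := V.frac_pos; positivity
    have hlt : f.excessLoss α g (V.path f y d q) < ((V.frac * ε / 3 : ℝ) : EReal) :=
      hq.trans_lt (by exact_mod_cast hε')
    obtain ⟨T₀, hT₀⟩ := eventually_atTop.1 (sum_le_of_limsup_lt hlt)
    obtain ⟨n, hn⟩ := exists_nat_ge ((3 * R) ^ α / (V.frac * ε / 3))
    refine ⟨max T₀ n, fun i hi => ?_⟩
    have hGn : 0 ≤ G i q := Set.indicator_nonneg (fun _ _ => le_max_right _ _) _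
    rw [Real.dist_eq, sub_zero, abs_of_nonneg hGn]
    by_cases hqs : q.1 ∈ V.success i
    · have hTi : T₀ ≤ V.finish i q.1 := (le_max_left _ _).trans (hi.trans
        (V.strictMono_start.le_apply.trans (V.start_lt_finish i _ hqs).le))
      have h1 := (VisitStages.visits_mul_stageExcess_le (f := f) hα hR hd1 hd2 hg hgy hqs).trans
        (add_le_add (hT₀ _ hTi) le_rfl)
      have hTpos : (0 : ℝ) < V.finish i q.1 :=
        Nat.cast_pos.2 ((Nat.zero_le _).trans_lt (V.start_lt_finish i _ hqs))
      have h2 : (3 * R) ^ α ≤ V.frac * ε / 3 * (i + 1) := by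
        have h3 := (div_le_iff₀ hε').1 hn
        have h4 : (n : ℝ) ≤ i + 1 := by
          exact_mod_cast ((le_max_right _ _).trans hi).trans (Nat.le_succ i)
        nlinarith
      have h3 : (V.start i : ℝ) * (3 * R) ^ α ≤ V.frac * ε / 3 * V.finish i q.1 := by
        have h4 : ((i : ℝ) + 1) * V.start i ≤ V.finish i q.1 := by
          exact_mod_cast V.mul_start_le_finish i _ hqs
        calc (V.start i : ℝ) * (3 * R) ^ α ≤ V.start i * (V.frac * ε / 3 * (i + 1)) := by gcongr
          _ = V.frac * ε / 3 * (((i : ℝ) + 1) * V.start i) := by ring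
          _ ≤ _ := by gcongr
      have h4 := V.frac_mul_finish_le_visits hqs
      have hNpos : (0 : ℝ) < V.visits i q.1 := (mul_pos V.frac_pos hTpos).trans_le h4
      have h5 : V.stageExcess f α R y i d q ≤ 2 * ε / 3 := by
        refine le_of_mul_le_mul_left ?_ hNpos
        calc _ ≤ _ := h1
          _ ≤ V.frac * ε / 3 * V.finish i q.1 + V.frac * ε / 3 * V.finish i q.1 := by gcongr
          _ = V.frac * V.finish i q.1 * (2 * ε / 3) := by ring
          _ ≤ _ := by gcongr
      rw [hG]
      simp only
      rw [Set.indicator_of_mem (Set.mk_mem_prod hqs (Set.mem_univ _))]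
      exact max_lt (by linarith) hε
    · rw [hG]
      simp only
      rw [Set.indicator_of_notMem fun h => hqs h.1]
      exact hε
  have hFi : ∀ i, Integrable (V.stageExcess f α R y i d) M := fun i =>
    Integrable.of_bound (hF i d).aestronglyMeasurable ((3 * R) ^ α)
      (ae_of_all _ fun q => hFb i q)
  have hGm : ∀ i, Measurable (G i) := fun i =>
    ((hF i d).max measurable_const).indicator (hEm i)
  have htend := tendsto_integral_of_dominated_convergence (μ := M) (F := G) (f := fun _ => 0)
    (fun _ => (3 * R) ^ α) (fun i => (hGm i).aestronglyMeasurable) (integrable_const _)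
    (fun i => ae_of_all _ fun q => by
      rw [Real.norm_eq_abs, hG]
      simp only [Set.indicator]
      split_ifs
      · rw [abs_of_nonneg (le_max_right _ _)]
        exact max_le ((le_abs_self _).trans (hFb i q)) hB
      · simpa using hB) hlim
  rw [integral_zero] at htend
  have hle : ∀ i, V.frac * η ≤ ∫ q, G i q ∂M := fun i => by
    refine (hd i).2.2.trans ?_
    rw [hG]
    simp only
    rw [integral_indicator (hEm i)]
    exact integral_mono (hFi i).integrableOn (hFi i).pos_part.integrableOn
      fun q => le_max_left _ _
  exact absurd (ge_of_tendsto' htend hle) (not_le.2 (mul_pos V.frac_pos hη))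

end Necessity

end

theorem mainTheorem2 {X Y : Type u}
    [MetricSpace X] [TopologicalSpace.SeparableSpace X] [MeasurableSpace X] [BorelSpace X]
    [MetricSpace Y] [TopologicalSpace.SeparableSpace Y] [MeasurableSpace Y] [BorelSpace Y]
    (α : ℝ) (hα : 1 ≤ α)
    (hball : ∃ (y : Y) (r : ℝ), ¬ FTiMEOn α (lossBall α y r)) :
    SOLAR X Y α = CSProcesses X ∧
    (∃ (𝒯 : Set (Set X)) (y : ℕ → Y) (e : ℕ → List (ℕ × Set X)) (f : LearningRule X Y),
      IsHedgeData 𝒯 y e ∧ f.IsTruncatedHedge α y e) ∧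
    (∀ (𝒯 : Set (Set X)) (y : ℕ → Y) (e : ℕ → List (ℕ × Set X)) (f : LearningRule X Y),
      IsHedgeData 𝒯 y e → f.IsTruncatedHedge α y e →
        f.OptimisticallyUniversal α ∧ ∀ μ ∈ CSProcesses X, f.UniversallyConsistent α μ) := by
  have : SecondCountableTopology X := UniformSpace.secondCountable_of_separable X
  have : SecondCountableTopology Y := UniformSpace.secondCountable_of_separable Y
  have : Nonempty Y := hball.nonempty
  obtain ⟨𝒯, y, e, hd⟩ := exists_isHedgeData (X := X) (Y := Y)
  have hf := isTruncatedHedge_hedgeRule (Y := Y) (y := y) (α := α) hd.measurableSet_code hd.code_zero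
  have heq : SOLAR X Y α = CSProcesses X :=
    (SOLAR_subset_CSProcesses hα hball).antisymm fun μ hμ =>
      ⟨_, hf.universallyConsistent hα hd hμ⟩
  refine ⟨heq, ⟨𝒯, y, e, _, hd, hf⟩, fun 𝒯 y e f hd hf => ?_⟩
  have h : ∀ μ ∈ CSProcesses X, f.UniversallyConsistent α μ := fun μ hμ =>
    hf.universallyConsistent hα hd hμ
  exact ⟨fun μ hμ => h μ (heq ▸ hμ), h⟩
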